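/- Let $\alpha\in(0,1)$. For a temporal mesh $0=t_0<t_1<\dots<t_M=T$ put $\tau_j:=t_j-t_{j-1}$ ($j\ge1$) and $\rho_j:=\tau_j/\tau_{j-1}$ ($j\ge2$). For $\{U^j\}_{j=0}^M\subset\mathbb R$ and $1\le m\le M$ let $$\delta_t^\alpha U^m:=\frac1{\Gamma(1-\alpha)}\int_0^{t_m}(t_m-s)^{-\alpha}\,\partial_s(\Pi^mU)(s)\,ds ,$$ where $\Pi^1U$ is the linear Lagrange interpolant of $U$ at $\{t_0,t_1\}$ on $(0,t_1)$ and, for $m\ge 2$, $\Pi^mU$ is on $(t_{j-1},t_j)$ the quadratic Lagrange interpolant of $U$ at $\{t_{j-1},t_j,t_{j+1}\}$ if $1\le j<m$, and at $\{t_{m-2},t_{m-1},t_m\}$ if $j=m$. There is a constant $\bar\sigma^*=\bar\sigma^*(\alpha)\in(0,1)$, depending only on $\alpha$, such that the following holds. Let $T>0$, $\lambda\ge0$ and $\gamma\in\mathbb R$ be given, and let the mesh satisfy * $1\le\rho_j\le 2/(1-\bar\sigma^*)-1$ for $2\le j\le M$, and $\rho_{j+1}\le\rho_j$ for $2\le j\le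 M-1$; * $\tau_1\simeq M^{-r}$, $\tau_j\simeq t_j/j$ and $t_j\simeq\tau_1j^r$ for $j=1,\dots,M$, for some $r$ with $1\le r\le(3-\alpha)/\alpha$ if $\gamma>\alpha-1$, or for some $r\ge1$ if $\gamma\le\alpha-1$; * $\lambda\tau_j^\alpha<\{\Gamma(2-\alpha)\}^{-1}$ for $1\le j\le M$. Then $\delta_t^\alpha$ allows an inverse-monotone representation: there are $\beta_j\in[0,1)$ ($1\le j\le M$) and real $\kappa_{m,j}$ ($0\le j\le m$, $1\le m\le M$) such that, for all $\{U^j\}_{j=0}^M$ and all $1\le m\le M$, $$\delta_t^\alpha U^m=\sum_{j=0}^m\kappa_{m,j}V^j,\qquad V^0:=U^0,\quad V^j:=\frac{U^j-\beta_jU^{j-1}}{1-\beta_j}\ (j\ge1),$$ $$\kappa_{m,m}>0,\qquad \sum_{j=0}^m\kappa_{m,j}=0,\qquad \kappa_{m,j}\le0\ \ (0\le j<m).$$ Furthermore, for any such $\{\beta_j\}$, $\{\kappa_{m,j}\}$, and for $\{U^j\}_{j=0}^M$ and $\{W^j\}_{j=0}^M$ with $U^0=W^0=0$, $$\left.\begin{array}{ll}\displaystyle\sum_{j=0}^m\kappa_{m,j}W^j-\lambda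 U^m\lesssim(\tau_1/t_m)^{\gamma+1}&\forall\,1\le m\le M\\[2mm]\displaystyle\frac{U^j-\beta_jU^{j-1}}{1-\beta_j}\le W^j&\forall\,1\le j\le M\end{array}\right\}\ \Rightarrow\ U^j\lesssim\ell_\gamma\,\tau_1\,t_j^{\alpha-1}(\tau_1/t_j)^{\min\{0,\gamma\}}\quad\forall\,1\le j\le M,$$ where $\ell_\gamma:=1+\ln(T/\tau_1)$ if $\gamma=0$ and $\ell_\gamma:=1$ otherwise. Here $a\lesssim b$ means $a\le Cb$ with a positive constant $C$, and $a\simeq b$ means $a\lesssim b$ and $b\lesssim a$. The constant in the conclusion depends only on $\alpha$, $T$, $\lambda$, $\gamma$, $r$, the constants in the mesh assumptions and the constant in the hypothesis on $W$; it does not depend on $M$, on the mesh, or on $\beta$, $\kappa$, $U$, $W$. -/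

import Mathlib

open Set MeasureTheory

noncomputable section

namespace L2Subdiffusion

/-- The Caputo fractional derivative of order `α ∈ (0,1)` at time `x`. -/
def caputo (α : ℝ) (v : ℝ → ℝ) (x : ℝ) : ℝ :=
  1 / Real.Gamma (1 - α) * ∫ s in (0 : ℝ)..x, (x - s) ^ (-α) * deriv v s

/-- The temporal mesh `0 = t 0 < t 1 < ⋯ < t M = T`; values `t j` with `j > M` are irrelevant. -/
structure IsMesh (T : ℝ) (M : ℕ) (t : ℕ → ℝ) : Prop where
  start : t 0 = 0
  final : t M = T
  step : ∀ j, j < M → t j < t (j + 1)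

/-- The step size `τ_j = t_j - t_{j-1}`, used for `j ≥ 1`. -/
def tau (t : ℕ → ℝ) (j : ℕ) : ℝ := t j - t (j - 1)

/-- The step ratio `ρ_j = τ_j / τ_{j-1}`, used for `j ≥ 2`. -/
def rho (t : ℕ → ℝ) (j : ℕ) : ℝ := tau t j / tau t (j - 1)

/-- Indices of the interpolation points of `Π^m` on the interval `(t_{j-1}, t_j)`, `1 ≤ j ≤ m`:
linear `{t_0, t_1}` for `m = 1`, quadratic `{t_{j-1}, t_j, t_{j+1}}` for `j < m`,
and quadratic `{t_{m-2}, t_{m-1}, t_m}` for `j = m > 1`. -/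
def nodes (m j : ℕ) : Finset ℕ :=
  if m = 1 then {0, 1}
  else if j < m then {j - 1, j, j + 1}
  else {m - 2, m - 1, m}

/-- The Lagrange interpolation polynomial of the data `U` used by `Π^m` on `(t_{j-1}, t_j)`. -/
def piece (t U : ℕ → ℝ) (m j : ℕ) : Polynomial ℝ :=
  Lagrange.interpolate (nodes m j) t U

/-- The piecewise-polynomial interpolant `Π^m U` on `(0, t_m]`. -/
def interpolant (t U : ℕ → ℝ) (m : ℕ) (s : ℝ) : ℝ :=
  ∑ j ∈ Finset.Icc 1 m, (Ioc (t (j - 1)) (t j)).indicator (fun x => (piece t U m j).eval x) s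

/-- The L2-type discrete fractional derivative `δ_t^α U^m = ∂_t^α (Π^m U)(t_m)`. -/
def delta (α : ℝ) (t U : ℕ → ℝ) (m : ℕ) : ℝ := caputo α (interpolant t U m) (t m)

/-- The values `V^j`: `V^0 = U^0` and `V^j = (U^j - β_j U^{j-1}) / (1 - β_j)` for `j ≥ 1`. -/
def weighted (β U : ℕ → ℝ) (j : ℕ) : ℝ :=
  if j = 0 then U 0 else (U j - β j * U (j - 1)) / (1 - β j)

/-- The coefficients `β_j` (`1 ≤ j ≤ M`) and `κ_{m,j}` (`0 ≤ j ≤ m ≤ M`, `m ≥ 1`) give an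
inverse-monotone representation of `δ_t^α` on the mesh `t`. -/
structure IsInverseMonotoneRep (α : ℝ) (M : ℕ) (t β : ℕ → ℝ) (κ : ℕ → ℕ → ℝ) : Prop where
  beta_mem : ∀ j, 1 ≤ j → j ≤ M → β j ∈ Ico (0 : ℝ) 1
  rep : ∀ U : ℕ → ℝ, ∀ m, 1 ≤ m → m ≤ M →
    delta α t U m = ∑ j ∈ Finset.range (m + 1), κ m j * weighted β U j
  diag_pos : ∀ m, 1 ≤ m → m ≤ M → 0 < κ m m
  sum_zero : ∀ m, 1 ≤ m → m ≤ M → ∑ j ∈ Finset.range (m + 1), κ m j = 0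
  offdiag_nonpos : ∀ m j, j < m → m ≤ M → κ m j ≤ 0

/-- The step ratios satisfy `1 ≤ ρ_{j+1} ≤ ρ_j ≤ 2 / (1 - σ) - 1` for all `j ≥ 2`. -/
structure StepRatioCondition (σ : ℝ) (M : ℕ) (t : ℕ → ℝ) : Prop where
  one_le : ∀ j, 2 ≤ j → j ≤ M → 1 ≤ rho t j
  le_bound : ∀ j, 2 ≤ j → j ≤ M → rho t j ≤ 2 / (1 - σ) - 1
  antitone : ∀ j, 2 ≤ j → j + 1 ≤ M → rho t (j + 1) ≤ rho t j

/-- The quantities `a` and `b` are equivalent with constant `C`. -/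
def EquivUpTo (C a b : ℝ) : Prop := a ≤ C * b ∧ b ≤ C * a

/-- Quasi-grading of degree `r`, with `C` the constant in all equivalences. -/
structure QuasiGraded (α γ r C : ℝ) (M : ℕ) (t : ℕ → ℝ) : Prop where
  one_le_r : 1 ≤ r
  r_le : α - 1 < γ → r ≤ (3 - α) / α
  tau_one : EquivUpTo C (tau t 1) ((M : ℝ) ^ (-r))
  tau_equiv : ∀ j, 1 ≤ j → j ≤ M → EquivUpTo C (tau t j) (t j / j)
  t_equiv : ∀ j, 1 ≤ j → j ≤ M → EquivUpTo C (t j) (tau t 1 * (j : ℝ) ^ r)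

/-- The factor `ℓ_γ`, equal to `1 + ln (T / τ_1)` for `γ = 0` and to `1` otherwise. -/
def ell (T γ : ℝ) (t : ℕ → ℝ) : ℝ := if γ = 0 then 1 + Real.log (T / tau t 1) else 1

/-- The barrier `ℓ_γ τ_1 t_j^{α-1} (τ_1 / t_j)^{min (0, γ)}`, used for `j ≥ 1`. -/
def barrier (α T γ : ℝ) (t : ℕ → ℝ) (j : ℕ) : ℝ :=
  ell T γ t * tau t 1 * t j ^ (α - 1) * (tau t 1 / t j) ^ min 0 γ

end L2Subdiffusion

end

/-! Let `w_{m,j}` (`weight`) be the coefficient of `U^j - U^{j-1}` in `Γ(1-α) δ_t^α U^m`. If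
`w_{m,j}` increased with `j`, a discrete maximum principle would be immediate, but the parabola on
the last interval lowers `w_{m,m-1}` and can spoil this. Passing to `V^j` with a constant `β`
replaces `w` by its geometric averages `K_{m,j} = (1-β) ∑_k β^k w_{m,j+k}` (`cumWeight`), and `K` is
nondecreasing in `j` exactly when `w_{m,j} ≤ K_{m,j+1}`. Away from the end this follows because
`w_{m,j}` lies between the values of the kernel at the two ends of its interval (`le_weight`,
`weight_le`). The comparisons at the end reduce to explicit inequalities; the delicate one involves
two step ratios, and the optimal `β` satisfies it strictly on a uniform mesh (`uniform_margin`),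
hence, by continuity, for ratios near `1` (`exists_beta`). This closeness determines `σ`.

For stability, testing with a unit sequence shows `κ_{m,m} = (1-β_m) w_{m,m} / Γ(1-α)` in every
representation, so the step restriction gives `λ (1-β_m) < κ_{m,m}` and a comparison principle holds
(`IsInverseMonotoneRep.comparison`). A supersolution `B` with `δ_t^α B^m - λ B^m ≥ (τ_1/t_m)^{γ+1}`
then suffices. This condition does not mention the representation, so `B` may be built with the
constant `β` and used with any other one.

The supersolutions rest on the fact that `t^{α-1}` has zero fractional derivative away from `0`,
while `t^{α-1}` switched on only at `t_j` has derivative at least of order `t_j^α t^{-α-1}` later.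
Superposing these with weights `j^{-1-k} t_j^q` produces a source of size `m^{-k} t_m^{q-1}`.
Quadrature errors are smaller by a power of `m`, up to a logarithm, and are absorbed beyond a fixed
index; a single jump at the first node handles the indices before it (`exists_singular_barrier`).
The total weight is a harmonic sum when `k = q = 0`, which is the origin of `ℓ_0`. For `γ ≤ α-1` the
function `t^{α-1-γ} exp(t/h)` is used instead.

The term `λ U` is absorbed on fine meshes by the barrier with exponential growth. Only finitely many
`M` remain; for each of them a geometric sequence works, since the step restriction then leaves a
gap that is uniform over all admissible meshes with `M` steps. -/

open Set MeasureTheory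

noncomputable section

namespace L2Subdiffusion

/-! ### Moments of the kernel `x ^ (-α)`. -/

section

/-- The kernel moment `∫_a^b x^{-α} dx`. -/
def kernelInt (α a b : ℝ) : ℝ := ∫ x in a..b, x ^ (-α)

/-- The kernel moment `∫_a^b x^{-α} (a + b - 2 x) dx`. -/
def kernelSlope (α a b : ℝ) : ℝ := ∫ x in a..b, x ^ (-α) * (a + b - 2 * x)

variable {α a b x y : ℝ}

/-- This is convexity of the kernel. After scaling to `y = 1` it follows from Bernoulli, `(1 + s) ^
α ≤ 1 + α s`, and `(1 - α s)(1 + α s) ≤ 1`. -/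
theorem rpow_neg_tangent (hα₀ : 0 < α) (hα₁ : α < 1) (hx : 0 < x) (hy : 0 < y) :
    y ^ (-α) - α * y ^ (-α - 1) * (x - y) ≤ x ^ (-α) := by
  set s := (x - y) / y with hs
  have hs1 : 1 + s = x / y := by rw [hs]; field_simp; ring
  have hpos : 0 < 1 + s := by rw [hs1]; positivity
  have h := rpow_one_add_le_one_add_mul_self (s := s) (by linarith) hα₀.le hα₁.le
  have hu : 0 < (1 + s) ^ α := Real.rpow_pos_of_pos hpos _
  have h2 : 1 - α * s ≤ ((1 + s) ^ α)⁻¹ := by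
    rw [← one_div, le_div_iff₀ hu]
    rcases le_total (1 - α * s) 0 with h0 | h0
    · nlinarith
    · nlinarith [mul_le_mul_of_nonneg_left h h0, sq_nonneg (α * s)]
  have h3 : x ^ (-α) = y ^ (-α) * ((1 + s) ^ α)⁻¹ := by
    rw [hs1, ← Real.rpow_neg (by positivity), ← Real.mul_rpow hy.le (by positivity)]
    congr 1
    field_simp
  have h4 : y ^ (-α - 1) * (x - y) = y ^ (-α) * s := by
    rw [hs, Real.rpow_sub_one hy.ne']; ring
  have h5 : 0 < y ^ (-α) := Real.rpow_pos_of_pos hy _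
  rw [h3, mul_assoc, h4]
  nlinarith [mul_le_mul_of_nonneg_left h2 h5.le]

theorem integral_affine (c d e a b : ℝ) :
    ∫ x in a..b, (c + d * (x - e)) = (c + d * ((a + b) / 2 - e)) * (b - a) := by
  rw [intervalIntegral.integral_add (by simp) (Continuous.intervalIntegrable (by fun_prop) _ _),
    intervalIntegral.integral_const_mul, intervalIntegral.integral_sub
    (Continuous.intervalIntegrable (by fun_prop) _ _) (by simp)]
  simp only [intervalIntegral.integral_const, integral_id, smul_eq_mul]
  ring

theorem intervalIntegrable_kernel (hα₁ : α < 1) (a b : ℝ) :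
    IntervalIntegrable (fun x : ℝ => x ^ (-α)) volume a b :=
  intervalIntegral.intervalIntegrable_rpow' (by linarith)

theorem intervalIntegrable_kernel_mul (hα₁ : α < 1) (a b c d : ℝ) :
    IntervalIntegrable (fun x : ℝ => x ^ (-α) * (c - d * x)) volume a b :=
  (intervalIntegrable_kernel hα₁ a b).mul_continuousOn (by fun_prop)

theorem kernelInt_eq (hα₁ : α < 1) (a b : ℝ) :
    kernelInt α a b = (b ^ (1 - α) - a ^ (1 - α)) / (1 - α) := by
  rw [kernelInt, integral_rpow (Or.inl (by linarith))]
  simp only [show -α + 1 = 1 - α by ring]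

theorem kernelInt_zero_left (hα₁ : α < 1) (b : ℝ) :
    kernelInt α 0 b = b ^ (1 - α) / (1 - α) := by
  rw [kernelInt_eq hα₁, Real.zero_rpow (by linarith), sub_zero]

theorem kernelSlope_zero_left (hα₁ : α < 1) (hb : 0 ≤ b) :
    kernelSlope α 0 b = b ^ (2 - α) * (α / ((1 - α) * (2 - α))) := by
  have h1 : kernelSlope α 0 b = ∫ x in (0 : ℝ)..b, (b * x ^ (-α) - 2 * x ^ (1 - α)) := by
    refine intervalIntegral.integral_congr_ae (Filter.Eventually.of_forall fun x hx => ?_)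
    rw [uIoc_of_le hb] at hx
    have : x ^ (1 - α) = x * x ^ (-α) := by
      rw [show 1 - α = 1 + -α by ring, Real.rpow_add hx.1, Real.rpow_one]
    rw [this]; ring
  rw [h1, intervalIntegral.integral_sub ((intervalIntegrable_kernel hα₁ 0 b).const_mul b)
    ((intervalIntegral.intervalIntegrable_rpow' (by linarith)).const_mul 2),
    intervalIntegral.integral_const_mul, intervalIntegral.integral_const_mul,
    integral_rpow (Or.inl (by linarith)), integral_rpow (Or.inl (by linarith)),
    show -α + 1 = 1 - α by ring, show 1 - α + 1 = 2 - α by ring,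
    Real.zero_rpow (by linarith), Real.zero_rpow (by linarith)]
  have h2 : b ^ (2 - α) = b * b ^ (1 - α) := by
    rcases hb.eq_or_lt with rfl | hb
    · rw [Real.zero_rpow (by linarith), zero_mul]
    · rw [show 2 - α = 1 + (1 - α) by ring, Real.rpow_add hb, Real.rpow_one]
  rw [h2]
  have : 1 - α ≠ 0 := by linarith
  have : 2 - α ≠ 0 := by linarith
  field_simp
  ring

theorem kernelInt_smul (hα₁ : α < 1) {τ : ℝ} (hτ : 0 ≤ τ) (ha : 0 ≤ a) (hb : 0 ≤ b) :
    kernelInt α (τ * a) (τ * b) = τ ^ (1 - α) * kernelInt α a b := by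
  rw [kernelInt_eq hα₁, kernelInt_eq hα₁, Real.mul_rpow hτ ha, Real.mul_rpow hτ hb]; ring

/-- Integrate the tangent at `b`. The surplus over `b ^ (-α) * (b - a)` is what later pays for the
curvature corrections in the weights; likewise in `kernelInt_upper`. -/
theorem kernelInt_lower (hα₀ : 0 < α) (hα₁ : α < 1) (ha : 0 ≤ a) (hab : a < b) :
    (b ^ (-α) + α * b ^ (-α - 1) * ((b - a) / 2)) * (b - a) ≤ kernelInt α a b := by
  have hb : 0 < b := ha.trans_lt hab
  have h1 : ∫ x in a..b, (b ^ (-α) + -(α * b ^ (-α - 1)) * (x - b)) =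
      (b ^ (-α) + α * b ^ (-α - 1) * ((b - a) / 2)) * (b - a) := by
    rw [integral_affine]; ring
  rw [← h1]
  refine intervalIntegral.integral_mono_on_of_le_Ioo hab.le
    (Continuous.intervalIntegrable (by fun_prop) _ _) (intervalIntegrable_kernel hα₁ a b)
    fun x hx => ?_
  linarith [rpow_neg_tangent hα₀ hα₁ (ha.trans_lt hx.1) hb]

theorem kernelInt_upper (hα₀ : 0 < α) (hα₁ : α < 1) (ha : 0 < a) (hab : a < b) :
    kernelInt α a b ≤ (a ^ (-α) - α * b ^ (-α - 1) * ((b - a) / 2)) * (b - a) := by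
  have hb : 0 < b := ha.trans hab
  have h1 : ∫ x in a..b, (a ^ (-α) + -(α * b ^ (-α - 1)) * (x - a)) =
      (a ^ (-α) - α * b ^ (-α - 1) * ((b - a) / 2)) * (b - a) := by
    rw [integral_affine]; ring
  rw [← h1]
  refine intervalIntegral.integral_mono_on_of_le_Ioo hab.le
    (intervalIntegrable_kernel hα₁ a b) (Continuous.intervalIntegrable (by fun_prop) _ _)
    fun x hx => ?_
  have hx0 : 0 < x := ha.trans hx.1
  have h := rpow_neg_tangent hα₀ hα₁ ha hx0
  have h2 : b ^ (-α - 1) ≤ x ^ (-α - 1) :=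
    Real.rpow_le_rpow_of_nonpos hx0 hx.2.le (by linarith)
  have h3 : α * b ^ (-α - 1) * (x - a) ≤ α * x ^ (-α - 1) * (x - a) := by
    have : 0 ≤ x - a := by linarith [hx.1]
    gcongr
  linarith

theorem mul_le_kernelInt (hα₀ : 0 < α) (hα₁ : α < 1) (ha : 0 ≤ a) (hab : a < b) :
    b ^ (-α) * (b - a) ≤ kernelInt α a b := by
  refine le_trans ?_ (kernelInt_lower hα₀ hα₁ ha hab)
  have : 0 < b := ha.trans_lt hab
  have : 0 ≤ α * b ^ (-α - 1) * ((b - a) / 2) := by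
    have : 0 < b - a := by linarith
    positivity
  gcongr
  linarith

/-- The affine factor has mean zero and decreases, as does the kernel; replacing the kernel by its
midpoint value can only lower the integral. -/
theorem kernelSlope_nonneg (hα₀ : 0 < α) (hα₁ : α < 1) (ha : 0 ≤ a) (hab : a < b) :
    0 ≤ kernelSlope α a b := by
  have h1 : ∫ x in a..b, ((a + b) / 2) ^ (-α) * (a + b - 2 * x) = 0 := by
    rw [intervalIntegral.integral_const_mul, intervalIntegral.integral_sub (by simp)
      (Continuous.intervalIntegrable (by fun_prop) _ _), intervalIntegral.integral_const_mul]
    simp only [intervalIntegral.integral_const, integral_id, smul_eq_mul]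
    ring
  rw [← h1, kernelSlope]
  refine intervalIntegral.integral_mono_on_of_le_Ioo hab.le
    (Continuous.intervalIntegrable (by fun_prop) _ _)
    (intervalIntegrable_kernel_mul hα₁ a b (a + b) 2) fun x hx => ?_
  have hx0 : 0 < x := ha.trans_lt hx.1
  rcases le_total x ((a + b) / 2) with h | h
  · have := Real.rpow_le_rpow_of_nonpos hx0 h (by linarith : -α ≤ 0)
    have : 0 ≤ a + b - 2 * x := by linarith
    gcongr
  · have h2 := Real.rpow_le_rpow_of_nonpos (by linarith) h (by linarith : -α ≤ 0)
    nlinarith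

/-- Subtract the midpoint value of the kernel, which integrates to zero, and use that `α * a ^ (-α -
1)` is a Lipschitz constant of the kernel on the interval. -/
theorem kernelSlope_upper (hα₀ : 0 < α) (hα₁ : α < 1) (ha : 0 < a) (hab : a < b) :
    kernelSlope α a b ≤ α * a ^ (-α - 1) * ((b - a) ^ 3 / 6) := by
  set c := (a + b) / 2 with hc
  have h1 : ∫ x in a..b, (c ^ (-α) * (a + b - 2 * x) + 2 * (α * a ^ (-α - 1)) * (x - c) ^ 2) =
      α * a ^ (-α - 1) * ((b - a) ^ 3 / 6) := by
    have e : ∫ x in a..b, (x - c) ^ 2 = (b - a) ^ 3 / 12 := by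
      rw [intervalIntegral.integral_comp_sub_right (fun x => x ^ 2) c, integral_pow, hc]
      ring
    rw [intervalIntegral.integral_add (Continuous.intervalIntegrable (by fun_prop) _ _)
      (Continuous.intervalIntegrable (by fun_prop) _ _), intervalIntegral.integral_const_mul,
      intervalIntegral.integral_const_mul, e, intervalIntegral.integral_sub (by simp)
      (Continuous.intervalIntegrable (by fun_prop) _ _), intervalIntegral.integral_const_mul]
    simp only [intervalIntegral.integral_const, integral_id, smul_eq_mul]
    ring
  rw [← h1, kernelSlope]
  refine intervalIntegral.integral_mono_on_of_le_Ioo hab.le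
    (intervalIntegrable_kernel_mul hα₁ a b (a + b) 2)
    (Continuous.intervalIntegrable (by fun_prop) _ _) fun x hx => ?_
  have hx0 : 0 < x := ha.trans hx.1
  have hc0 : 0 < c := by rw [hc]; linarith
  have hac : a ≤ c := by rw [hc]; linarith
  have m1 : x ^ (-α - 1) ≤ a ^ (-α - 1) :=
    Real.rpow_le_rpow_of_nonpos ha hx.1.le (by linarith)
  have m2 : c ^ (-α - 1) ≤ a ^ (-α - 1) := Real.rpow_le_rpow_of_nonpos ha hac (by linarith)
  have e1 : a + b - 2 * x = 2 * (c - x) := by rw [hc]; ring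
  rw [e1]
  rcases le_total x c with h | h
  · have t := rpow_neg_tangent hα₀ hα₁ hc0 hx0
    have : α * x ^ (-α - 1) * (c - x) ≤ α * a ^ (-α - 1) * (c - x) := by
      have : 0 ≤ c - x := by linarith
      gcongr
    nlinarith
  · have t := rpow_neg_tangent hα₀ hα₁ hx0 hc0
    have : α * c ^ (-α - 1) * (x - c) ≤ α * a ^ (-α - 1) * (x - c) := by
      have : 0 ≤ x - c := by linarith
      gcongr
    nlinarith

end

/-! ### The discrete derivative as a weighted sum of increments. -/

section

/-- Contribution of the curvature of `Π^m U` on `(t_{j-1}, t_j)`, `1 ≤ j < m`. -/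
def slopeTerm (α : ℝ) (t : ℕ → ℝ) (m j : ℕ) : ℝ :=
  if 1 ≤ j ∧ j < m then kernelSlope α (t m - t j) (t m - t (j - 1)) / (t (j + 1) - t (j - 1))
  else 0

/-- Contribution of the curvature of `Π^m U` on the last interval `(t_{m-1}, t_m)`. -/
def endTerm (α : ℝ) (t : ℕ → ℝ) (m : ℕ) : ℝ :=
  if 2 ≤ m then kernelSlope α 0 (tau t m) / (t m - t (m - 2)) else 0

/-- The coefficient of `U^j - U^{j-1}` in `Γ(1 - α) δ_t^α U^m`. -/
def weight (α : ℝ) (t : ℕ → ℝ) (m j : ℕ) : ℝ :=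
  (kernelInt α (t m - t j) (t m - t (j - 1)) + slopeTerm α t m (j - 1) - slopeTerm α t m j
    + (if j = m then endTerm α t m else 0) - (if j + 1 = m then endTerm α t m else 0)) / tau t j

/-- First divided difference on `(t_i, t_{i+1})`. -/
def divDiff (t U : ℕ → ℝ) (i : ℕ) : ℝ := (U (i + 1) - U i) / (t (i + 1) - t i)

/-- Second divided difference at `t_i, t_{i+1}, t_{i+2}`. -/
def divDiff₂ (t U : ℕ → ℝ) (i : ℕ) : ℝ := (divDiff t U (i + 1) - divDiff t U i) / (t (i + 2) - t i)

/-- Second divided difference of the data interpolated by `Π^m U` on `(t_i, t_{i+1})`. -/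
def curvature (t U : ℕ → ℝ) (m i : ℕ) : ℝ :=
  if m = 1 then 0 else if i + 1 < m then divDiff₂ t U i else divDiff₂ t U (i - 1)

theorem lt_of_step {t : ℕ → ℝ} {m : ℕ} (ht : ∀ j, j < m → t j < t (j + 1)) {i j : ℕ}
    (hij : i < j) (hj : j ≤ m) : t i < t j := by
  induction j, hij using Nat.le_induction with
  | base => exact ht i (by omega)
  | succ k hk ih => exact (ih (by omega)).trans (ht k (by omega))

theorem le_of_step {t : ℕ → ℝ} {m : ℕ} (ht : ∀ j, j < m → t j < t (j + 1)) {i j : ℕ}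
    (hij : i ≤ j) (hj : j ≤ m) : t i ≤ t j := by
  rcases hij.eq_or_lt with rfl | h
  · exact le_rfl
  · exact (lt_of_step ht h hj).le

open Polynomial in
theorem interpolate_two {t : ℕ → ℝ} (U : ℕ → ℝ) (h : t 0 < t 1) :
    Lagrange.interpolate ({0, 1} : Finset ℕ) t U = C (U 0) + C (divDiff t U 0) * (X - C (t 0)) := by
  symm
  refine Lagrange.eq_interpolate_of_eval_eq _ ?_ ?_ ?_
  · intro x hx y hy hxy
    simp at hx hy
    rcases hx with rfl | rfl <;> rcases hy with rfl | rfl <;> first | rfl | (exfalso; linarith)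
  · rw [Finset.card_pair (by simp)]
    refine lt_of_le_of_lt (b := 1) ?_ (by norm_num)
    compute_degree
  · intro i hi
    simp at hi
    have : t 1 - t 0 ≠ 0 := by linarith
    rcases hi with rfl | rfl
    · simp
    · simp [divDiff]; field_simp; ring

open Polynomial in
theorem interpolate_three {t : ℕ → ℝ} (U : ℕ → ℝ) {k : ℕ} (h₁ : t k < t (k + 1))
    (h₂ : t (k + 1) < t (k + 2)) :
    Lagrange.interpolate ({k, k + 1, k + 2} : Finset ℕ) t U =
      C (U (k + 1)) + C (divDiff t U k) * (X - C (t (k + 1)))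
        + C (divDiff₂ t U k) * ((X - C (t k)) * (X - C (t (k + 1)))) := by
  symm
  refine Lagrange.eq_interpolate_of_eval_eq _ ?_ ?_ ?_
  · intro x hx y hy hxy
    simp at hx hy
    rcases hx with rfl | rfl | rfl <;> rcases hy with rfl | rfl | rfl <;>
      first | rfl | (exfalso; linarith)
  · have : ({k, k + 1, k + 2} : Finset ℕ).card = 3 := by
      rw [Finset.card_eq_three]; exact ⟨k, k + 1, k + 2, by simp, by simp, by simp, rfl⟩
    rw [this]
    refine lt_of_le_of_lt (b := 2) ?_ (by norm_num)
    compute_degree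
  · intro i hi
    simp at hi
    have n1 : t (k + 1) - t k ≠ 0 := by linarith
    have n2 : t (k + 2) - t (k + 1) ≠ 0 := by linarith
    have n3 : t (k + 2) - t k ≠ 0 := by linarith
    rcases hi with rfl | rfl | rfl
    · simp [divDiff]; field_simp; ring
    · simp
    · simp [divDiff, divDiff₂]; field_simp; ring

open Polynomial in
-- On each interval the derivative is the chord slope plus the curvature times an affine function
-- vanishing at the midpoint, so the two parts integrate to `kernelInt` and `kernelSlope`. On the
-- last interval the parabola is that of the preceding one and is rewritten around the last chord.
theorem eval_derivative_piece {t : ℕ → ℝ} (U : ℕ → ℝ) {m i : ℕ}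
    (ht : ∀ j, j < m → t j < t (j + 1)) (hi : i < m) (s : ℝ) :
    (derivative (piece t U m (i + 1))).eval s =
      divDiff t U i + curvature t U m i * (2 * s - t i - t (i + 1)) := by
  rcases Nat.lt_or_ge m 2 with h | h
  · obtain rfl : m = 1 := by omega
    obtain rfl : i = 0 := by omega
    simp [piece, nodes, curvature, interpolate_two U (ht 0 (by omega))]
  · rcases Nat.lt_or_ge (i + 1) m with h' | h'
    · have : nodes m (i + 1) = {i, i + 1, i + 2} := by
        simp [nodes, show m ≠ 1 by omega, h']
      rw [piece, this, interpolate_three U (ht i (by omega)) (ht (i + 1) (by omega))]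
      simp only [curvature, show m ≠ 1 by omega, h', if_true, if_false, derivative_add,
        derivative_mul, derivative_C, derivative_sub, derivative_X, eval_add, eval_mul, eval_C,
        eval_X, eval_sub, eval_zero, eval_one]
      ring
    · obtain ⟨k, rfl⟩ : ∃ k, m = k + 2 := ⟨m - 2, by omega⟩
      obtain rfl : i = k + 1 := by omega
      have : nodes (k + 2) (k + 1 + 1) = {k, k + 1, k + 2} := by
        simp [nodes]
      rw [piece, this, interpolate_three U (ht k (by omega)) (ht (k + 1) (by omega))]
      have n3 : t (k + 2) - t k ≠ 0 := by
        have := ht k (by omega)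
        have := ht (k + 1) (by omega)
        have : t (k + 1 + 1) = t (k + 2) := rfl
        linarith
      have : divDiff t U (k + 1) = divDiff t U k + divDiff₂ t U k * (t (k + 2) - t k) := by
        rw [divDiff₂]; field_simp; ring
      simp [curvature, this]
      ring

theorem deriv_interpolant {t : ℕ → ℝ} (U : ℕ → ℝ) {m i : ℕ}
    (ht : ∀ j, j < m → t j < t (j + 1)) (hi : i < m) {s : ℝ} (hs : s ∈ Ioo (t i) (t (i + 1))) :
    deriv (interpolant t U m) s =
      divDiff t U i + curvature t U m i * (2 * s - t i - t (i + 1)) := by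
  have h : interpolant t U m =ᶠ[nhds s] fun x => (piece t U m (i + 1)).eval x := by
    filter_upwards [Ioo_mem_nhds hs.1 hs.2] with x hx
    rw [interpolant, Finset.sum_eq_single (i + 1)]
    · rw [indicator_of_mem (by exact ⟨hx.1, hx.2.le⟩)]
    · intro j hj hne
      rw [Finset.mem_Icc] at hj
      rw [indicator_of_notMem]
      rintro ⟨h1, h2⟩
      rcases lt_or_gt_of_ne hne with h | h
      · have := le_of_step ht (show j ≤ i by omega) hi.le
        linarith [hx.1]
      · have := le_of_step ht (show i + 1 ≤ j - 1 by omega) (by omega)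
        linarith [hx.2]
    · intro hn
      exact absurd (Finset.mem_Icc.mpr ⟨by omega, by omega⟩) hn
  rw [h.deriv_eq, Polynomial.deriv, eval_derivative_piece U ht hi]

theorem integral_kernel_affine {α : ℝ} (hα₁ : α < 1) (d c u v T : ℝ) :
    ∫ s in u..v, (T - s) ^ (-α) * (d + c * (2 * s - u - v)) =
      d * kernelInt α (T - v) (T - u) + c * kernelSlope α (T - v) (T - u) := by
  have h := intervalIntegral.integral_comp_sub_left (a := u) (b := v)
    (fun x => d * x ^ (-α) + c * (x ^ (-α) * ((T - v) + (T - u) - 2 * x))) T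
  rw [intervalIntegral.integral_add ((intervalIntegrable_kernel hα₁ _ _).const_mul _)
    ((intervalIntegrable_kernel_mul hα₁ _ _ _ _).const_mul _),
    intervalIntegral.integral_const_mul, intervalIntegral.integral_const_mul] at h
  rw [kernelInt, kernelSlope, ← h]
  congr 1
  ext s
  ring

theorem intervalIntegrable_kernel_affine {α : ℝ} (hα₁ : α < 1) (d c u v T : ℝ) :
    IntervalIntegrable (fun s => (T - s) ^ (-α) * (d + c * (2 * s - u - v))) volume u v := by
  have h := (intervalIntegrable_kernel hα₁ (T - u) (T - v)).comp_sub_left T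
  simp only [sub_sub_cancel] at h
  exact h.mul_continuousOn (by fun_prop)

theorem sum_range_succ_sub_mul (s q : ℕ → ℝ) (N : ℕ) :
    ∑ i ∈ Finset.range (N + 1), (s i - s (i + 1)) * q i =
      s 0 * q 0 - s (N + 1) * q N + ∑ i ∈ Finset.range N, s (i + 1) * (q (i + 1) - q i) := by
  induction N with
  | zero => simp; ring
  | succ n ih => rw [Finset.sum_range_succ, ih, Finset.sum_range_succ _ n]; ring

/-- Each curvature is a multiple of the difference of two neighbouring chord slopes. Abel summation
therefore moves every slope moment to the coefficients of two consecutive increments, with opposite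
signs. -/
theorem delta_eq_sum {α : ℝ} (hα₁ : α < 1) {t : ℕ → ℝ} (U : ℕ → ℝ) {m : ℕ} (h0 : t 0 = 0)
    (hm : 1 ≤ m) (ht : ∀ j, j < m → t j < t (j + 1)) :
    delta α t U m =
      1 / Real.Gamma (1 - α) * ∑ i ∈ Finset.range m, weight α t m (i + 1) * (U (i + 1) - U i) := by
  rw [delta, caputo]
  congr 1
  have key : ∀ i < m, EqOn (fun s => (t m - s) ^ (-α) *
      (divDiff t U i + curvature t U m i * (2 * s - t i - t (i + 1))))
      (fun s => (t m - s) ^ (-α) * deriv (interpolant t U m) s) (uIoo (t i) (t (i + 1))) := by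
    intro i hi s hs
    rw [uIoo_of_le (ht i hi).le] at hs
    simp only [deriv_interpolant U ht hi hs]
  have hint := fun i (hi : i < m) => (intervalIntegrable_kernel_affine hα₁ (divDiff t U i)
    (curvature t U m i) (t i) (t (i + 1)) (t m)).congr_uIoo (key i hi)
  rw [← h0, ← intervalIntegral.sum_integral_adjacent_intervals hint]
  have e1 : ∀ i ∈ Finset.range m, ∫ s in t i..t (i + 1),
      (t m - s) ^ (-α) * deriv (interpolant t U m) s =
      divDiff t U i * kernelInt α (t m - t (i + 1)) (t m - t i)
        + curvature t U m i * kernelSlope α (t m - t (i + 1)) (t m - t i) := by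
    intro i hi
    rw [← intervalIntegral.integral_congr_uIoo (key i (Finset.mem_range.mp hi)),
      integral_kernel_affine hα₁]
  rw [Finset.sum_congr rfl e1]
  have e2 : ∀ i ∈ Finset.range m, weight α t m (i + 1) * (U (i + 1) - U i) =
      divDiff t U i * kernelInt α (t m - t (i + 1)) (t m - t i)
      + ((slopeTerm α t m i - slopeTerm α t m (i + 1)) * divDiff t U i
      + ((if i + 1 = m then endTerm α t m else 0) - (if i + 1 + 1 = m then endTerm α t m else 0))
        * divDiff t U i) := by
    intro i hi
    simp only [weight, divDiff, tau, Nat.add_sub_cancel]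
    ring
  rw [Finset.sum_congr rfl e2, Finset.sum_add_distrib, Finset.sum_add_distrib]
  congr 1
  rcases Nat.lt_or_ge m 2 with h | h
  · obtain rfl : m = 1 := by omega
    simp [curvature, slopeTerm, endTerm]
  · obtain ⟨n, rfl⟩ : ∃ n, m = n + 2 := ⟨m - 2, by omega⟩
    rw [Finset.sum_add_distrib, sum_range_succ_sub_mul _ _ (n + 1), Finset.sum_range_succ]
    have z0 : slopeTerm α t (n + 2) 0 = 0 := by simp [slopeTerm]
    have z1 : slopeTerm α t (n + 2) (n + 1 + 1) = 0 := by simp [slopeTerm]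
    have e3 : ∑ i ∈ Finset.range (n + 1 + 1), ((if i + 1 = n + 2 then endTerm α t (n + 2) else 0)
        - (if i + 1 + 1 = n + 2 then endTerm α t (n + 2) else 0)) * divDiff t U i =
        endTerm α t (n + 2) * (divDiff t U (n + 1) - divDiff t U n) := by
      rw [Finset.sum_range_succ, Finset.sum_range_succ, Finset.sum_eq_zero]
      · simp; ring
      · intro i hi
        have := Finset.mem_range.mp hi
        simp [show i ≠ n by omega, show i ≠ n + 1 by omega]
    rw [z0, z1, e3]
    have e4 : curvature t U (n + 2) (n + 1) *
        kernelSlope α (t (n + 2) - t (n + 1 + 1)) (t (n + 2) - t (n + 1)) =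
        endTerm α t (n + 2) * (divDiff t U (n + 1) - divDiff t U n) := by
      simp [curvature, endTerm, divDiff₂, tau]
      ring
    rw [e4, zero_mul, zero_mul, sub_zero, zero_add]
    congr 1
    refine Finset.sum_congr rfl fun i hi => ?_
    have := Finset.mem_range.mp hi
    simp [curvature, slopeTerm, divDiff₂, show i < n + 1 by omega]
    ring

end

/-! ### The numerical inequality on the uniform mesh and the choice of `β`. -/

section

/-- Taylor bounds for `(3/4) exp(α log(4/3))` here and for `(1/2) exp(α log 2)` in `le_half_rpow`,
with rational bounds for the logarithms, reduce `uniform_margin` to polynomials in `α`. -/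
theorem three_fourths_rpow_le {α : ℝ} (hα₀ : 0 < α) (hα₁ : α < 1) :
    (3 / 4 : ℝ) ^ (1 - α) ≤
      3 / 4 * (1 + 0.288 * α + (0.288 * α) ^ 2 / 2 + 2 * (0.288 * α) ^ 3 / 9) := by
  have hlog : Real.log (4 / 3) ≤ 0.288 := by
    rw [Real.log_le_iff_le_exp (by norm_num)]
    have := Real.sum_le_exp_of_nonneg (x := 0.288) (by norm_num) 4
    refine le_trans ?_ this
    norm_num [Finset.sum_range_succ, Nat.factorial]
  have h1 : (3 / 4 : ℝ) ^ (1 - α) = 3 / 4 * Real.exp (Real.log (4 / 3) * α) := by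
    rw [Real.rpow_sub (by norm_num), Real.rpow_one, ← Real.rpow_def_of_pos (by norm_num),
      show (4 / 3 : ℝ) = (3 / 4)⁻¹ by norm_num, Real.inv_rpow (by norm_num), div_eq_mul_inv]
  have h2 : Real.exp (Real.log (4 / 3) * α) ≤ Real.exp (0.288 * α) := by gcongr
  have h3 := Real.exp_bound' (x := 0.288 * α) (by positivity) (by linarith) (n := 3) (by norm_num)
  norm_num [Finset.sum_range_succ, Nat.factorial] at h3
  rw [h1]
  have : Real.exp (0.288 * α) ≤
      1 + 0.288 * α + (0.288 * α) ^ 2 / 2 + 2 * (0.288 * α) ^ 3 / 9 := by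
    norm_num
    linarith
  linarith

theorem le_half_rpow {α : ℝ} (hα₀ : 0 < α) :
    1 / 2 * (1 + 0.693 * α + (0.693 * α) ^ 2 / 2 + (0.693 * α) ^ 3 / 6) ≤
      (1 / 2 : ℝ) ^ (1 - α) := by
  have hlog : 0.693 ≤ Real.log 2 := by linarith [Real.log_two_gt_d9]
  have h1 : (1 / 2 : ℝ) ^ (1 - α) = 1 / 2 * Real.exp (Real.log 2 * α) := by
    have h2 : (2 : ℝ) ^ α = ((1 / 2) ^ α)⁻¹ := by
      rw [← Real.inv_rpow (by norm_num)]; norm_num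
    rw [Real.rpow_sub (by norm_num), Real.rpow_one, ← Real.rpow_def_of_pos (by norm_num), h2,
      div_eq_mul_inv]
  have h2 : Real.exp (0.693 * α) ≤ Real.exp (Real.log 2 * α) := by gcongr
  have h3 := Real.sum_le_exp_of_nonneg (x := 0.693 * α) (by positivity) 4
  norm_num [Finset.sum_range_succ, Nat.factorial] at h3
  rw [h1]
  norm_num at h2 ⊢
  have h4 := Real.exp_le_exp.mpr h2
  linarith

/-- This is the last comparison with all ratios equal to `1` and `β` optimal. Both sides tend to `4`
as `α → 0`, so crude bounds do not suffice. After division by `4 ^ (1 - α)` the linear and quadratic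
terms in `α` decide. -/
theorem uniform_margin {α : ℝ} (hα₀ : 0 < α) (hα₁ : α < 1) :
    4 * (1 + α / (2 * (2 - α)) + (1 - α) * α / 12) *
      ((3 : ℝ) ^ (1 - α) - 2 ^ (1 - α) + (1 - α) * α * 3 ^ (-α - 1) / 12) < 4 ^ (1 - α) := by
  have u := three_fourths_rpow_le hα₀ hα₁
  have l := le_half_rpow hα₀
  set c := (3 / 4 : ℝ) ^ (1 - α) with hc
  set d := (1 / 2 : ℝ) ^ (1 - α) with hd
  have hc1 : c ≤ 1 := Real.rpow_le_one (by norm_num) (by norm_num) (by linarith)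
  have h4 : (0 : ℝ) < 4 ^ (1 - α) := Real.rpow_pos_of_pos (by norm_num) _
  have e3 : (3 : ℝ) ^ (1 - α) = c * 4 ^ (1 - α) := by
    rw [hc, ← Real.mul_rpow (by norm_num) (by norm_num)]; norm_num
  have e2 : (2 : ℝ) ^ (1 - α) = d * 4 ^ (1 - α) := by
    rw [hd, ← Real.mul_rpow (by norm_num) (by norm_num)]; norm_num
  have e33 : (3 : ℝ) ^ (-α - 1) = c * 4 ^ (1 - α) / 9 := by
    rw [← e3, show (1 - α) = (-α - 1) + 2 by ring, Real.rpow_add (by norm_num)]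
    norm_num
  rw [e3, e2, e33]
  have hp : 0 < 2 - α := by linarith
  have key : 4 * (1 + α / (2 * (2 - α)) + (1 - α) * α / 12) *
      (c - d + (1 - α) * α * c / 108) < 1 := by
    have h1 : c - d + (1 - α) * α * c / 108 ≤ 1 / 4 - 0.121 * α - 0.088 * α ^ 2 := by
      have : (1 - α) * α * c ≤ α := by
        have : (1 - α) * c ≤ 1 := by nlinarith
        nlinarith
      have h3 : 0 < α ^ 3 := by positivity
      have h2 : 0 < α ^ 2 := by positivity
      norm_num at u l ⊢
      nlinarith
    have e : 1 + α / (2 * (2 - α)) + (1 - α) * α / 12 =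
        (2 - α / 3 - α ^ 2 / 4 + α ^ 3 / 12) / (2 - α) := by
      field_simp; ring
    have hα2 : α ^ 2 < 1 := by nlinarith
    have hα3 : α ^ 3 ≤ α ^ 2 := by nlinarith [sq_nonneg α]
    have hq : 0 < 2 - α / 3 - α ^ 2 / 4 + α ^ 3 / 12 := by
      have : 0 < α ^ 3 := by positivity
      linarith
    rw [e]
    refine lt_of_le_of_lt (mul_le_mul_of_nonneg_left h1 (by positivity)) ?_
    rw [mul_div_assoc', div_mul_eq_mul_div, div_lt_one hp]
    have h5 : (2 - α / 3 - α ^ 2 / 4 + α ^ 3 / 12) ≤ 2 - α / 3 - α ^ 2 / 6 := by linarith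
    have h6 : 0 ≤ 1 / 4 - 0.121 * α - 0.088 * α ^ 2 := by norm_num; linarith
    have h7 := mul_le_mul_of_nonneg_right h5 h6
    have h8 : α * α ^ 2 ≤ α * 1 := by gcongr
    have h9 : α * α ^ 3 ≤ α * 1 := by nlinarith
    norm_num at h7 h6 ⊢
    nlinarith
  calc _ = 4 * (1 + α / (2 * (2 - α)) + (1 - α) * α / 12) *
      (c - d + (1 - α) * α * c / 108) * 4 ^ (1 - α) := by ring
    _ < 1 * 4 ^ (1 - α) := by gcongr
    _ = _ := one_mul _

/-- On nearly uniform meshes a constant `β` makes the three most recent coefficients of the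
transformed operator increasing; `x`, `y` are the last two step sizes divided by `τ_m`. -/
theorem exists_beta {α : ℝ} (hα₀ : 0 < α) (hα₁ : α < 1) :
    ∃ β : ℝ, 0 < β ∧ β < 1 ∧ 1 ≤ (1 - β) * (1 / (1 - α) + α / ((1 - α) * (2 - α)) / 2) ∧
      ∃ ε : ℝ, 0 < ε ∧ ε < 1 ∧ ∀ x y : ℝ, 1 - ε ≤ x → x ≤ 1 → 1 - ε ≤ y → y ≤ 1 →
        kernelInt α (1 + x) (1 + x + y) / y + α * (1 + x + y) ^ (-α - 1) * (y / 12) ≤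
          (1 - β) * (β / (1 - α) + kernelInt α 1 (1 + x) / x -
            (1 / x - β) * ((α / ((1 - α) * (2 - α)) + α * x ^ 3 / 6) / (1 + x))) := by
  have hb : 0 < 1 - α := by linarith
  have hb2 : 0 < 2 - α := by linarith
  set P := 1 + α / (2 * (2 - α)) + (1 - α) * α / 12 with hP
  have hP1 : 1 ≤ P := by
    have : 0 ≤ α / (2 * (2 - α)) := by positivity
    have : 0 ≤ (1 - α) * α / 12 := by positivity
    linarith
  have h2 : (0 : ℝ) < 2 ^ (1 - α) := Real.rpow_pos_of_pos (by norm_num) _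
  have h2lt : (2 : ℝ) ^ (1 - α) < 2 := by
    calc (2 : ℝ) ^ (1 - α) < 2 ^ (1 : ℝ) := Real.rpow_lt_rpow_of_exponent_lt (by norm_num)
          (by linarith)
      _ = 2 := Real.rpow_one _
  -- For `x = y = 1` the right side of the margin is `s (2 ^ (1 - α) - s P) / (1 - α)` with `s = 1 -
  -- β`; this `β` maximizes it, with value `4 ^ (1 - α) / (4 P (1 - α))`.
  refine ⟨1 - 2 ^ (1 - α) / (2 * P), ?_, ?_, ?_, ?_⟩
  · rw [sub_pos, div_lt_one (by positivity)]; linarith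
  · have : 0 < 2 ^ (1 - α) / (2 * P) := by positivity
    linarith
  · rw [sub_sub_cancel]
    have hl : 2 * (1 - 0.7 * α) ≤ (2 : ℝ) ^ (1 - α) := by
      rw [Real.rpow_sub (by norm_num), Real.rpow_one, div_eq_mul_inv, ← Real.rpow_neg (by norm_num),
        Real.rpow_def_of_pos (by norm_num)]
      have := Real.add_one_le_exp (Real.log 2 * -α)
      have := Real.log_two_lt_d9
      norm_num at *
      nlinarith
    set p := 1 + α / (2 * (2 - α)) with hp
    have hp1 : 1 ≤ p := by
      have : 0 ≤ α / (2 * (2 - α)) := by positivity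
      linarith
    have e : 1 / (1 - α) + α / ((1 - α) * (2 - α)) / 2 = p / (1 - α) := by
      rw [hp]; field_simp
    rw [e, div_mul_div_comm, one_le_div (by positivity)]
    have hPp : P = p + (1 - α) * α / 12 := hP
    rw [hPp]
    have h1 : 2 * (1 - 0.7 * α) * p ≤ 2 ^ (1 - α) * p := by gcongr
    have h3 : (1 - α) ^ 2 ≤ 1 := by nlinarith
    norm_num at h1 ⊢
    nlinarith [mul_le_mul_of_nonneg_left h3 hα₀.le, mul_le_mul_of_nonneg_left hp1 hα₀.le]
  · set β := 1 - 2 ^ (1 - α) / (2 * P) with hβ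
    -- `F` is the right side minus the left side, as a function of the scaled steps. It is positive
    -- and continuous at `(1, 1)`, which provides `ε`.
    let F : ℝ × ℝ → ℝ := fun z =>
      (1 - β) * (β / (1 - α) + (((1 + z.1) ^ (1 - α) - 1 ^ (1 - α)) / (1 - α)) / z.1 -
            (1 / z.1 - β) * ((α / ((1 - α) * (2 - α)) + α * z.1 ^ 3 / 6) / (1 + z.1))) -
      ((((1 + z.1 + z.2) ^ (1 - α) - (1 + z.1) ^ (1 - α)) / (1 - α)) / z.2 +
        α * (1 + z.1 + z.2) ^ (-α - 1) * (z.2 / 12))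
    have hF : 0 < F (1, 1) := by
      have m := uniform_margin hα₀ hα₁
      have e4 : (4 : ℝ) ^ (1 - α) = 2 ^ (1 - α) * 2 ^ (1 - α) := by
        rw [← Real.mul_rpow (by norm_num) (by norm_num)]; norm_num
      have hβ' : 1 - β = 2 ^ (1 - α) / (2 * P) := by rw [hβ]; ring
      have e1 : (1 - β) * (β / (1 - α) + (((1 + 1 : ℝ) ^ (1 - α) - 1 ^ (1 - α)) / (1 - α)) / 1 -
            (1 / 1 - β) * ((α / ((1 - α) * (2 - α)) + α * 1 ^ 3 / 6) / (1 + 1))) =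
            4 ^ (1 - α) / (4 * P * (1 - α)) := by
        have q : (α / ((1 - α) * (2 - α)) + α * 1 ^ 3 / 6) / (1 + 1) = (P - 1) / (1 - α) := by
          rw [hP]; field_simp; ring
        have hβ2 : β = 1 - 2 ^ (1 - α) / (2 * P) := hβ
        rw [q, div_one (1 : ℝ), hβ', hβ2, e4, Real.one_rpow, show (1 + 1 : ℝ) = 2 by norm_num]
        field_simp
        ring
      show 0 < _ - _
      rw [sub_pos]
      simp only [e1]
      rw [lt_div_iff₀ (by positivity)]
      rw [← hP] at m
      refine lt_of_eq_of_lt ?_ m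
      rw [show (1 + 1 + 1 : ℝ) = 3 by norm_num, show (1 + 1 : ℝ) = 2 by norm_num]
      field_simp
    have hcont : ContinuousAt F (1, 1) := by
      have c1 : ContinuousAt (fun z : ℝ × ℝ => (1 + z.1) ^ (1 - α)) (1, 1) :=
        ContinuousAt.rpow_const (by fun_prop) (Or.inl (by norm_num))
      have c2 : ContinuousAt (fun z : ℝ × ℝ => (1 + z.1 + z.2) ^ (1 - α)) (1, 1) :=
        ContinuousAt.rpow_const (by fun_prop) (Or.inl (by norm_num))
      have c3 : ContinuousAt (fun z : ℝ × ℝ => (1 + z.1 + z.2) ^ (-α - 1)) (1, 1) :=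
        ContinuousAt.rpow_const (by fun_prop) (Or.inl (by norm_num))
      have n1 : (1, 1).1 ≠ (0 : ℝ) := by norm_num
      have n2 : (1, 1).2 ≠ (0 : ℝ) := by norm_num
      have n3 : (1 : ℝ) + (1, 1).1 ≠ (0 : ℝ) := by norm_num
      have f1 : ContinuousAt (fun z : ℝ × ℝ => z.1) (1, 1) := by fun_prop
      have f2 : ContinuousAt (fun z : ℝ × ℝ => z.2) (1, 1) := by fun_prop
      have k : ∀ c : ℝ, ContinuousAt (fun _ : ℝ × ℝ => c) (1, 1) := fun c => continuousAt_const
      refine ContinuousAt.sub ?_ ?_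
      · refine (k _).mul (((k _).add ((((c1.sub (k _)).div_const _)).div f1 n1)).sub ?_)
        refine (((k _).div f1 n1).sub (k _)).mul ?_
        exact ((k _).add (((k _).mul (f1.pow 3)).div_const _)).div ((k _).add f1) n3
      · exact (((c2.sub c1).div_const _).div f2 n2).add (((k _).mul c3).mul (f2.div_const _))
    have hev := hcont.eventually (lt_mem_nhds hF)
    rw [Metric.eventually_nhds_iff] at hev
    obtain ⟨ε, hε, h⟩ := hev
    refine ⟨min (ε / 2) (1 / 2), by positivity, by
      linarith [min_le_right (ε / 2) (1 / 2 : ℝ)], fun x y hx hx1 hy hy1 => ?_⟩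
    have hm := min_le_left (ε / 2) (1 / 2 : ℝ)
    have := @h (x, y) (by
      rw [Prod.dist_eq, max_lt_iff, Real.dist_eq, Real.dist_eq, abs_lt, abs_lt]
      constructor <;> constructor <;> simp only <;> linarith)
    have := this.le
    simp only [F, sub_nonneg] at this
    rw [kernelInt_eq hα₁, kernelInt_eq hα₁]
    exact this

end

/-! ### Pointwise bounds for the weights on meshes with slowly growing steps. -/

section

/-- Meshes with nondecreasing step sizes, and step ratios at most `1 / (1 - ε)`. -/
structure NearUniformMesh (ε : ℝ) (M : ℕ) (t : ℕ → ℝ) : Prop where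
  start : t 0 = 0
  step : ∀ j, j < M → t j < t (j + 1)
  mono : ∀ j, j + 2 ≤ M → tau t (j + 1) ≤ tau t (j + 2)
  ratio : ∀ j, j + 2 ≤ M → (1 - ε) * tau t (j + 2) ≤ tau t (j + 1)

theorem tau_succ (t : ℕ → ℝ) (j : ℕ) : tau t (j + 1) = t (j + 1) - t j := rfl

theorem tau_zero (t : ℕ → ℝ) : tau t 0 = 0 := by simp [tau]

variable {α β ε : ℝ} {M m : ℕ} {t : ℕ → ℝ}

namespace NearUniformMesh

theorem tau_pos (h : NearUniformMesh ε M t) {j : ℕ} (hj : j < M) : 0 < tau t (j + 1) :=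
  sub_pos.mpr (h.step j hj)

theorem tau_le_tau (h : NearUniformMesh ε M t) {i j : ℕ} (hij : i ≤ j) (hj : j ≤ M) :
    tau t i ≤ tau t j := by
  induction j, hij using Nat.le_induction with
  | base => exact le_rfl
  | succ k hk ih =>
    refine (ih (by omega)).trans ?_
    rcases k with _ | k
    · rw [tau_zero]; exact (h.tau_pos (by omega)).le
    · exact h.mono k hj

theorem lt (h : NearUniformMesh ε M t) {i j : ℕ} (hij : i < j) (hj : j ≤ M) : t i < t j :=
  lt_of_step h.step hij hj

theorem le (h : NearUniformMesh ε M t) {i j : ℕ} (hij : i ≤ j) (hj : j ≤ M) : t i ≤ t j :=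
  le_of_step h.step hij hj

theorem pos (h : NearUniformMesh ε M t) {j : ℕ} (hj : 1 ≤ j) (hjM : j ≤ M) : 0 < t j := by
  rw [← h.start]; exact h.lt hj hjM

theorem mono_right (h : NearUniformMesh ε M t) (hm : m ≤ M) : NearUniformMesh ε m t :=
  ⟨h.start, fun j hj => h.step j (by omega), fun j hj => h.mono j (by omega),
    fun j hj => h.ratio j (by omega)⟩

end NearUniformMesh

theorem slopeTerm_nonneg (hα₀ : 0 < α) (hα₁ : α < 1) (h : NearUniformMesh ε m t) (j : ℕ) :
    0 ≤ slopeTerm α t m j := by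
  unfold slopeTerm
  split_ifs with hj
  · have h1 := h.lt hj.2 le_rfl
    have h2 := h.lt (show j - 1 < j by omega) hj.2.le
    have h3 := h.lt (show j - 1 < j + 1 by omega) (by omega)
    exact div_nonneg (kernelSlope_nonneg hα₀ hα₁ (by linarith) (by linarith)) (by linarith)
  · exact le_rfl

theorem endTerm_nonneg (hα₀ : 0 < α) (hα₁ : α < 1) (h : NearUniformMesh ε m t) :
    0 ≤ endTerm α t m := by
  unfold endTerm
  split_ifs with hj
  · have h1 := h.lt (show m - 2 < m by omega) le_rfl
    have h2 := h.lt (show m - 1 < m by omega) le_rfl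
    exact div_nonneg (kernelSlope_nonneg hα₀ hα₁ le_rfl (by rw [tau]; linarith)) (by linarith)
  · exact le_rfl

/-- Since steps do not decrease, `t (j + 1) - t (j - 1) ≥ 2 τ_j`, which turns the `1 / 6` of
`kernelSlope_upper` into `1 / 12`. -/
theorem slopeTerm_le (hα₀ : 0 < α) (hα₁ : α < 1) (h : NearUniformMesh ε m t) {j : ℕ}
    (hj : j < m) : slopeTerm α t m j ≤ α * (t m - t j) ^ (-α - 1) * (tau t j ^ 2 / 12) := by
  rcases j with _ | j
  · simp [slopeTerm, tau_zero]
  have h1 := h.lt hj le_rfl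
  have h2 := h.lt (show j < j + 1 by omega) hj.le
  have h3 := h.tau_le_tau (show j + 1 ≤ j + 2 by omega) (by omega)
  have h4 : t (j + 1 + 1) - t j = tau t (j + 1) + tau t (j + 2) := by simp [tau]
  have h5 := h.tau_pos (show j < m by omega)
  simp only [slopeTerm, hj, and_true, Nat.le_add_left, if_true, Nat.add_sub_cancel]
  rw [h4, div_le_iff₀ (by linarith)]
  refine (kernelSlope_upper hα₀ hα₁ (sub_pos.mpr h1) (by linarith)).trans ?_
  have e : t m - t j - (t m - t (j + 1)) = tau t (j + 1) := by rw [tau_succ]; ring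
  have : 0 < (t m - t (j + 1)) ^ (-α - 1) := Real.rpow_pos_of_pos (sub_pos.mpr h1) _
  rw [e]
  have : tau t (j + 1) ^ 3 / 6 ≤ tau t (j + 1) ^ 2 / 12 * (tau t (j + 1) + tau t (j + 2)) := by
    nlinarith [sq_nonneg (tau t (j + 1)), mul_le_mul_of_nonneg_left h3 (sq_nonneg (tau t (j + 1)))]
  calc _ ≤ α * (t m - t (j + 1)) ^ (-α - 1) *
        (tau t (j + 1) ^ 2 / 12 * (tau t (j + 1) + tau t (j + 2))) := by gcongr
    _ = _ := by ring

/-- The only negative correction is the slope term of the same interval. At least two longer steps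
follow, so its kernel factor is at most `9 / 4` times the one in `kernelInt_lower`; the loss `9 /
48` is below the available surplus `1 / 2`. Together with `weight_le` this interlaces consecutive
weights through the kernel values at the nodes. -/
theorem le_weight (hα₀ : 0 < α) (hα₁ : α < 1) (h : NearUniformMesh ε m t) {i : ℕ}
    (hi : i + 3 ≤ m) : (t m - t i) ^ (-α) ≤ weight α t m (i + 1) := by
  have hτ := h.tau_pos (show i < m by omega)
  have h1 := h.lt (show i + 1 < m by omega) le_rfl
  have h0 := h.lt (show i < m by omega) le_rfl
  have s0 := slopeTerm_nonneg hα₀ hα₁ h i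
  have s1 := slopeTerm_le hα₀ hα₁ h (show i + 1 < m by omega)
  have k := kernelInt_lower hα₀ hα₁ (sub_pos.mpr h1).le
    (show t m - t (i + 1) < t m - t i by rw [tau_succ] at hτ; linarith)
  have e : t m - t i - (t m - t (i + 1)) = tau t (i + 1) := by rw [tau_succ]; ring
  rw [e] at k
  have hw : weight α t m (i + 1) = (kernelInt α (t m - t (i + 1)) (t m - t i)
      + slopeTerm α t m i - slopeTerm α t m (i + 1)) / tau t (i + 1) := by
    simp [weight, show i + 1 ≠ m by omega, show i + 1 + 1 ≠ m by omega]
  rw [hw, le_div_iff₀ hτ]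
  have hS : t m - t i ≤ 3 / 2 * (t m - t (i + 1)) := by
    have a1 := h.tau_le_tau (show i + 1 ≤ i + 2 by omega) (by omega)
    have a2 := h.tau_le_tau (show i + 1 ≤ i + 3 by omega) (by omega)
    have a3 := h.le (show i + 3 ≤ m by omega) le_rfl
    simp only [tau_succ] at *
    linarith
  have hp : (t m - t (i + 1)) ^ (-α - 1) ≤ 9 / 4 * (t m - t i) ^ (-α - 1) := by
    have p1 : (3 / 2 * (t m - t (i + 1))) ^ (-α - 1) ≤ (t m - t i) ^ (-α - 1) :=
      Real.rpow_le_rpow_of_nonpos (sub_pos.mpr h0) hS (by linarith)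
    rw [Real.mul_rpow (by norm_num) (sub_pos.mpr h1).le] at p1
    have p2 : (4 / 9 : ℝ) ≤ (3 / 2) ^ (-α - 1) := by
      have : (3 / 2 : ℝ) ^ (-2 : ℝ) ≤ (3 / 2) ^ (-α - 1) :=
        Real.rpow_le_rpow_of_exponent_le (by norm_num) (by linarith)
      rw [Real.rpow_neg (by norm_num)] at this
      norm_num at this ⊢
      exact this
    have p3 : 0 < (t m - t (i + 1)) ^ (-α - 1) := Real.rpow_pos_of_pos (sub_pos.mpr h1) _
    nlinarith
  have p0 : 0 < (t m - t i) ^ (-α - 1) := Real.rpow_pos_of_pos (sub_pos.mpr h0) _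
  have q : α * (t m - t (i + 1)) ^ (-α - 1) * (tau t (i + 1) ^ 2 / 12) ≤
      α * (9 / 4 * (t m - t i) ^ (-α - 1)) * (tau t (i + 1) ^ 2 / 12) := by gcongr
  have r : 0 ≤ α * (t m - t i) ^ (-α - 1) * tau t (i + 1) ^ 2 := by positivity
  nlinarith

/-- The end correction can only lower this weight, and the slope term of the previous, shorter
interval costs `1 / 12` against the surplus `1 / 2` of `kernelInt_upper`. -/
theorem weight_le (hα₀ : 0 < α) (hα₁ : α < 1) (h : NearUniformMesh ε m t) {i : ℕ}
    (hi : i + 2 ≤ m) : weight α t m (i + 1) ≤ (t m - t (i + 1)) ^ (-α) := by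
  have hτ := h.tau_pos (show i < m by omega)
  have h1 := h.lt (show i + 1 < m by omega) le_rfl
  have h0 := h.lt (show i < m by omega) le_rfl
  have s0 := slopeTerm_le hα₀ hα₁ h (show i < m by omega)
  have s1 := slopeTerm_nonneg hα₀ hα₁ h (i + 1)
  have k := kernelInt_upper hα₀ hα₁ (sub_pos.mpr h1)
    (show t m - t (i + 1) < t m - t i by rw [tau_succ] at hτ; linarith)
  have e : t m - t i - (t m - t (i + 1)) = tau t (i + 1) := by rw [tau_succ]; ring
  rw [e] at k
  have hw : weight α t m (i + 1) ≤ (kernelInt α (t m - t (i + 1)) (t m - t i)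
      + slopeTerm α t m i) / tau t (i + 1) := by
    have := endTerm_nonneg hα₀ hα₁ h
    simp only [weight, show i + 1 ≠ m by omega, if_false, Nat.add_sub_cancel]
    gcongr
    split_ifs <;> linarith
  refine hw.trans ?_
  rw [div_le_iff₀ hτ]
  have hm := h.tau_le_tau (show i ≤ i + 1 by omega) (by omega)
  have hm0 : 0 ≤ tau t i := by
    have := h.tau_le_tau (show 0 ≤ i by omega) (by omega)
    rwa [tau_zero] at this
  have p0 : 0 < (t m - t i) ^ (-α - 1) := Real.rpow_pos_of_pos (sub_pos.mpr h0) _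
  have q : α * (t m - t i) ^ (-α - 1) * (tau t i ^ 2 / 12) ≤
      α * (t m - t i) ^ (-α - 1) * (tau t (i + 1) ^ 2 / 12) := by gcongr
  have r : 0 ≤ α * (t m - t i) ^ (-α - 1) * tau t (i + 1) ^ 2 := by positivity
  nlinarith

theorem rpow_one_sub_eq {a : ℝ} (hx : 0 < a) : a ^ (1 - α) = a ^ (-α) * a := by
  rw [show 1 - α = -α + 1 by ring, Real.rpow_add_one hx.ne']

theorem rpow_two_sub_eq {a : ℝ} (hx : 0 < a) : a ^ (2 - α) = a ^ (-α) * a ^ 2 := by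
  rw [show 2 - α = -α + (2 : ℕ) by push_cast; ring, Real.rpow_add_natCast hx.ne']

theorem weight_one (hα₁ : α < 1) (h : NearUniformMesh ε 1 t) :
    weight α t 1 1 = tau t 1 ^ (-α) * (1 / (1 - α)) := by
  have hτ := h.tau_pos (show 0 < 1 by omega)
  have : t 1 - t 0 = tau t 1 := rfl
  simp only [weight, slopeTerm, endTerm]
  norm_num
  rw [this, kernelInt_zero_left hα₁, rpow_one_sub_eq hτ]
  field_simp

theorem weight_last (hα₁ : α < 1) {n : ℕ} (h : NearUniformMesh ε (n + 2) t) :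
    weight α t (n + 2) (n + 2) = tau t (n + 2) ^ (-α) * (1 / (1 - α)) +
      (slopeTerm α t (n + 2) (n + 1) + endTerm α t (n + 2)) / tau t (n + 2) := by
  have hτ := h.tau_pos (show n + 1 < n + 2 by omega)
  have e : t (n + 2) - t (n + 1) = tau t (n + 2) := rfl
  have : slopeTerm α t (n + 2) (n + 2) = 0 := by simp [slopeTerm]
  simp only [weight, this, show n + 2 - 1 = n + 1 by omega]
  norm_num
  rw [e, kernelInt_zero_left hα₁, rpow_one_sub_eq hτ]
  field_simp
  ring

theorem endTerm_eq (hα₁ : α < 1) {n : ℕ} (h : NearUniformMesh ε (n + 2) t) :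
    endTerm α t (n + 2) = tau t (n + 2) ^ (-α) * tau t (n + 2) *
      (α / ((1 - α) * (2 - α)) / (1 + tau t (n + 1) / tau t (n + 2))) := by
  have hτ := h.tau_pos (show n + 1 < n + 2 by omega)
  have hτ' := h.tau_pos (show n < n + 2 by omega)
  have e : t (n + 2) - t n = tau t (n + 2) + tau t (n + 1) := by simp [tau]
  simp only [endTerm, Nat.le_add_left, if_true, Nat.add_sub_cancel]
  rw [kernelSlope_zero_left hα₁ hτ.le, e, rpow_two_sub_eq hτ]
  have : tau t (n + 2) + tau t (n + 1) ≠ 0 := by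
    have : tau t (n + 1 + 1) = tau t (n + 2) := rfl
    linarith
  have : 1 + tau t (n + 1) / tau t (n + 2) =
    (tau t (n + 2) + tau t (n + 1)) / tau t (n + 2) := by field_simp
  rw [this]
  have : tau t (n + 2) ≠ 0 := hτ.ne'
  field_simp

theorem slopeTerm_pred_le (hα₀ : 0 < α) (hα₁ : α < 1) {n : ℕ} (h : NearUniformMesh ε (n + 2) t) :
    slopeTerm α t (n + 2) (n + 1) ≤ tau t (n + 2) ^ (-α) * tau t (n + 2) *
      ((α * (tau t (n + 1) / tau t (n + 2)) ^ 3 / 6) / (1 + tau t (n + 1) / tau t (n + 2))) := by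
  have hτ : 0 < tau t (n + 2) := h.tau_pos (show n + 1 < n + 2 by omega)
  have hτ' := h.tau_pos (show n < n + 2 by omega)
  have e : t (n + 2) - t n = tau t (n + 2) + tau t (n + 1) := by simp [tau]
  have e1 : t (n + 2) - t (n + 1) = tau t (n + 2) := rfl
  have hk := kernelSlope_upper hα₀ hα₁ hτ
    (show tau t (n + 2) < tau t (n + 2) + tau t (n + 1) by linarith)
  simp only [slopeTerm, Nat.le_add_left, show n + 1 < n + 2 by omega, and_true, if_true,
    Nat.add_sub_cancel, show n + 1 + 1 = n + 2 from rfl]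
  rw [e1, e, div_le_iff₀ (by linarith)]
  refine hk.trans (le_of_eq ?_)
  rw [add_sub_cancel_left, Real.rpow_sub_one hτ.ne']
  field_simp

/-- Here the end correction enters with a minus sign, so `le_weight` is not available for this
index. -/
theorem weight_pred_ge (hα₀ : 0 < α) (hα₁ : α < 1) {n : ℕ} (h : NearUniformMesh ε (n + 2) t) :
    (kernelInt α (tau t (n + 2)) (tau t (n + 2) + tau t (n + 1)) -
      (slopeTerm α t (n + 2) (n + 1) + endTerm α t (n + 2))) / tau t (n + 1) ≤
      weight α t (n + 2) (n + 1) := by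
  have hτ' := h.tau_pos (show n < n + 2 by omega)
  have e : t (n + 2) - t n = tau t (n + 2) + tau t (n + 1) := by simp [tau]
  have e1 : t (n + 2) - t (n + 1) = tau t (n + 2) := rfl
  have := slopeTerm_nonneg hα₀ hα₁ h n
  simp only [weight, Nat.add_sub_cancel, e1, e]
  norm_num
  refine div_le_div_of_nonneg_right ?_ hτ'.le
  linarith

end

/-! ### The comparisons involving the most recent weights. -/

section

/-- The conditions on a constant `β` that yield an inverse-monotone representation on meshes
whose consecutive step ratios are close to `1`. -/
structure AdmissibleBeta (α β ε : ℝ) : Prop where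
  pos : 0 < β
  lt_one : β < 1
  last : 1 ≤ (1 - β) * (1 / (1 - α) + α / ((1 - α) * (2 - α)) / 2)
  eps_pos : 0 < ε
  eps_lt : ε < 1
  margin : ∀ x y : ℝ, 1 - ε ≤ x → x ≤ 1 → 1 - ε ≤ y → y ≤ 1 →
    kernelInt α (1 + x) (1 + x + y) / y + α * (1 + x + y) ^ (-α - 1) * (y / 12) ≤
      (1 - β) * (β / (1 - α) + kernelInt α 1 (1 + x) / x -
        (1 / x - β) * ((α / ((1 - α) * (2 - α)) + α * x ^ 3 / 6) / (1 + x)))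

variable {α β ε : ℝ} {M m n : ℕ} {t : ℕ → ℝ}

theorem NearUniformMesh.ratio_mem (h : NearUniformMesh ε m t) (hn : n + 2 ≤ m) :
    1 - ε ≤ tau t (n + 1) / tau t (n + 2) ∧ tau t (n + 1) / tau t (n + 2) ≤ 1 := by
  have hτ : 0 < tau t (n + 2) := h.tau_pos (show n + 1 < m by omega)
  rw [le_div_iff₀ hτ, div_le_one hτ]
  exact ⟨h.ratio n hn, h.mono n hn⟩

theorem last_le_weight (hα₀ : 0 < α) (hα₁ : α < 1) (h : NearUniformMesh ε m t) (hm : 1 ≤ m) :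
    tau t m ^ (-α) * (1 / (1 - α)) ≤ weight α t m m := by
  rcases Nat.lt_or_ge m 2 with h2 | h2
  · obtain rfl : m = 1 := by omega
    exact (weight_one hα₁ h).ge
  · obtain ⟨n, rfl⟩ : ∃ n, m = n + 2 := ⟨m - 2, by omega⟩
    have hτ : 0 < tau t (n + 2) := h.tau_pos (show n + 1 < n + 2 by omega)
    rw [weight_last hα₁ h]
    have := slopeTerm_nonneg hα₀ hα₁ h (n + 1)
    have := endTerm_nonneg hα₀ hα₁ h
    have : 0 ≤ (slopeTerm α t (n + 2) (n + 1) + endTerm α t (n + 2)) / tau t (n + 2) := by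
      positivity
    linarith

theorem endTerm_bounds (hα₀ : 0 < α) (hα₁ : α < 1) (h : NearUniformMesh ε (n + 2) t) :
    tau t (n + 2) ^ (-α) * (α / ((1 - α) * (2 - α)) / 2) ≤ endTerm α t (n + 2) / tau t (n + 2) ∧
    endTerm α t (n + 2) / tau t (n + 2) ≤ tau t (n + 2) ^ (-α) * (α / ((1 - α) * (2 - α))) := by
  have hτ : 0 < tau t (n + 2) := h.tau_pos (show n + 1 < n + 2 by omega)
  have hτ' : 0 < tau t (n + 1) := h.tau_pos (show n < n + 2 by omega)
  have hx := (h.ratio_mem le_rfl).2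
  have hx0 : 0 < tau t (n + 1) / tau t (n + 2) := by positivity
  set x := tau t (n + 1) / tau t (n + 2)
  have hp : 0 < tau t (n + 2) ^ (-α) := Real.rpow_pos_of_pos hτ _
  have hb : 0 < 1 - α := by linarith
  have hb2 : 0 < 2 - α := by linarith
  have e : endTerm α t (n + 2) / tau t (n + 2) =
      tau t (n + 2) ^ (-α) * (α / ((1 - α) * (2 - α)) / (1 + x)) := by
    rw [endTerm_eq hα₁ h, mul_right_comm, mul_div_cancel_right₀ _ hτ.ne']
  rw [e]
  constructor
  · gcongr; linarith
  · exact mul_le_mul_of_nonneg_left (div_le_self (by positivity) (by linarith)) hp.le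

/-- The end correction is at least half of `α / ((1 - α)(2 - α))` in units of `τ_m ^ (-α)`, because
the previous step is no longer than the last. The field `last` is designed for this bound. -/
theorem AdmissibleBeta.last_weight (hb : AdmissibleBeta α β ε) (hα₀ : 0 < α) (hα₁ : α < 1) {ε' : ℝ}
    (h : NearUniformMesh ε' m t) (hm : 2 ≤ m) :
    tau t m ^ (-α) ≤ (1 - β) * weight α t m m := by
  obtain ⟨n, rfl⟩ : ∃ n, m = n + 2 := ⟨m - 2, by omega⟩
  have hτ : 0 < tau t (n + 2) := h.tau_pos (show n + 1 < n + 2 by omega)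
  have hp : 0 < tau t (n + 2) ^ (-α) := Real.rpow_pos_of_pos hτ _
  have h1 := (endTerm_bounds hα₀ hα₁ h).1
  have h2 : 0 ≤ slopeTerm α t (n + 2) (n + 1) / tau t (n + 2) :=
    div_nonneg (slopeTerm_nonneg hα₀ hα₁ h (n + 1)) hτ.le
  have hβ : 0 < 1 - β := by linarith [hb.lt_one]
  rw [weight_last hα₁ h, add_div]
  calc tau t (n + 2) ^ (-α) ≤ tau t (n + 2) ^ (-α) *
        ((1 - β) * (1 / (1 - α) + α / ((1 - α) * (2 - α)) / 2)) :=
        le_mul_of_one_le_right hp.le hb.last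
    _ = (1 - β) * (tau t (n + 2) ^ (-α) * (1 / (1 - α)) +
        tau t (n + 2) ^ (-α) * (α / ((1 - α) * (2 - α)) / 2)) := by ring
    _ ≤ _ := by gcongr; linarith

/-- Scaling by `τ_m` reduces this to `margin`. The slope and end corrections enter the last two
weights with factors `1 / τ_m` and `-1 / τ_{m-1}`, so only the net factor `1 / x - β`, which is
nonnegative, remains. The parameter `y` is left free: it is `1` in `pred_pos` and the third step
ratio in `pred_pred`. -/
theorem AdmissibleBeta.pred_weight (hb : AdmissibleBeta α β ε) (hα₀ : 0 < α) (hα₁ : α < 1)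
    (h : NearUniformMesh (ε / 2) (n + 2) t) {y : ℝ} (hy : 1 - ε ≤ y) (hy1 : y ≤ 1) :
    tau t (n + 2) ^ (-α) *
      (kernelInt α (1 + tau t (n + 1) / tau t (n + 2)) (1 + tau t (n + 1) / tau t (n + 2) + y) / y +
        α * (1 + tau t (n + 1) / tau t (n + 2) + y) ^ (-α - 1) * (y / 12)) ≤
      (1 - β) * (β * weight α t (n + 2) (n + 2) + weight α t (n + 2) (n + 1)) := by
  have hτ : 0 < tau t (n + 2) := h.tau_pos (show n + 1 < n + 2 by omega)
  have hτ' : 0 < tau t (n + 1) := h.tau_pos (show n < n + 2 by omega)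
  obtain ⟨hx, hx1⟩ := h.ratio_mem le_rfl
  have hx0 : 0 < tau t (n + 1) / tau t (n + 2) := by positivity
  have e1 := endTerm_eq hα₁ h
  have s1 := slopeTerm_pred_le hα₀ hα₁ h
  have hτx : tau t (n + 1) = tau t (n + 2) * (tau t (n + 1) / tau t (n + 2)) := by field_simp
  have w1 := weight_pred_ge hα₀ hα₁ h
  have w2 := weight_last hα₁ h
  set x := tau t (n + 1) / tau t (n + 2) with hxdef
  have hp : 0 < tau t (n + 2) ^ (-α) := Real.rpow_pos_of_pos hτ _
  set s := slopeTerm α t (n + 2) (n + 1) + endTerm α t (n + 2) with hs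
  set Q := (α / ((1 - α) * (2 - α)) + α * x ^ 3 / 6) / (1 + x) with hQ
  have hsQ : s / tau t (n + 2) ≤ tau t (n + 2) ^ (-α) * Q := by
    rw [div_le_iff₀ hτ, hs, e1]
    calc _ ≤ _ := add_le_add_left s1 _
      _ = _ := by rw [hQ]; ring
  have hk : kernelInt α (tau t (n + 2)) (tau t (n + 2) + tau t (n + 1)) =
      tau t (n + 2) ^ (-α) * tau t (n + 2) * kernelInt α 1 (1 + x) := by
    rw [← rpow_one_sub_eq hτ, ← kernelInt_smul hα₁ hτ.le zero_le_one (by linarith)]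
    congr 1
    · ring
    · rw [mul_add, mul_one, ← hτx]
  have hβ : 0 < 1 - β := by linarith [hb.lt_one]
  have hxβ : 0 ≤ 1 / x - β := by
    have : 1 ≤ 1 / x := by rw [le_div_iff₀ hx0]; linarith
    linarith [hb.lt_one]
  have m := hb.margin x y (by linarith [hb.eps_pos]) hx1 hy hy1
  calc _ ≤ tau t (n + 2) ^ (-α) * ((1 - β) * (β / (1 - α) + kernelInt α 1 (1 + x) / x -
        (1 / x - β) * Q)) := by gcongr
    _ = (1 - β) * (tau t (n + 2) ^ (-α) * (β / (1 - α) + kernelInt α 1 (1 + x) / x) -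
        (1 / x - β) * (tau t (n + 2) ^ (-α) * Q)) := by ring
    _ ≤ (1 - β) * (tau t (n + 2) ^ (-α) * (β / (1 - α) + kernelInt α 1 (1 + x) / x) -
        (1 / x - β) * (s / tau t (n + 2))) := by gcongr
    _ = (1 - β) * (β * (tau t (n + 2) ^ (-α) * (1 / (1 - α)) + s / tau t (n + 2)) +
        (tau t (n + 2) ^ (-α) * tau t (n + 2) * kernelInt α 1 (1 + x) - s) / tau t (n + 1)) := by
        rw [hτx]
        field_simp
        ring
    _ ≤ _ := by rw [w2, ← hk]; gcongr

theorem AdmissibleBeta.pred_pos (hb : AdmissibleBeta α β ε) (hα₀ : 0 < α) (hα₁ : α < 1)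
    (h : NearUniformMesh (ε / 2) (n + 2) t) :
    tau t (n + 2) ^ (-α) * (1 / 3) ≤
      (1 - β) * (β * weight α t (n + 2) (n + 2) + weight α t (n + 2) (n + 1)) := by
  have hτ : 0 < tau t (n + 2) := h.tau_pos (show n + 1 < n + 2 by omega)
  have hτ' : 0 < tau t (n + 1) := h.tau_pos (show n < n + 2 by omega)
  refine le_trans ?_ (hb.pred_weight hα₀ hα₁ h (y := 1) (by linarith [hb.eps_pos]) le_rfl)
  obtain ⟨hx, hx1⟩ := h.ratio_mem le_rfl
  have hx0 : 0 < tau t (n + 1) / tau t (n + 2) := by positivity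
  set x := tau t (n + 1) / tau t (n + 2)
  have hp : 0 < tau t (n + 2) ^ (-α) := Real.rpow_pos_of_pos hτ _
  have k := mul_le_kernelInt (α := α) hα₀ hα₁ (show 0 ≤ 1 + x by linarith)
    (show 1 + x < 1 + x + 1 by linarith)
  have p1 : (3 : ℝ) ^ (-1 : ℝ) ≤ 3 ^ (-α) :=
    Real.rpow_le_rpow_of_exponent_le (by norm_num) (by linarith)
  have p2 : (3 : ℝ) ^ (-α) ≤ (1 + x + 1) ^ (-α) :=
    Real.rpow_le_rpow_of_nonpos (by linarith) (by linarith) (by linarith)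
  rw [Real.rpow_neg_one] at p1
  have : 0 < (1 + x + 1) ^ (-α - 1) := Real.rpow_pos_of_pos (by linarith) _
  have : 0 ≤ α * (1 + x + 1) ^ (-α - 1) * (1 / 12) := by positivity
  rw [add_sub_cancel_left, mul_one] at k
  gcongr
  rw [div_one]
  norm_num at p1
  linarith

theorem AdmissibleBeta.pred_pred (hb : AdmissibleBeta α β ε) (hα₀ : 0 < α) (hα₁ : α < 1)
    (h : NearUniformMesh (ε / 2) (n + 3) t) :
    weight α t (n + 3) (n + 1) ≤
      (1 - β) * (β * weight α t (n + 3) (n + 3) + weight α t (n + 3) (n + 2)) := by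
  have hτ : 0 < tau t (n + 3) := h.tau_pos (show n + 2 < n + 3 by omega)
  have hτ' : 0 < tau t (n + 2) := h.tau_pos (show n + 1 < n + 3 by omega)
  have hτ'' : 0 < tau t (n + 1) := h.tau_pos (show n < n + 3 by omega)
  obtain ⟨hx, hx1⟩ := h.ratio_mem (show n + 1 + 2 ≤ n + 3 by omega)
  obtain ⟨hz, hz1⟩ := h.ratio_mem (show n + 2 ≤ n + 3 by omega)
  simp only [show n + 1 + 1 = n + 2 from rfl, show n + 1 + 2 = n + 3 from rfl] at hx hx1
  have hx0 : 0 < tau t (n + 2) / tau t (n + 3) := by positivity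
  have hz0 : 0 < tau t (n + 1) / tau t (n + 2) := by positivity
  have hε := hb.eps_pos
  have hε1 := hb.eps_lt
  have hyz : tau t (n + 1) / tau t (n + 3) =
    tau t (n + 1) / tau t (n + 2) * (tau t (n + 2) / tau t (n + 3)) := by field_simp
  refine le_trans ?_ (hb.pred_weight (n := n + 1) hα₀ hα₁ h
    (y := tau t (n + 1) / tau t (n + 3)) ?_ ?_)
  · simp only [show n + 1 + 1 = n + 2 from rfl, show n + 1 + 2 = n + 3 from rfl]
    have hxx : tau t (n + 2) = tau t (n + 3) * (tau t (n + 2) / tau t (n + 3)) := by field_simp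
    have hyy : tau t (n + 1) = tau t (n + 3) * (tau t (n + 1) / tau t (n + 3)) := by field_simp
    have hy0 : 0 < tau t (n + 1) / tau t (n + 3) := by positivity
    have e1 : t (n + 3) - t (n + 1) = tau t (n + 3) * (1 + tau t (n + 2) / tau t (n + 3)) := by
      rw [mul_add, ← hxx]; simp [tau]
    have e2 : t (n + 3) - t n = tau t (n + 3) *
        (1 + tau t (n + 2) / tau t (n + 3) + tau t (n + 1) / tau t (n + 3)) := by
      rw [mul_add, mul_add, ← hxx, ← hyy]; simp [tau]
    have s := slopeTerm_le hα₀ hα₁ h (show n < n + 3 by omega)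
    have s1 := slopeTerm_nonneg hα₀ hα₁ h (n + 1)
    have hm0 : 0 ≤ tau t n := by
      have := h.tau_le_tau (show 0 ≤ n by omega) (by omega)
      rwa [tau_zero] at this
    have hm1 := h.tau_le_tau (show n ≤ n + 1 by omega) (by omega)
    have hw : weight α t (n + 3) (n + 1) = (kernelInt α (t (n + 3) - t (n + 1)) (t (n + 3) - t n)
        + slopeTerm α t (n + 3) n - slopeTerm α t (n + 3) (n + 1)) / tau t (n + 1) := by
      simp [weight]
    rw [e2] at s
    rw [hw, e1, e2, kernelInt_smul hα₁ hτ.le (by positivity) (by positivity), rpow_one_sub_eq hτ]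
    rw [Real.mul_rpow hτ.le (by positivity), Real.rpow_sub_one hτ.ne'] at s
    set x := tau t (n + 2) / tau t (n + 3)
    set y := tau t (n + 1) / tau t (n + 3)
    have hp : 0 < tau t (n + 3) ^ (-α) := Real.rpow_pos_of_pos hτ _
    have hq : 0 < (1 + x + y) ^ (-α - 1) := Real.rpow_pos_of_pos (by positivity) _
    rw [div_le_iff₀ hτ'']
    have s2 : α * (tau t (n + 3) ^ (-α) / tau t (n + 3) * (1 + x + y) ^ (-α - 1)) *
        (tau t n ^ 2 / 12) ≤ α * (tau t (n + 3) ^ (-α) / tau t (n + 3) * (1 + x + y) ^ (-α - 1)) *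
        (tau t (n + 1) ^ 2 / 12) := by gcongr
    refine le_trans (b := tau t (n + 3) ^ (-α) * tau t (n + 3) * kernelInt α (1 + x) (1 + x + y) +
      α * (tau t (n + 3) ^ (-α) / tau t (n + 3) * (1 + x + y) ^ (-α - 1)) *
        (tau t (n + 1) ^ 2 / 12)) (by linarith) (le_of_eq ?_)
    rw [hyy]
    field_simp
  -- Two consecutive ratios multiply, and `(1 - ε / 2)² ≥ 1 - ε`; hence meshes are taken with `ε /
  -- 2` while `margin` is stated with `ε`.
  · rw [hyz]; nlinarith
  · rw [hyz]; nlinarith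

end

/-! ### Geometric averages of the weights, the representation and the comparison principle. -/

section

variable {α β ε lam : ℝ} {M m n : ℕ} {t : ℕ → ℝ}

/-- The coefficient of `V^j - V^{j-1}` in `Γ(1 - α) δ_t^α U^m`, where
`V^j = (U^j - β U^{j-1}) / (1 - β)`. -/
def cumWeight (α β : ℝ) (t : ℕ → ℝ) (m j : ℕ) : ℝ :=
  ∑ k ∈ Finset.range (m + 1 - j), (1 - β) * β ^ k * weight α t m (j + k)

theorem cumWeight_succ_self (α β : ℝ) (t : ℕ → ℝ) (m : ℕ) : cumWeight α β t m (m + 1) = 0 := by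
  simp [cumWeight]

theorem cumWeight_rec (α β : ℝ) (t : ℕ → ℝ) {m j : ℕ} (hj : j ≤ m) :
    cumWeight α β t m j = (1 - β) * weight α t m j + β * cumWeight α β t m (j + 1) := by
  rw [cumWeight, cumWeight, show m + 1 - j = (m + 1 - (j + 1)) + 1 by omega,
    Finset.sum_range_succ', add_comm, Finset.mul_sum]
  congr 1
  · simp
  · refine Finset.sum_congr rfl fun k _ => ?_
    rw [show j + (k + 1) = j + 1 + k by ring, pow_succ]
    ring

theorem cumWeight_last (α β : ℝ) (t : ℕ → ℝ) (m : ℕ) :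
    cumWeight α β t m m = (1 - β) * weight α t m m := by
  rw [cumWeight_rec α β t le_rfl, cumWeight_succ_self, mul_zero, add_zero]

theorem cumWeight_pred (α β : ℝ) (t : ℕ → ℝ) (n : ℕ) :
    cumWeight α β t (n + 1) n =
      (1 - β) * (β * weight α t (n + 1) (n + 1) + weight α t (n + 1) n) := by
  rw [cumWeight_rec α β t (Nat.le_succ n), cumWeight_last]; ring

/-- Backward induction from the end. The last two cases are `last_weight` and `pred_pred`. Otherwise
`w_{i+1} ≤ (t_m - t_{i+1}) ^ (-α) ≤ w_{i+2}`, and `w_{i+2} ≤ K_{i+3}` makes the average `K_{i+2}` of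
these two at least `w_{i+2}`. -/
theorem AdmissibleBeta.weight_le_cumWeight_succ (hb : AdmissibleBeta α β ε) (hα₀ : 0 < α)
    (hα₁ : α < 1) (h : NearUniformMesh (ε / 2) m t) {i : ℕ} (hi : i + 2 ≤ m) :
    weight α t m (i + 1) ≤ cumWeight α β t m (i + 2) := by
  obtain ⟨d, rfl⟩ : ∃ d, m = i + 2 + d := ⟨m - (i + 2), by omega⟩
  induction d generalizing i with
  | zero =>
    rw [add_zero, cumWeight_last]
    exact (weight_le hα₀ hα₁ h le_rfl).trans (hb.last_weight hα₀ hα₁ h (by omega))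
  | succ d ih =>
    rcases d with _ | d
    · have := hb.pred_pred hα₀ hα₁ h
      rw [← cumWeight_pred] at this
      exact this
    · have e : i + 2 + (d + 1 + 1) = i + 1 + 2 + (d + 1) := by ring
      rw [e] at h ⊢
      have h1 := @ih (i + 1) h (by omega)
      have h2 := weight_le hα₀ hα₁ h (show i + 2 ≤ i + 1 + 2 + (d + 1) by omega)
      have h3 := le_weight hα₀ hα₁ h (show i + 1 + 3 ≤ i + 1 + 2 + (d + 1) by omega)
      rw [cumWeight_rec α β t (show i + 2 ≤ i + 1 + 2 + (d + 1) by omega)]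
      simp only [show i + 1 + 1 = i + 2 from rfl] at h1 h3
      have := hb.pos
      have := hb.lt_one
      nlinarith

theorem AdmissibleBeta.cumWeight_mono (hb : AdmissibleBeta α β ε) (hα₀ : 0 < α) (hα₁ : α < 1)
    (h : NearUniformMesh (ε / 2) m t) {i j : ℕ} (hi : 1 ≤ i) (hij : i ≤ j) (hj : j ≤ m) :
    cumWeight α β t m i ≤ cumWeight α β t m j := by
  induction j, hij using Nat.le_induction with
  | base => exact le_rfl
  | succ k hk ih =>
    refine (ih (by omega)).trans ?_
    obtain ⟨k, rfl⟩ : ∃ l, k = l + 1 := ⟨k - 1, by omega⟩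
    rw [cumWeight_rec α β t (show k + 1 ≤ m by omega)]
    have := hb.weight_le_cumWeight_succ hα₀ hα₁ h (show k + 2 ≤ m by omega)
    have := hb.lt_one
    nlinarith

theorem AdmissibleBeta.le_cumWeight_of_add_three_le (hb : AdmissibleBeta α β ε) (hα₀ : 0 < α)
    (hα₁ : α < 1) (h : NearUniformMesh (ε / 2) m t) {i : ℕ} (hi : i + 3 ≤ m) :
    (t m - t i) ^ (-α) ≤ cumWeight α β t m (i + 1) := by
  refine (le_weight hα₀ hα₁ h hi).trans ?_
  rw [cumWeight_rec α β t (show i + 1 ≤ m by omega)]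
  have := hb.weight_le_cumWeight_succ hα₀ hα₁ h (show i + 2 ≤ m by omega)
  have := hb.pos
  nlinarith

/-- The averages inherit the kernel as a lower bound, up to a constant that is needed only for the
last two indices. All barrier estimates based on `unweight` use this. -/
theorem AdmissibleBeta.le_cumWeight (hb : AdmissibleBeta α β ε) (hα₀ : 0 < α)
    (hα₁ : α < 1) (h : NearUniformMesh (ε / 2) m t) {i : ℕ} (hi : i + 1 ≤ m) :
    min (1 - β) (1 / 3) * (t m - t i) ^ (-α) ≤ cumWeight α β t m (i + 1) := by
  have hβ0 := hb.pos
  have hβ := hb.lt_one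
  have h0 := h.lt (show i < m by omega) le_rfl
  have hp : 0 < (t m - t i) ^ (-α) := Real.rpow_pos_of_pos (sub_pos.mpr h0) _
  obtain ⟨d, rfl⟩ : ∃ d, m = i + 1 + d := ⟨m - (i + 1), by omega⟩
  rcases d with _ | _ | d
  · simp only [add_zero] at *
    rw [cumWeight_last]
    have h1 := last_le_weight hα₀ hα₁ h (by omega)
    rw [tau_succ] at h1
    have : 1 ≤ 1 / (1 - α) := by rw [le_div_iff₀ (by linarith)]; linarith
    have h2 : (t (i + 1) - t i) ^ (-α) ≤ weight α t (i + 1) (i + 1) :=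
      (le_mul_of_one_le_right hp.le this).trans h1
    have : 0 < 1 - β := by linarith
    calc _ ≤ (1 - β) * (t (i + 1) - t i) ^ (-α) := by gcongr; exact min_le_left _ _
      _ ≤ _ := by gcongr
  · simp only [zero_add, show i + 1 + 1 = i + 2 from rfl] at *
    rw [cumWeight_pred]
    refine le_trans ?_ (hb.pred_pos hα₀ hα₁ h)
    rw [mul_comm]
    have hτ : 0 < tau t (i + 2) := h.tau_pos (show i + 1 < i + 2 by omega)
    have hτ' : 0 < tau t (i + 1) := h.tau_pos (show i < i + 2 by omega)
    have e : t (i + 2) - t i = tau t (i + 2) + tau t (i + 1) := by simp [tau]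
    have h1 : (t (i + 2) - t i) ^ (-α) ≤ tau t (i + 2) ^ (-α) :=
      Real.rpow_le_rpow_of_nonpos hτ (by linarith) (by linarith)
    have h2 : min (1 - β) (1 / 3) ≤ 1 / 3 := min_le_right _ _
    have : 0 < 1 - β := by linarith
    gcongr
  · refine le_trans ?_ (hb.le_cumWeight_of_add_three_le hα₀ hα₁ h (by omega))
    have h2 : min (1 - β) (1 / 3) ≤ 1 / 3 := min_le_right _ _
    nlinarith

/-- Insert `(1 - β) w_j = K_j - β K_{j+1}`. The increments of `V` satisfy `(1 - β)(V^j - V^{j-1}) =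
(U^j - U^{j-1}) - β (U^{j-1} - U^{j-2})`, and `V^1 - V^0 = (U^1 - U^0) / (1 - β)`, so the sum
telescopes with a remainder containing `K_{m,m+1} = 0`. -/
theorem sum_weight_eq_sum_cumWeight (hβ : β ≠ 1) (hm : 1 ≤ m) (U : ℕ → ℝ) :
    ∑ i ∈ Finset.range m, weight α t m (i + 1) * (U (i + 1) - U i) =
      ∑ i ∈ Finset.range m, cumWeight α β t m (i + 1) *
        (weighted (fun _ => β) U (i + 1) - weighted (fun _ => β) U i) := by
  have hβ' : 1 - β ≠ 0 := sub_ne_zero.mpr hβ.symm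
  have key : ∀ N, N + 1 ≤ m →
      ∑ i ∈ Finset.range (N + 1), weight α t m (i + 1) * (U (i + 1) - U i) =
      ∑ i ∈ Finset.range (N + 1), cumWeight α β t m (i + 1) *
        (weighted (fun _ => β) U (i + 1) - weighted (fun _ => β) U i) -
        β * cumWeight α β t m (N + 2) * ((U (N + 1) - U N) / (1 - β)) := by
    intro N
    induction N with
    | zero =>
      intro h
      have := cumWeight_rec α β t h
      simp only [zero_add] at this ⊢
      rw [Finset.sum_range_one, Finset.sum_range_one, this]
      simp [weighted]
      field_simp
      ring
    | succ N ih =>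
      intro h
      rw [Finset.sum_range_succ, ih (by omega), Finset.sum_range_succ _ (N + 1),
        cumWeight_rec α β t h]
      simp [weighted]
      field_simp
      ring
  obtain ⟨N, rfl⟩ : ∃ N, m = N + 1 := ⟨m - 1, by omega⟩
  rw [key N le_rfl, cumWeight_succ_self]
  ring

theorem AdmissibleBeta.isInverseMonotoneRep (hb : AdmissibleBeta α β ε) (hα₀ : 0 < α)
    (hα₁ : α < 1) (h : NearUniformMesh (ε / 2) M t) :
    IsInverseMonotoneRep α M t (fun _ => β) (fun m j => 1 / Real.Gamma (1 - α) *
      ((if j = 0 then 0 else cumWeight α β t m j) - cumWeight α β t m (j + 1))) := by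
  have hΓ : 0 < Real.Gamma (1 - α) := Real.Gamma_pos_of_pos (by linarith)
  have hΓ' : 0 < 1 / Real.Gamma (1 - α) := by positivity
  have hβ := hb.lt_one
  have hc : 0 < min (1 - β) (1 / 3 : ℝ) := lt_min (by linarith) (by norm_num)
  have hpos : ∀ m i, i + 1 ≤ m → m ≤ M → 0 < cumWeight α β t m (i + 1) := by
    intro m i hi hm
    have h' := h.mono_right hm
    refine lt_of_lt_of_le ?_ (hb.le_cumWeight hα₀ hα₁ h' hi)
    have := h'.lt (show i < m by omega) le_rfl
    have := Real.rpow_pos_of_pos (sub_pos.mpr this) (-α)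
    positivity
  have hsum : ∀ (V : ℕ → ℝ) m, ∑ j ∈ Finset.range (m + 1), (1 / Real.Gamma (1 - α) *
      ((if j = 0 then 0 else cumWeight α β t m j) - cumWeight α β t m (j + 1))) * V j =
      1 / Real.Gamma (1 - α) * ∑ i ∈ Finset.range m, cumWeight α β t m (i + 1) *
        (V (i + 1) - V i) := by
    intro V m
    have := sum_range_succ_sub_mul (fun j => if j = 0 then 0 else cumWeight α β t m j) V m
    simp only [Nat.add_eq_zero_iff, one_ne_zero, and_false, if_false, if_true,
      cumWeight_succ_self, zero_mul, sub_zero, zero_add] at this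
    rw [← this, Finset.mul_sum]
    exact Finset.sum_congr rfl fun j _ => by ring
  refine ⟨fun j _ _ => ⟨hb.pos.le, hβ⟩, fun U m hm hmM => ?_, fun m hm hmM => ?_,
    fun m hm hmM => ?_, fun m j hj hmM => ?_⟩
  · rw [hsum, delta_eq_sum hα₁ U h.start hm (h.mono_right hmM).step,
      sum_weight_eq_sum_cumWeight hβ.ne hm]
  · obtain ⟨m, rfl⟩ : ∃ n, m = n + 1 := ⟨m - 1, by omega⟩
    have := hpos (m + 1) m le_rfl hmM
    rw [cumWeight_succ_self]
    simp only [Nat.add_eq_zero_iff, one_ne_zero, and_false, if_false, sub_zero]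
    positivity
  · have := hsum (fun _ => 1) m
    simpa using this
  · rcases j with _ | j
    · have := hpos m 0 (by omega) hmM
      simp only [if_true, zero_sub, mul_neg, zero_add] at *
      have : 0 < 1 / Real.Gamma (1 - α) * cumWeight α β t m 1 := by positivity
      linarith
    · have := hb.cumWeight_mono hα₀ hα₁ (h.mono_right hmM) (show 1 ≤ j + 1 by omega)
        (show j + 1 ≤ j + 1 + 1 by omega) (by omega)
      simp only [Nat.add_eq_zero_iff, one_ne_zero, and_false, if_false]
      exact mul_nonpos_of_nonneg_of_nonpos hΓ'.le (by linarith)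

/-- The diagonal coefficient of an inverse-monotone representation. -/
theorem IsInverseMonotoneRep.diag_eq {β : ℕ → ℝ} {κ : ℕ → ℕ → ℝ}
    (hrep : IsInverseMonotoneRep α M t β κ) (hα₁ : α < 1) (h : NearUniformMesh ε M t)
    (hm : 1 ≤ m) (hmM : m ≤ M) :
    κ m m = (1 - β m) * (1 / Real.Gamma (1 - α) * weight α t m m) := by
  have hβ := (hrep.beta_mem m hm hmM).2
  -- For the unit sequence at `m` only the last term survives on both sides.
  have := hrep.rep (Pi.single m 1) m hm hmM
  rw [delta_eq_sum hα₁ _ h.start hm (h.mono_right hmM).step, Finset.sum_range_succ] at this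
  obtain ⟨m, rfl⟩ : ∃ n, m = n + 1 := ⟨m - 1, by omega⟩
  rw [Finset.sum_range_succ, Finset.sum_eq_zero, Finset.sum_eq_zero] at this
  · have e1 : weighted β (Pi.single (m + 1) 1) (m + 1) = 1 / (1 - β (m + 1)) := by
      simp [weighted]
    rw [e1] at this
    have h1 : 1 - β (m + 1) ≠ 0 := by linarith
    simp only [Pi.single_eq_same, zero_add] at this
    rw [Pi.single_eq_of_ne (by omega)] at this
    rw [sub_zero, mul_one] at this
    rw [this]
    field_simp
  · intro j hj
    have := Finset.mem_range.mp hj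
    have e : weighted β (Pi.single (m + 1) 1) j = 0 := by
      simp only [weighted]
      rw [Pi.single_eq_of_ne (by omega), Pi.single_eq_of_ne (by omega),
        Pi.single_eq_of_ne (by omega)]
      simp
    rw [e, mul_zero]
  · intro j hj
    have := Finset.mem_range.mp hj
    rw [Pi.single_eq_of_ne (by omega), Pi.single_eq_of_ne (by omega)]
    simp

/-- Discrete comparison principle for `δ_t^α - lam`. -/
theorem IsInverseMonotoneRep.comparison {β : ℕ → ℝ} {κ : ℕ → ℕ → ℝ}
    (hrep : IsInverseMonotoneRep α M t β κ) (hlam₀ : 0 ≤ lam)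
    (hlam : ∀ m, 1 ≤ m → m ≤ M → lam * (1 - β m) < κ m m) {U W B F : ℕ → ℝ}
    (hU : U 0 = 0) (hW : W 0 = 0) (hB : 0 ≤ B 0)
    (hF : ∀ m, 1 ≤ m → m ≤ M → ∑ j ∈ Finset.range (m + 1), κ m j * W j - lam * U m ≤ F m)
    (hUW : ∀ j, 1 ≤ j → j ≤ M → (U j - β j * U (j - 1)) / (1 - β j) ≤ W j)
    (hBF : ∀ m, 1 ≤ m → m ≤ M → F m ≤ delta α t B m - lam * B m) :
    ∀ j, j ≤ M → U j ≤ B j := by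
  -- The induction must carry both bounds: the one on `W` controls the history through the
  -- nonpositive coefficients, the one on `U` enters through `β m * U (m - 1)`.
  suffices H : ∀ j, j ≤ M → U j ≤ B j ∧ W j ≤ weighted β B j from fun j hj => (H j hj).1
  intro j
  induction j using Nat.strong_induction_on with
  | _ m ih =>
    intro hmM
    rcases Nat.eq_zero_or_pos m with rfl | hm
    · simp [hU, hW, weighted, hB]
    have hβ := hrep.beta_mem m hm hmM
    have hβ1 : 0 < 1 - β m := by linarith [hβ.2]
    have h1 := hF m hm hmM
    have h2 := hBF m hm hmM
    rw [hrep.rep B m hm hmM, Finset.sum_range_succ] at h2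
    rw [Finset.sum_range_succ] at h1
    have h3 : ∑ j ∈ Finset.range m, κ m j * weighted β B j ≤
        ∑ j ∈ Finset.range m, κ m j * W j := by
      refine Finset.sum_le_sum fun j hj => ?_
      have hj := Finset.mem_range.mp hj
      exact mul_le_mul_of_nonpos_left (ih j hj (by omega)).2 (hrep.offdiag_nonpos m j hj hmM)
    have h4 := (ih (m - 1) (by omega) (by omega)).1
    have h5 := hUW m hm hmM
    have h6 : weighted β B m = (B m - β m * B (m - 1)) / (1 - β m) := by
      simp [weighted, show m ≠ 0 by omega]
    have h7 : U m - β m * U (m - 1) ≤ W m * (1 - β m) := (div_le_iff₀ hβ1).mp h5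
    have h8 : weighted β B m * (1 - β m) = B m - β m * B (m - 1) := by rw [h6]; field_simp
    have h9 : β m * U (m - 1) ≤ β m * B (m - 1) := mul_le_mul_of_nonneg_left h4 hβ.1
    have h10 : (1 - β m) * (weighted β B m - W m) ≤ B m - U m := by nlinarith
    -- A violation of `W m ≤ weighted β B m` is excluded since the diagonal coefficient dominates
    -- the contribution of `lam`.
    have h11 : 0 ≤ (κ m m - lam * (1 - β m)) * (weighted β B m - W m) := by
      nlinarith [mul_le_mul_of_nonneg_left h10 hlam₀]
    have h12 : 0 ≤ weighted β B m - W m :=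
      nonneg_of_mul_nonneg_right h11 (by linarith [hlam m hm hmM])
    exact ⟨by nlinarith, by linarith⟩

end

/-! ### Regular barriers: geometric for a fixed number of steps, exponential for fine meshes. -/

section

variable {α β ε μ T : ℝ} {M m n : ℕ} {t : ℕ → ℝ}

/-- The operator `Γ(1 - α) δ_t^α`, see `delta_eq_sum`. -/
def scaledDelta (α : ℝ) (t B : ℕ → ℝ) (m : ℕ) : ℝ :=
  ∑ i ∈ Finset.range m, weight α t m (i + 1) * (B (i + 1) - B i)

/-- The sequence `B` with `(B^j - β B^{j-1}) / (1 - β) = V^j`. -/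
def unweight (β : ℝ) (V : ℕ → ℝ) : ℕ → ℝ
  | 0 => V 0
  | j + 1 => β * unweight β V j + (1 - β) * V (j + 1)

theorem weighted_unweight (hβ : β ≠ 1) (V : ℕ → ℝ) :
    weighted (fun _ => β) (unweight β V) = V := by
  have : 1 - β ≠ 0 := sub_ne_zero.mpr hβ.symm
  ext j
  rcases j with _ | j
  · simp [weighted, unweight]
  · simp [weighted, unweight]; field_simp

theorem scaledDelta_unweight (hβ : β ≠ 1) (hm : 1 ≤ m) (V : ℕ → ℝ) :
    scaledDelta α t (unweight β V) m =
      ∑ i ∈ Finset.range m, cumWeight α β t m (i + 1) * (V (i + 1) - V i) := by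
  rw [scaledDelta, sum_weight_eq_sum_cumWeight hβ hm, weighted_unweight hβ]

theorem unweight_le (hβ₀ : 0 ≤ β) {V : ℕ → ℝ}
    (hV : ∀ j, j < M → V j ≤ V (j + 1)) : ∀ j, j ≤ M → unweight β V j ≤ V j := by
  intro j
  induction j with
  | zero => exact fun _ => le_rfl
  | succ j ih =>
    intro hj
    have h1 := ih (by omega)
    have h2 := hV j (by omega)
    simp only [unweight]
    nlinarith

/-- The increments before `k` are discarded; choosing `k` selects the part of the history where the
kernel is known to be large. -/
theorem mul_sub_le_sum {K V : ℕ → ℝ} {c : ℝ} {k : ℕ} (hkm : k ≤ m)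
    (hV : ∀ j, j < m → V j ≤ V (j + 1)) (hK : ∀ j, j < m → 0 ≤ K (j + 1))
    (hc : ∀ j, k ≤ j → j < m → c ≤ K (j + 1)) :
    c * (V m - V k) ≤ ∑ i ∈ Finset.range m, K (i + 1) * (V (i + 1) - V i) := by
  induction m, hkm using Nat.le_induction with
  | base =>
    rw [sub_self, mul_zero]
    refine Finset.sum_nonneg fun i hi => ?_
    have hi := Finset.mem_range.mp hi
    exact mul_nonneg (hK i hi) (sub_nonneg.mpr (hV i hi))
  | succ n hn ih =>
    rw [Finset.sum_range_succ]
    have h1 := ih (fun j hj => hV j (by omega)) (fun j hj => hK j (by omega))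
      (fun j hj hj' => hc j hj (by omega))
    have h2 := hV n (by omega)
    have h3 := hc n hn (by omega)
    nlinarith

theorem AdmissibleBeta.cumWeight_nonneg (hb : AdmissibleBeta α β ε) (hα₀ : 0 < α)
    (hα₁ : α < 1) (h : NearUniformMesh (ε / 2) m t) {i : ℕ} (hi : i < m) :
    0 ≤ cumWeight α β t m (i + 1) := by
  refine le_trans ?_ (hb.le_cumWeight hα₀ hα₁ h hi)
  have := Real.rpow_nonneg (sub_pos.mpr (h.lt hi le_rfl)).le (-α)
  have : 0 ≤ min (1 - β) (1 / 3 : ℝ) := le_min (by linarith [hb.lt_one]) (by norm_num)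
  positivity

set_option maxHeartbeats 400000 in
/-- Barrier on a mesh with a fixed number of steps. -/
theorem AdmissibleBeta.exists_coarse_barrier (hb : AdmissibleBeta α β ε) (hα₀ : 0 < α)
    (hα₁ : α < 1) (hμ : 0 ≤ μ) (hT : 0 < T) (hM : 1 ≤ M) :
    ∃ C : ℝ, 0 < C ∧ ∀ t, NearUniformMesh (ε / 2) M t → t M = T →
      (∀ j, 1 ≤ j → j ≤ M → μ < tau t j ^ (-α) * (1 / (1 - α))) →
      ∃ B : ℕ → ℝ, B 0 = 0 ∧ ∀ m, 1 ≤ m → m ≤ M → B m ≤ C ∧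
        1 ≤ scaledDelta α t B m - μ * B m := by
  have hβ0 := hb.pos
  have hβ : 0 < 1 - β := by linarith [hb.lt_one]
  have hα : 0 < 1 - α := by linarith
  have hα' : 0 < 2 - α := by linarith
  have hM0 : (0 : ℝ) < M := by exact_mod_cast hM
  set w := (T / M) ^ (-α) * (1 / (1 - α)) with hw
  have hw0 : 0 < w := by positivity
  -- `w` is the restriction threshold for a step of the mean length `T / M`. If `w ≤ μ` there is no
  -- admissible mesh, as the last step is at least the mean.
  by_cases hμw : μ < w
  swap
  · refine ⟨1, one_pos, fun t h hMT hj => absurd ?_ hμw⟩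
    have h1 := hj M hM le_rfl
    refine h1.trans_le ?_
    have hmean : T / M ≤ tau t M := by
      rw [div_le_iff₀ hM0, ← hMT, ← sub_zero (t M), ← h.start, ← Finset.sum_range_sub]
      calc _ ≤ ∑ i ∈ Finset.range M, tau t M := by
            refine Finset.sum_le_sum fun i hi => ?_
            exact h.tau_le_tau (i := i + 1) (Finset.mem_range.mp hi) le_rfl
        _ = _ := by simp [mul_comm]
    have := Real.rpow_le_rpow_of_nonpos (by positivity) hmean (by linarith : -α ≤ 0)
    rw [hw]
    gcongr
  set c := α / ((1 - α) * (2 - α)) / 2 with hc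
  have hc0 : 0 < c := by positivity
  -- Relative gap between `μ` and the last weight: for `m = 1` it comes from `τ_1 ≤ T / M`, and for
  -- `m ≥ 2` from the end correction, which exceeds the step restriction by a fixed factor.
  set η := min (1 - μ / w) (c / (1 / (1 - α) + c)) with hη
  have hη0 : 0 < η := lt_min (by rw [sub_pos, div_lt_one hw0]; exact hμw) (by positivity)
  have hη1 : η ≤ 1 := (min_le_left _ _).trans (by
    have : 0 ≤ μ / w := by positivity
    linarith)
  -- With `(1 - β) * η * R = 2`, the last increment of `R ^ j` alone outweighs `μ B`.
  set R := 2 / ((1 - β) * η) with hR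
  have hR0 : 0 < R := by positivity
  have hR1 : 1 ≤ R := by
    rw [hR, le_div_iff₀ (by positivity)]
    nlinarith
  set s := T ^ (-α) * ((1 - β) * η / 2) with hs
  have hs0 : 0 < s := by positivity
  refine ⟨R ^ M / s, by positivity, fun t h hMT hj => ?_⟩
  set V : ℕ → ℝ := fun j => if j = 0 then 0 else R ^ j / s with hV
  have hVs : ∀ j, V (j + 1) = R ^ (j + 1) / s := fun j => by simp [hV]
  have hVle : ∀ j, V j ≤ R ^ j / s := by
    intro j
    rcases j with _ | j
    · simp [hV]; positivity
    · exact (hVs j).le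
  have hVmono : ∀ j, V j ≤ V (j + 1) := by
    intro j
    refine (hVle j).trans ?_
    rw [hVs]
    gcongr
    exact Nat.le_succ j
  have hle := unweight_le (M := M) hb.pos.le (fun j _ => hVmono j)
  refine ⟨unweight β V, by simp [unweight, hV], fun m hm hmM => ⟨?_, ?_⟩⟩
  · refine (hle m hmM).trans ((hVle m).trans ?_)
    gcongr
  · have h' := h.mono_right hmM
    have hτ : 0 < tau t m := by
      obtain ⟨k, rfl⟩ : ∃ k, m = k + 1 := ⟨m - 1, by omega⟩
      exact h.tau_pos (by omega)
    have hgap : μ ≤ (1 - η) * weight α t m m := by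
      rcases Nat.lt_or_ge m 2 with h2 | h2
      · obtain rfl : m = 1 := by omega
        have e1 : η ≤ 1 - μ / w := min_le_left _ _
        have hmean : tau t 1 ≤ T / M := by
          rw [le_div_iff₀ hM0, ← hMT, ← sub_zero (t M), ← h.start, ← Finset.sum_range_sub]
          calc _ = ∑ i ∈ Finset.range M, tau t 1 := by simp [mul_comm]
            _ ≤ _ := by
              refine Finset.sum_le_sum fun i hi => ?_
              exact h.tau_le_tau (j := i + 1) (by omega) (Finset.mem_range.mp hi)
        have hw1 : w ≤ weight α t 1 1 := by
          rw [weight_one hα₁ h', hw]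
          have := Real.rpow_le_rpow_of_nonpos hτ hmean (by linarith : -α ≤ 0)
          gcongr
        calc μ = μ / w * w := by field_simp
          _ ≤ (1 - η) * w := by gcongr; linarith
          _ ≤ _ := mul_le_mul_of_nonneg_left hw1 (by linarith)
      · obtain ⟨n, rfl⟩ : ∃ n, m = n + 2 := ⟨m - 2, by omega⟩
        have e1 : η ≤ c / (1 / (1 - α) + c) := min_le_right _ _
        have h3 := hj (n + 2) hm hmM
        have h4 := (endTerm_bounds hα₀ hα₁ h').1
        have h5 := div_nonneg (slopeTerm_nonneg hα₀ hα₁ h' (n + 1)) hτ.le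
        have h6 := weight_last hα₁ h'
        have hp : 0 < tau t (n + 2) ^ (-α) := Real.rpow_pos_of_pos hτ _
        have h7 : tau t (n + 2) ^ (-α) * (1 / (1 - α) + c) ≤ weight α t (n + 2) (n + 2) := by
          rw [h6, add_div, hc]; linarith
        have e2 : 1 / (1 - α) ≤ (1 - η) * (1 / (1 - α) + c) := by
          rw [le_div_iff₀ (by positivity)] at e1; linarith
        calc μ ≤ tau t (n + 2) ^ (-α) * (1 / (1 - α)) := h3.le
          _ ≤ tau t (n + 2) ^ (-α) * ((1 - η) * (1 / (1 - α) + c)) := by gcongr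
          _ = (1 - η) * (tau t (n + 2) ^ (-α) * (1 / (1 - α) + c)) := by ring
          _ ≤ _ := mul_le_mul_of_nonneg_left h7 (by linarith)
    obtain ⟨k, rfl⟩ : ∃ k, m = k + 1 := ⟨m - 1, by omega⟩
    have hlast := last_le_weight hα₀ hα₁ h' hm
    set W := weight α t (k + 1) (k + 1) with hW
    have hWs : T ^ (-α) ≤ W := by
      have h1 : T ^ (-α) ≤ tau t (k + 1) ^ (-α) := by
        refine Real.rpow_le_rpow_of_nonpos hτ ?_ (by linarith)
        rw [tau_succ, ← hMT]
        have := h.le (show k + 1 ≤ M by omega) le_rfl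
        have := h.le (show 0 ≤ k by omega) (by omega)
        rw [h.start] at this
        linarith
      have h2 : 1 ≤ 1 / (1 - α) := by rw [le_div_iff₀ hα]; linarith
      have h3 : 0 < T ^ (-α) := by positivity
      nlinarith
    rw [scaledDelta_unweight hb.lt_one.ne hm]
    have hsum := mul_sub_le_sum (K := cumWeight α β t (k + 1)) (V := V) (m := k + 1) (k := k)
      (c := (1 - β) * W) (by omega) (fun j _ => hVmono j)
      (fun j hj => hb.cumWeight_nonneg hα₀ hα₁ h' hj) (fun j hj hj' => by
        obtain rfl : j = k := by omega
        rw [cumWeight_last])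
    refine le_trans ?_ (sub_le_sub_right hsum _)
    have hB : unweight β V (k + 1) ≤ β * (R ^ k / s) + (1 - β) * (R ^ (k + 1) / s) := by
      simp only [unweight, hVs]
      have := (hle k (by omega)).trans (hVle k)
      gcongr
    have hx : 1 ≤ R ^ k := one_le_pow₀ hR1
    set X := R ^ k / s with hX
    have hXR : R ^ (k + 1) / s = R * X := by rw [hX, pow_succ]; ring
    have hX0 : 0 < X := by positivity
    rw [hVs, hXR]
    rw [hXR] at hB
    have hW0 : 0 < W := lt_of_lt_of_le (by positivity) hWs
    have hμB : μ * unweight β V (k + 1) ≤ (1 - η) * W * (β * X + (1 - β) * (R * X)) := by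
      have : 0 ≤ β * X + (1 - β) * (R * X) := by positivity
      calc _ ≤ μ * (β * X + (1 - β) * (R * X)) := by gcongr
        _ ≤ _ := by gcongr
    have hVk : (1 - β) * W * (R * X - X) ≤ (1 - β) * W * (R * X - V k) := by
      have := hVle k
      gcongr
    have hRη : (1 - β) * η * R = 2 := by rw [hR]; field_simp
    have hXs : s * X = R ^ k := by rw [hX]; field_simp
    have hWX : T ^ (-α) * X ≤ W * X := by gcongr
    have hTX : 1 ≤ T ^ (-α) * X := by
      have : s ≤ T ^ (-α) := by
        rw [hs]
        refine mul_le_of_le_one_right (by positivity) ?_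
        nlinarith
      calc 1 ≤ s * X := hXs ▸ hx
        _ ≤ _ := by gcongr
    have fin : (1 - β) * W * (R * X - X) - (1 - η) * W * (β * X + (1 - β) * (R * X)) =
        W * X * ((1 - β) * η * R - 1 + η * β) := by ring
    rw [hRη] at fin
    have hηβ : 1 ≤ 2 - 1 + η * β := by
      have : 0 ≤ η * β := by positivity
      linarith
    have hWX0 : 0 < W * X := by positivity
    have := le_mul_of_one_le_right hWX0.le hηβ
    linarith

/-- Barrier with `t^a`-growth, `a ≥ 0`, on sufficiently fine meshes. -/
theorem AdmissibleBeta.exists_power_barrier (hb : AdmissibleBeta α β ε) (hα₀ : 0 < α)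
    (hα₁ : α < 1) (hμ : 0 ≤ μ) (T : ℝ) {a : ℝ} (ha : 0 ≤ a) :
    ∃ h C : ℝ, 0 < h ∧ 0 < C ∧ ∀ (M : ℕ) (t : ℕ → ℝ), NearUniformMesh (ε / 2) M t → t M ≤ T →
      tau t M ≤ h → ∃ B : ℕ → ℝ, B 0 = 0 ∧ ∀ m, 1 ≤ m → m ≤ M → B m ≤ C * t m ^ a ∧
        t m ^ (a - α) ≤ scaledDelta α t B m - μ * B m := by
  have hβ : 0 < 1 - β := by linarith [hb.lt_one]
  set c := min (1 - β) (1 / 3 : ℝ) with hc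
  have hc0 : 0 < c := lt_min hβ (by norm_num)
  -- `h` is chosen so that the kernel at distance `2 h` equals `X`, large enough for an increment of
  -- `V m / 2` over that distance to dominate `(μ + 1) V m`.
  set X := 2 * (μ + 1) / c with hX
  have hX0 : 0 < X := by positivity
  set h := X ^ (-1 / α) / 2 with hh
  have hh0 : 0 < h := by positivity
  have hhX : (2 * h) ^ (-α) = X := by
    rw [hh, mul_div_cancel₀ _ (two_ne_zero), ← Real.rpow_mul hX0.le,
      show -1 / α * -α = 1 by field_simp, Real.rpow_one]
  set s := min (c / 2) ((2 * h) ^ α) with hs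
  have hs0 : 0 < s := by positivity
  refine ⟨h, Real.exp (T / h) / s, hh0, by positivity, fun M t hmesh hMT hτ => ?_⟩
  set V : ℕ → ℝ := fun j => if j = 0 then 0 else t j ^ a * Real.exp (t j / h) / s with hV
  have hVs : ∀ j, 1 ≤ j → V j = t j ^ a * Real.exp (t j / h) / s := fun j hj => by
    simp [hV, show j ≠ 0 by omega]
  have hVmono : ∀ j, j < M → V j ≤ V (j + 1) := by
    intro j hj
    have hp := hmesh.pos (show 1 ≤ j + 1 by omega) hj
    rw [hVs (j + 1) (by omega)]
    rcases Nat.eq_zero_or_pos j with rfl | hj0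
    · simp only [hV, if_true]; positivity
    · have hp' := hmesh.pos hj0 hj.le
      have := (hmesh.step j hj).le
      rw [hVs j hj0]
      gcongr
  have hle := unweight_le hb.pos.le hVmono
  refine ⟨unweight β V, by simp [unweight, hV], fun m hm hmM => ?_⟩
  have hmesh' := hmesh.mono_right hmM
  have hp := hmesh.pos hm hmM
  have hVm : V m = t m ^ a * Real.exp (t m / h) / s := hVs m hm
  have hVm0 : 0 < V m := by rw [hVm]; positivity
  have hVa : t m ^ a ≤ s * V m := by
    rw [hVm, mul_div_cancel₀ _ hs0.ne']
    exact le_mul_of_one_le_right (by positivity) (Real.one_le_exp (by positivity))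
  constructor
  · refine (hle m hmM).trans ?_
    have := hmesh.le hmM le_rfl
    rw [hVm, mul_comm (t m ^ a), mul_div_right_comm]
    gcongr
    linarith
  · rw [scaledDelta_unweight hb.lt_one.ne hm]
    have hB := mul_le_mul_of_nonneg_left (hle m hmM) hμ
    suffices H : t m ^ (a - α) + μ * V m ≤
        ∑ i ∈ Finset.range m, cumWeight α β t m (i + 1) * (V (i + 1) - V i) by linarith
    have hK := fun j (hj : j < m) => hb.cumWeight_nonneg hα₀ hα₁ hmesh' hj
    have hsplit : t m ^ (a - α) = t m ^ a * t m ^ (-α) := by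
      rw [sub_eq_add_neg, Real.rpow_add hp]
    have hq : 0 < t m ^ (-α) := Real.rpow_pos_of_pos hp _
    have hXc : c / 2 * X = μ + 1 := by rw [hX]; field_simp
    rcases le_total (t m) (2 * h) with hcase | hcase
    · have hsum := mul_sub_le_sum (K := cumWeight α β t m) (V := V) (k := 0)
        (c := c * t m ^ (-α)) (Nat.zero_le m) (fun j hj => hVmono j (by omega)) hK
        (fun j _ hj => by
          refine le_trans ?_ (hb.le_cumWeight hα₀ hα₁ hmesh' hj)
          have h1 := hmesh'.lt hj le_rfl
          have h2 := hmesh'.le (Nat.zero_le j) hj.le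
          rw [hmesh.start] at h2
          have := Real.rpow_le_rpow_of_nonpos (sub_pos.mpr h1) (show t m - t j ≤ t m by linarith)
            (by linarith : -α ≤ 0)
          gcongr)
      refine le_trans ?_ hsum
      have hV0 : V 0 = 0 := by simp [hV]
      have h1 : X ≤ t m ^ (-α) := by
        rw [← hhX]; exact Real.rpow_le_rpow_of_nonpos hp hcase (by linarith)
      have h2 : s ≤ c / 2 := min_le_left _ _
      rw [hV0, sub_zero, hsplit]
      have h3 : t m ^ a * t m ^ (-α) ≤ c / 2 * V m * t m ^ (-α) := by
        have : t m ^ a ≤ c / 2 * V m := hVa.trans (by gcongr)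
        gcongr
      have h4 : c / 2 * X * V m ≤ c / 2 * t m ^ (-α) * V m := by gcongr
      rw [hXc] at h4
      linarith
    -- Since no step exceeds `h`, some node lies between `h` and `2 h` before `t m`: far enough for
    -- the exponential to double, near enough for the kernel to be at least `X`.
    · obtain ⟨k, hk, hk1, hk2⟩ : ∃ k, k < m ∧ t k ≤ t m - h ∧ t m - t k ≤ 2 * h := by
        have hex : ∃ k, t m - h < t k := ⟨m, by linarith⟩
        classical
        have h1 := Nat.find_spec hex
        have h2 : Nat.find hex ≤ m := Nat.find_min' hex (by linarith)
        have h3 : Nat.find hex ≠ 0 := by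
          intro h0
          rw [h0, hmesh.start] at h1
          linarith
        obtain ⟨k, hk⟩ := Nat.exists_eq_succ_of_ne_zero h3
        have h4 := Nat.find_min hex (m := k) (by omega)
        rw [hk] at h1 h2
        refine ⟨k, h2, not_lt.mp h4, ?_⟩
        have h5 := hmesh.tau_le_tau (show k + 1 ≤ M by omega) le_rfl
        rw [tau_succ] at h5
        simp only [Nat.succ_eq_add_one] at h1
        linarith
      have hsum := mul_sub_le_sum (K := cumWeight α β t m) (V := V) (k := k)
        (c := c * X) hk.le (fun j hj => hVmono j (by omega)) hK
        (fun j hj hj' => by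
          refine le_trans ?_ (hb.le_cumWeight hα₀ hα₁ hmesh' hj')
          have h1 := hmesh'.lt hj' le_rfl
          have h2 := hmesh'.le hj hj'.le
          rw [← hhX]
          have := Real.rpow_le_rpow_of_nonpos (sub_pos.mpr h1)
            (show t m - t j ≤ 2 * h by linarith) (by linarith : -α ≤ 0)
          gcongr)
      refine le_trans ?_ hsum
      have hVk : V k ≤ V m / 2 := by
        rcases Nat.eq_zero_or_pos k with rfl | hk0
        · simp only [hV, if_true]; rw [← hVm]; positivity
        · have hpk := hmesh.pos hk0 (by omega)
          have htk : t k ≤ t m := by linarith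
          rw [hVs k hk0, hVm]
          have h1 : Real.exp (t k / h) ≤ Real.exp (t m / h) / 2 := by
            have e : Real.exp (t k / h) ≤ Real.exp (t m / h - 1) := by
              rw [Real.exp_le_exp, le_sub_iff_add_le, div_add_one hh0.ne']
              gcongr
              linarith
            refine e.trans ?_
            rw [Real.exp_sub]
            gcongr
            have := Real.add_one_le_exp 1
            linarith
          calc _ ≤ t m ^ a * (Real.exp (t m / h) / 2) / s := by gcongr
            _ = _ := by ring
      have h1 : t m ^ (-α) ≤ ((2 * h) ^ α)⁻¹ := by
        rw [← Real.rpow_neg (by positivity)]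
        exact Real.rpow_le_rpow_of_nonpos (by positivity) hcase (by linarith)
      have h2 : s ≤ (2 * h) ^ α := min_le_right _ _
      have h3 : t m ^ (a - α) ≤ V m := by
        rw [hsplit]
        have h5 : 0 < (2 * h) ^ α := by positivity
        calc _ ≤ (2 * h) ^ α * V m * ((2 * h) ^ α)⁻¹ := by
              have : t m ^ a ≤ (2 * h) ^ α * V m := hVa.trans (by gcongr)
              gcongr
          _ = V m := by field_simp
      have h4 : c * X * (V m / 2) ≤ c * X * (V m - V k) := by
        have : V m / 2 ≤ V m - V k := by linarith
        gcongr
      have h5 : c * X * (V m / 2) = (μ + 1) * V m := by rw [← hXc]; ring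
      linarith

end

/-! ### The function `t ^ (α - 1)`: truncated derivatives and quadrature errors. -/

section

variable {α β ε r C₁ : ℝ} {M m n : ℕ} {t : ℕ → ℝ}

/-- Quantitative consequences of quasi-grading. -/
structure GradedMesh (C₁ r : ℝ) (M : ℕ) (t : ℕ → ℝ) : Prop where
  tau_le : ∀ j, 1 ≤ j → j ≤ M → tau t j ≤ C₁ * (t j / j)
  growth : ∀ i j, 1 ≤ i → i ≤ j → j ≤ M → t j ≤ C₁ ^ 2 * ((j : ℝ) / i) ^ r * t i

namespace NearUniformMesh

theorem le_mul_tau (h : NearUniformMesh ε M t) {j m : ℕ} (hj : j ≤ m) (hm : m ≤ M) :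
    t j ≤ j * tau t m := by
  rw [← sub_zero (t j), ← h.start, ← Finset.sum_range_sub]
  calc _ ≤ ∑ i ∈ Finset.range j, tau t m := Finset.sum_le_sum fun i hi =>
        h.tau_le_tau (i := i + 1) (by have := Finset.mem_range.mp hi; omega) hm
    _ = _ := by simp

theorem mul_le_mul (h : NearUniformMesh ε M t) {j m : ℕ} (hj : j ≤ m) (hm : m ≤ M) :
    m * t j ≤ j * t m := by
  induction m, hj using Nat.le_induction with
  | base => exact le_rfl
  | succ n hn ih =>
    have h1 := ih (by omega)
    have h2 := h.le_mul_tau (show j ≤ n + 1 by omega) hm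
    rw [tau_succ] at h2
    push_cast
    linarith

theorem le_three_mul (h : NearUniformMesh ε M t) (hε : ε ≤ 1 / 2) {j : ℕ} (hj : j + 2 ≤ M) :
    t (j + 2) ≤ 3 * t (j + 1) := by
  have h1 := h.ratio j hj
  have h2 := h.le (Nat.zero_le j) (show j ≤ M by omega)
  have h3 : 0 < tau t (j + 2) := h.tau_pos (show j + 1 < M by omega)
  rw [h.start] at h2
  have h4 : tau t (j + 2) ≤ 2 * tau t (j + 1) := by nlinarith
  simp only [tau] at h4
  norm_num at h4
  linarith

end NearUniformMesh

/-- Closed form of the fractional derivative of `s ↦ s^{α-1}` truncated at `x`. -/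
def truncation (α T x : ℝ) : ℝ := 1 / T * ((T - x) ^ (1 - α) * x ^ (α - 1))

/-- The derivative of `truncation α T` at `s` is `-(1 - α) (T - s) ^ (-α) s ^ (α - 2)`, and the
kernel `(T - s) ^ (-α)` is smallest at `s = a`. The proof uses weighted means instead: `a ^ α b ^ (1
- α) + (T - a) ^ α (T - b) ^ (1 - α) ≤ T`. -/
theorem kernel_mul_le_truncation_sub (hα₀ : 0 < α) (hα₁ : α < 1) {a b T : ℝ} (ha : 0 < a)
    (hab : a < b) (hbT : b ≤ T) :
    (T - a) ^ (-α) * (a ^ (α - 1) - b ^ (α - 1)) ≤ truncation α T a - truncation α T b := by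
  have hb : 0 < b := ha.trans hab
  have hT : 0 < T := hb.trans_le hbT
  have hTa : 0 < T - a := by linarith
  have hTb : 0 ≤ T - b := by linarith
  have g1 := Real.geom_mean_le_arith_mean2_weighted hα₀.le (by linarith : 0 ≤ 1 - α) ha.le hb.le
    (by ring)
  have g2 := Real.geom_mean_le_arith_mean2_weighted hα₀.le (by linarith : 0 ≤ 1 - α) hTa.le hTb
    (by ring)
  have e1 : a ^ (α - 1) = a ^ α / a := by rw [Real.rpow_sub_one ha.ne']
  have e2 : b ^ (1 - α) * b ^ (α - 1) = 1 := by
    rw [← Real.rpow_add hb]; simp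
  have e3 : (T - a) ^ (1 - α) = (T - a) ^ (-α) * (T - a) := rpow_one_sub_eq hTa
  have e4 : (T - a) ^ α * (T - a) ^ (-α) = 1 := by rw [← Real.rpow_add hTa]; simp
  have hb1 : 0 < b ^ (α - 1) := Real.rpow_pos_of_pos hb _
  have hTa1 : 0 < (T - a) ^ (-α) := Real.rpow_pos_of_pos hTa _
  have key : a ^ α * b ^ (1 - α) + (T - a) ^ α * (T - b) ^ (1 - α) ≤ T := by linarith
  have key2 := mul_le_mul_of_nonneg_right key (mul_pos hb1 hTa1).le
  have key3 : a ^ α * (T - a) ^ (-α) + (T - b) ^ (1 - α) * b ^ (α - 1) ≤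
      T * (b ^ (α - 1) * (T - a) ^ (-α)) := by
    refine le_trans (le_of_eq ?_) key2
    calc _ = a ^ α * (b ^ (1 - α) * b ^ (α - 1)) * (T - a) ^ (-α) +
          ((T - a) ^ α * (T - a) ^ (-α)) * ((T - b) ^ (1 - α) * b ^ (α - 1)) := by
          rw [e2, e4]; ring
      _ = _ := by ring
  rw [truncation, truncation, ← mul_sub, e3, one_div, ← div_eq_inv_mul, le_div_iff₀ hT]
  have e5 : a ^ α = a ^ (α - 1) * a := by rw [e1]; field_simp
  rw [e5] at key3
  linarith

theorem truncation_nonneg {x T : ℝ} (hx : 0 ≤ x) (hxT : x ≤ T) : 0 ≤ truncation α T x := by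
  have : 0 ≤ T - x := by linarith
  have : 0 ≤ T := by linarith
  unfold truncation
  positivity

/-- Consider a jump to `x ^ (α - 1)` at time `0`, kept until `x`, followed by the decay of `s ^ (α -
1)`. The jump exceeds the effect of the decay by this amount, by Bernoulli. -/
theorem le_sub_truncation (hα₀ : 0 < α) (hα₁ : α < 1) {x T : ℝ} (hx : 0 < x) (hxT : x ≤ T) :
    (1 - α) * (x ^ α * T ^ (-α - 1)) ≤ T ^ (-α) * x ^ (α - 1) - truncation α T x := by
  have hT : 0 < T := hx.trans_le hxT
  have h := rpow_one_add_le_one_add_mul_self (s := -(x / T))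
    (by rw [neg_le_neg_iff, div_le_one hT]; exact hxT) (by linarith : 0 ≤ 1 - α) (by linarith)
  have e1 : (T - x) ^ (1 - α) = T ^ (1 - α) * (1 + -(x / T)) ^ (1 - α) := by
    rw [← Real.mul_rpow hT.le (by
      have : x / T ≤ 1 := (div_le_one hT).mpr hxT
      linarith)]
    congr 1
    field_simp
    ring
  have hp : 0 < T ^ (-α) := Real.rpow_pos_of_pos hT _
  have hq : 0 < x ^ (α - 1) := Real.rpow_pos_of_pos hx _
  have e5 : x ^ α = x ^ (α - 1) * x := by rw [Real.rpow_sub_one hx.ne']; field_simp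
  rw [truncation, e1, rpow_one_sub_eq hT, e5, Real.rpow_sub_one hT.ne']
  have h2 := mul_le_mul_of_nonneg_left h (mul_pos hp hq).le
  calc _ = T ^ (-α) * x ^ (α - 1) -
        T ^ (-α) * x ^ (α - 1) * (1 + (1 - α) * -(x / T)) := by field_simp; ring
    _ ≤ T ^ (-α) * x ^ (α - 1) - T ^ (-α) * x ^ (α - 1) * (1 + -(x / T)) ^ (1 - α) := by
        linarith
    _ = _ := by field_simp

/-- The same balance for a jump at a later time `y`, whose kernel value is only known to be at least
`(T - x) ^ (-α)`, with `x` the preceding node. -/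
theorem le_kernel_sub_truncation (hα₀ : 0 < α) (hα₁ : α < 1) {x y T : ℝ} (hx : 0 < x)
    (hxy : x ≤ y) (hyT : y < T) :
    T ^ (-α) * y ^ (α - 1) * (x / T) ≤ (T - x) ^ (-α) * y ^ (α - 1) - truncation α T y := by
  have hT : 0 < T := by linarith
  have hTx : 0 < T - x := by linarith
  have hy : 0 < y := by linarith
  have h1 : (T - y) ^ (1 - α) ≤ (T - x) ^ (1 - α) :=
    Real.rpow_le_rpow (by linarith) (by linarith) (by linarith)
  rw [rpow_one_sub_eq hTx] at h1
  have hq : 0 < y ^ (α - 1) := Real.rpow_pos_of_pos hy _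
  have h2 : truncation α T y ≤ 1 / T * ((T - x) ^ (-α) * (T - x) * y ^ (α - 1)) := by
    unfold truncation; gcongr
  have h3 : T ^ (-α) ≤ (T - x) ^ (-α) :=
    Real.rpow_le_rpow_of_nonpos hTx (by linarith) (by linarith)
  calc _ ≤ (T - x) ^ (-α) * y ^ (α - 1) * (x / T) := by gcongr
    _ = (T - x) ^ (-α) * y ^ (α - 1) - 1 / T * ((T - x) ^ (-α) * (T - x) * y ^ (α - 1)) := by
        field_simp; ring
    _ ≤ _ := by linarith

theorem rpow_sub_one_sub_le (hα₀ : 0 < α) (hα₁ : α < 1) {a b : ℝ} (ha : 0 < a) (hab : a ≤ b) :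
    a ^ (α - 1) - b ^ (α - 1) ≤ (b - a) * a ^ (α - 2) := by
  have h := rpow_neg_tangent (α := 1 - α) (by linarith) (by linarith) (ha.trans_le hab) ha
  rw [show -(1 - α) = α - 1 by ring, show α - 1 - 1 = α - 2 by ring] at h
  have : 0 < a ^ (α - 2) := Real.rpow_pos_of_pos ha _
  have : 0 ≤ b - a := by linarith
  nlinarith [mul_nonneg (mul_nonneg hα₀.le ‹0 < a ^ (α - 2)›.le) this]

/-- With `N = m + 1`, the indices `i + 1` and `m - i` add up to `N`, so one of them is at least `N /
2`. Bounding its power by that of `N` leaves a convergent series in the other. -/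
theorem exists_sum_convolution_le (hα₀ : 0 < α) (hα₁ : α < 1) :
    ∃ S : ℝ, 0 < S ∧ ∀ m : ℕ, ∑ i ∈ Finset.range m,
      ((i + 1 : ℕ) : ℝ) ^ (α - 2) * ((m + 1 : ℕ) : ℝ) * ((m - i : ℕ) : ℝ) ^ (-α - 1) ≤
        S * ((m + 1 : ℕ) : ℝ) ^ (-min α (1 - α)) := by
  have s1 : Summable fun n : ℕ => ((n + 1 : ℕ) : ℝ) ^ (α - 2) :=
    (summable_nat_add_iff 1).mpr (Real.summable_nat_rpow.mpr (by linarith))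
  have s2 : Summable fun n : ℕ => ((n + 1 : ℕ) : ℝ) ^ (-α - 1) :=
    (summable_nat_add_iff 1).mpr (Real.summable_nat_rpow.mpr (by linarith))
  set S1 := ∑' n : ℕ, ((n + 1 : ℕ) : ℝ) ^ (α - 2) with hS1
  set S2 := ∑' n : ℕ, ((n + 1 : ℕ) : ℝ) ^ (-α - 1) with hS2
  have p1 : 0 ≤ S1 := tsum_nonneg fun n => by positivity
  have p2 : 0 ≤ S2 := tsum_nonneg fun n => by positivity
  refine ⟨4 * (S1 + S2) + 1, by positivity, fun m => ?_⟩
  have hN : (0 : ℝ) < ((m + 1 : ℕ) : ℝ) := by positivity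
  have hN1 : (1 : ℝ) ≤ ((m + 1 : ℕ) : ℝ) := by push_cast; linarith [(Nat.cast_nonneg m : (0:ℝ) ≤ m)]
  set N := ((m + 1 : ℕ) : ℝ) with hNdef
  have hterm : ∀ i ∈ Finset.range m,
      ((i + 1 : ℕ) : ℝ) ^ (α - 2) * N * ((m - i : ℕ) : ℝ) ^ (-α - 1) ≤
      4 * N ^ (-α) * ((i + 1 : ℕ) : ℝ) ^ (α - 2) +
        4 * N ^ (α - 1) * ((m - i : ℕ) : ℝ) ^ (-α - 1) := by
    intro i hi
    have hi := Finset.mem_range.mp hi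
    have hsum : ((i + 1 : ℕ) : ℝ) + ((m - i : ℕ) : ℝ) = N := by
      rw [hNdef, ← Nat.cast_add]; congr 1; omega
    have hx : (0 : ℝ) < ((i + 1 : ℕ) : ℝ) := by positivity
    have hy : (0 : ℝ) < ((m - i : ℕ) : ℝ) := by exact_mod_cast (show 0 < m - i by omega)
    set x := ((i + 1 : ℕ) : ℝ)
    set y := ((m - i : ℕ) : ℝ)
    rcases le_total (N / 2) y with h | h
    · have h1 : y ^ (-α - 1) ≤ (N / 2) ^ (-α - 1) :=
        Real.rpow_le_rpow_of_nonpos (by positivity) h (by linarith)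
      have h2 : (N / 2) ^ (-α - 1) ≤ 4 * N ^ (-α - 1) := by
        rw [Real.div_rpow hN.le (by norm_num), div_eq_mul_inv, ← Real.rpow_neg (by norm_num),
          mul_comm]
        gcongr
        calc (2 : ℝ) ^ (-(-α - 1)) ≤ 2 ^ (2 : ℝ) :=
              Real.rpow_le_rpow_of_exponent_le (by norm_num) (by linarith)
          _ = 4 := by norm_num
      have h3 : N * N ^ (-α - 1) = N ^ (-α) := by rw [Real.rpow_sub_one hN.ne']; field_simp
      have h4 : 0 ≤ 4 * N ^ (α - 1) * y ^ (-α - 1) := by positivity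
      calc _ ≤ x ^ (α - 2) * N * (4 * N ^ (-α - 1)) := by gcongr; exact h1.trans h2
        _ = 4 * (N * N ^ (-α - 1)) * x ^ (α - 2) := by ring
        _ ≤ _ := by rw [h3]; linarith
    · have h' : N / 2 ≤ x := by linarith
      have h1 : x ^ (α - 2) ≤ (N / 2) ^ (α - 2) :=
        Real.rpow_le_rpow_of_nonpos (by positivity) h' (by linarith)
      have h2 : (N / 2) ^ (α - 2) ≤ 4 * N ^ (α - 2) := by
        rw [Real.div_rpow hN.le (by norm_num), div_eq_mul_inv, ← Real.rpow_neg (by norm_num),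
          mul_comm]
        gcongr
        calc (2 : ℝ) ^ (-(α - 2)) ≤ 2 ^ (2 : ℝ) :=
              Real.rpow_le_rpow_of_exponent_le (by norm_num) (by linarith)
          _ = 4 := by norm_num
      have h3 : N * N ^ (α - 2) = N ^ (α - 1) := by
        rw [show α - 2 = α - 1 - 1 by ring, Real.rpow_sub_one hN.ne']; field_simp
      have h4 : 0 ≤ 4 * N ^ (-α) * x ^ (α - 2) := by positivity
      calc _ ≤ 4 * N ^ (α - 2) * N * y ^ (-α - 1) := by gcongr; exact h1.trans h2
        _ = 4 * (N * N ^ (α - 2)) * y ^ (-α - 1) := by ring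
        _ ≤ _ := by rw [h3]; linarith
  refine (Finset.sum_le_sum hterm).trans ?_
  rw [Finset.sum_add_distrib, ← Finset.mul_sum, ← Finset.mul_sum]
  have b1 : ∑ i ∈ Finset.range m, ((i + 1 : ℕ) : ℝ) ^ (α - 2) ≤ S1 :=
    s1.sum_le_tsum _ fun i _ => by positivity
  have b2 : ∑ i ∈ Finset.range m, ((m - i : ℕ) : ℝ) ^ (-α - 1) ≤ S2 := by
    rw [← Finset.sum_range_reflect]
    refine le_trans (le_of_eq ?_) (s2.sum_le_tsum (Finset.range m) fun i _ => by positivity)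
    refine Finset.sum_congr rfl fun i hi => ?_
    have := Finset.mem_range.mp hi
    congr 2
    omega
  have q1 : N ^ (-α) ≤ N ^ (-min α (1 - α)) :=
    Real.rpow_le_rpow_of_exponent_le hN1 (neg_le_neg (min_le_left _ _))
  have q2 : N ^ (α - 1) ≤ N ^ (-min α (1 - α)) :=
    Real.rpow_le_rpow_of_exponent_le hN1 (by linarith [min_le_right α (1 - α)])
  have q0 : 0 < N ^ (-min α (1 - α)) := by positivity
  calc _ ≤ 4 * N ^ (-min α (1 - α)) * S1 + 4 * N ^ (-min α (1 - α)) * S2 := by gcongr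
    _ ≤ _ := by linarith

end

/-! ### Local estimates for increments of `t ^ (α - 1)`. -/

section

variable {α β ε r C₁ : ℝ} {M m n : ℕ} {t : ℕ → ℝ}

/-- Split `x_{i+1} g_{i+1} - x_i g_i = x_{i+1} wt_{i+1} - g_i (x_i - x_{i+1})`, compare the second
part with `Ψ`, and sum by parts. Each increment `wt_{i+1}` then acts as an independent copy of `x`
switched on at `i + 1`, with gain `D x - Ψ`. -/
theorem le_sum_mul_sub {g wt D x Ψ E : ℕ → ℝ} {p m : ℕ} (hpm : p ≤ m)
    (hg : ∀ i, p ≤ i → g (i + 1) = g i + wt (i + 1)) (hg0 : ∀ i, p ≤ i → i < m → 0 ≤ g i)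
    (hD : ∀ i, p ≤ i → i < m → D (i + 1) * (x i - x (i + 1)) ≤ Ψ i - Ψ (i + 1) + E i) :
    -(g p * Ψ p) + g m * Ψ m +
        ∑ i ∈ Finset.Ico p m, wt (i + 1) * (D (i + 1) * x (i + 1) - Ψ (i + 1)) -
        ∑ i ∈ Finset.Ico p m, g i * E i ≤
      ∑ i ∈ Finset.Ico p m, D (i + 1) * (x (i + 1) * g (i + 1) - x i * g i) := by
  induction m, hpm using Nat.le_induction with
  | base => simp
  | succ n hn ih =>
    have h1 := ih (fun i hi hi' => hg0 i hi (by omega)) fun i hi hi' => hD i hi (by omega)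
    have h2 := mul_le_mul_of_nonneg_left (hD n hn (by omega)) (hg0 n hn (by omega))
    rw [Finset.sum_Ico_succ_top hn, Finset.sum_Ico_succ_top hn, Finset.sum_Ico_succ_top hn]
    have h3 := hg n hn
    rw [h3]
    linarith

theorem div_three_rpow_le {a x : ℝ} (hx : 0 < x) (ha : -2 ≤ a) : (x / 3) ^ a ≤ 9 * x ^ a := by
  rw [Real.div_rpow hx.le (by norm_num), div_eq_mul_inv, ← Real.rpow_neg (by norm_num), mul_comm]
  gcongr
  calc (3 : ℝ) ^ (-a) ≤ 3 ^ (2 : ℝ) :=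
        Real.rpow_le_rpow_of_exponent_le (by norm_num) (by linarith)
    _ = 9 := by norm_num

/-- The continuous bound uses the kernel at the left node while `weight_le` gives the right node.
The error is the product of the two increments, of second order in the step; grading (`τ_j ≲ t_j /
j`) and convexity of the mesh (`t_j / j ≤ t_N / N`) express it in indices alone. -/
theorem weight_mul_sub_le (hα₀ : 0 < α) (hα₁ : α < 1) (hε : ε ≤ 1 / 2) (hC₁ : 0 < C₁)
    (h : NearUniformMesh ε (n + 1) t) (hg : GradedMesh C₁ r (n + 1) t) {i : ℕ} (hi : 1 ≤ i)
    (hin : i < n) :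
    weight α t (n + 1) (i + 1) * (t i ^ (α - 1) - t (i + 1) ^ (α - 1)) ≤
      truncation α (t (n + 1)) (t i) - truncation α (t (n + 1)) (t (i + 1)) +
        9 * C₁ ^ 2 * (t (n + 1))⁻¹ * (((i + 1 : ℕ) : ℝ) ^ (α - 2) * ((n + 1 : ℕ) : ℝ) *
          ((n - i : ℕ) : ℝ) ^ (-α - 1)) := by
  have hi0 := h.pos hi (by omega)
  have hi1 := h.lt (show i < i + 1 by omega) (by omega)
  have hlast := h.lt (show i + 1 < n + 1 by omega) le_rfl
  have hT := h.pos (show 1 ≤ n + 1 by omega) le_rfl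
  have hw := weight_le hα₀ hα₁ h (show i + 2 ≤ n + 1 by omega)
  have he := rpow_sub_one_sub_le hα₀ hα₁ hi0 hi1.le
  have he0 : 0 ≤ t i ^ (α - 1) - t (i + 1) ^ (α - 1) :=
    sub_nonneg.mpr (Real.rpow_le_rpow_of_nonpos hi0 hi1.le (by linarith))
  have hk := kernel_mul_le_truncation_sub hα₀ hα₁ hi0 hi1 hlast.le
  have hφ := rpow_neg_tangent hα₀ hα₁ (show 0 < t (n + 1) - t i by linarith)
    (show 0 < t (n + 1) - t (i + 1) by linarith)
  have h3 : t (i + 1) ≤ 3 * t i := by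
    obtain ⟨j, rfl⟩ : ∃ j, i = j + 1 := ⟨i - 1, by omega⟩
    exact h.le_three_mul hε (by omega)
  have hτ := hg.tau_le (i + 1) (by omega) (by omega)
  rw [tau_succ] at hτ
  have hmean := h.mul_le_mul (show i + 1 ≤ n + 1 by omega) le_rfl
  have hni : ((n - i : ℕ) : ℝ) = ((n + 1 : ℕ) : ℝ) - ((i + 1 : ℕ) : ℝ) := by
    rw [Nat.cast_sub hin.le]; push_cast; ring
  have hni0 : (0 : ℝ) < ((n - i : ℕ) : ℝ) := by exact_mod_cast (show 0 < n - i by omega)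
  have hN : (0 : ℝ) < ((n + 1 : ℕ) : ℝ) := by positivity
  have hJ : (0 : ℝ) < ((i + 1 : ℕ) : ℝ) := by positivity
  set N := ((n + 1 : ℕ) : ℝ)
  set J := ((i + 1 : ℕ) : ℝ)
  set D := ((n - i : ℕ) : ℝ)
  set T := t (n + 1)
  set a := t i
  set b := t (i + 1)
  have hb0 : 0 < b := by linarith
  have hTb : 0 < T - b := by linarith
  have q1 : 0 < (T - b) ^ (-α - 1) := Real.rpow_pos_of_pos hTb _
  have hφ' : (T - b) ^ (-α) - (T - a) ^ (-α) ≤ (b - a) * (T - b) ^ (-α - 1) := by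
    have : α * (T - b) ^ (-α - 1) * (T - a - (T - b)) ≤ 1 * (T - b) ^ (-α - 1) * (b - a) := by
      rw [show T - a - (T - b) = b - a by ring]
      have : 0 ≤ b - a := by linarith
      gcongr
    linarith
  have hφ0 : 0 ≤ (T - b) ^ (-α) - (T - a) ^ (-α) :=
    sub_nonneg.mpr (Real.rpow_le_rpow_of_nonpos hTb (by linarith) (by linarith))
  have herr : ((T - b) ^ (-α) - (T - a) ^ (-α)) * (a ^ (α - 1) - b ^ (α - 1)) ≤
      9 * C₁ ^ 2 * T⁻¹ * (J ^ (α - 2) * N * D ^ (-α - 1)) := by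
    have u1 : a ^ (α - 2) ≤ 9 * b ^ (α - 2) :=
      (Real.rpow_le_rpow_of_nonpos (by positivity) (show b / 3 ≤ a by linarith)
        (by linarith)).trans (div_three_rpow_le hb0 (by linarith))
    have u2 : (T - b) ^ (-α - 1) ≤ (T * D / N) ^ (-α - 1) := by
      refine Real.rpow_le_rpow_of_nonpos (by positivity) ?_ (by linarith)
      rw [div_le_iff₀ hN, hni]
      nlinarith
    have u3 : b ^ α ≤ (J * T / N) ^ α := by
      refine Real.rpow_le_rpow hb0.le ?_ hα₀.le
      rw [le_div_iff₀ hN]; linarith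
    have hba : 0 ≤ b - a := by linarith
    have q2 : 0 < b ^ (α - 2) := Real.rpow_pos_of_pos hb0 _
    have e1 : (C₁ * (b / J)) ^ 2 * b ^ (α - 2) = C₁ ^ 2 / J ^ 2 * b ^ α := by
      have : b ^ α = b ^ (α - 2) * b ^ 2 := by
        rw [← Real.rpow_natCast, ← Real.rpow_add hb0]; congr 1; push_cast; ring
      rw [this]; field_simp
    calc _ ≤ ((b - a) * (T - b) ^ (-α - 1)) * ((b - a) * a ^ (α - 2)) := by gcongr
      _ = (b - a) ^ 2 * a ^ (α - 2) * (T - b) ^ (-α - 1) := by ring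
      _ ≤ (C₁ * (b / J)) ^ 2 * (9 * b ^ (α - 2)) * (T * D / N) ^ (-α - 1) := by gcongr
      _ = 9 * (C₁ ^ 2 / J ^ 2 * b ^ α) * (T * D / N) ^ (-α - 1) := by rw [← e1]; ring
      _ ≤ 9 * (C₁ ^ 2 / J ^ 2 * (J * T / N) ^ α) * (T * D / N) ^ (-α - 1) := by gcongr
      _ = _ := by
        rw [Real.div_rpow (by positivity) hN.le, Real.mul_rpow hJ.le hT.le,
          Real.div_rpow (by positivity) hN.le, Real.mul_rpow hT.le hni0.le,
          show α - 2 = α - (2 : ℕ) by push_cast; ring, Real.rpow_sub_natCast hJ.ne',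
          Real.rpow_sub_one hN.ne', Real.rpow_sub_one hT.ne', Real.rpow_neg hN.le,
          Real.rpow_neg hT.le]
        field_simp
  calc _ ≤ (T - b) ^ (-α) * (a ^ (α - 1) - b ^ (α - 1)) := by gcongr
    _ = (T - a) ^ (-α) * (a ^ (α - 1) - b ^ (α - 1)) +
        ((T - b) ^ (-α) - (T - a) ^ (-α)) * (a ^ (α - 1) - b ^ (α - 1)) := by ring
    _ ≤ _ := add_le_add hk herr

theorem slopeTerm_add_endTerm_le (hα₀ : 0 < α) (hα₁ : α < 1) (h : NearUniformMesh ε (n + 2) t) :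
    slopeTerm α t (n + 2) (n + 1) + endTerm α t (n + 2) ≤
      tau t (n + 2) ^ (-α) * tau t (n + 2) * (1 + α / ((1 - α) * (2 - α))) := by
  have hτ : 0 < tau t (n + 2) := h.tau_pos (show n + 1 < n + 2 by omega)
  have hτ' : 0 < tau t (n + 1) := h.tau_pos (show n < n + 2 by omega)
  have hx1 := (h.ratio_mem le_rfl).2
  have hx0 : 0 < tau t (n + 1) / tau t (n + 2) := by positivity
  have s1 := slopeTerm_pred_le hα₀ hα₁ h
  have e2 := (endTerm_bounds hα₀ hα₁ h).2
  rw [div_le_iff₀ hτ] at e2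
  have hp : 0 < tau t (n + 2) ^ (-α) := Real.rpow_pos_of_pos hτ _
  set x := tau t (n + 1) / tau t (n + 2)
  have hx : α * x ^ 3 / 6 / (1 + x) ≤ 1 := by
    rw [div_le_one (by linarith)]
    have : x ^ 3 ≤ 1 := pow_le_one₀ hx0.le hx1
    nlinarith [pow_pos hx0 3]
  have : tau t (n + 2) ^ (-α) * tau t (n + 2) * (α * x ^ 3 / 6 / (1 + x)) ≤
      tau t (n + 2) ^ (-α) * tau t (n + 2) * 1 := by gcongr
  linarith

theorem weight_last_mul_sub_le (hα₀ : 0 < α) (hα₁ : α < 1) (hε : ε ≤ 1 / 2) (hC₁ : 0 < C₁)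
    (h : NearUniformMesh ε (n + 2) t) (hg : GradedMesh C₁ r (n + 2) t) :
    weight α t (n + 2) (n + 2) * (t (n + 1) ^ (α - 1) - t (n + 2) ^ (α - 1)) ≤
      9 * C₁ ^ (1 - α) * (1 / (1 - α) + (1 + α / ((1 - α) * (2 - α)))) *
        (t (n + 2))⁻¹ * ((n + 2 : ℕ) : ℝ) ^ (α - 1) := by
  have hτ : 0 < tau t (n + 2) := h.tau_pos (show n + 1 < n + 2 by omega)
  have hi0 := h.pos (show 1 ≤ n + 1 by omega) (by omega)
  have hi1 := h.lt (show n + 1 < n + 2 by omega) le_rfl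
  have hT : 0 < t (n + 2) := by linarith
  have he := rpow_sub_one_sub_le hα₀ hα₁ hi0 hi1.le
  rw [show t (n + 2) - t (n + 1) = tau t (n + 2) from rfl] at he
  have he0 : 0 ≤ t (n + 1) ^ (α - 1) - t (n + 2) ^ (α - 1) :=
    sub_nonneg.mpr (Real.rpow_le_rpow_of_nonpos hi0 hi1.le (by linarith))
  have h3 := h.le_three_mul hε le_rfl
  have hN : (0 : ℝ) < ((n + 2 : ℕ) : ℝ) := by positivity
  have ht := hg.tau_le (n + 2) (by omega) le_rfl
  have u1 : t (n + 1) ^ (α - 2) ≤ 9 * t (n + 2) ^ (α - 2) :=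
    (Real.rpow_le_rpow_of_nonpos (by positivity) (show t (n + 2) / 3 ≤ t (n + 1) by linarith)
      (by linarith)).trans (div_three_rpow_le hT (by linarith))
  have hp : 0 < tau t (n + 2) ^ (-α) := Real.rpow_pos_of_pos hτ _
  have hw : weight α t (n + 2) (n + 2) ≤
      tau t (n + 2) ^ (-α) * (1 / (1 - α) + (1 + α / ((1 - α) * (2 - α)))) := by
    rw [weight_last hα₁ h, mul_add]
    gcongr
    rw [div_le_iff₀ hτ]
    have := slopeTerm_add_endTerm_le hα₀ hα₁ h
    linarith
  have hc1 : 0 < 1 - α := by linarith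
  have hc2 : 0 < 2 - α := by linarith
  set c := 1 / (1 - α) + (1 + α / ((1 - α) * (2 - α)))
  have hc : 0 ≤ c := by positivity
  have u2 : tau t (n + 2) ^ (1 - α) ≤ (C₁ * (t (n + 2) / ((n + 2 : ℕ) : ℝ))) ^ (1 - α) :=
    Real.rpow_le_rpow hτ.le ht hc1.le
  calc _ ≤ tau t (n + 2) ^ (-α) * c * (tau t (n + 2) * (9 * t (n + 2) ^ (α - 2))) := by
        gcongr
        refine he.trans ?_
        gcongr
    _ = 9 * c * tau t (n + 2) ^ (1 - α) * t (n + 2) ^ (α - 2) := by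
        rw [rpow_one_sub_eq hτ]; ring
    _ ≤ 9 * c * (C₁ * (t (n + 2) / ((n + 2 : ℕ) : ℝ))) ^ (1 - α) * t (n + 2) ^ (α - 2) := by
        gcongr
    _ = _ := by
      rw [Real.mul_rpow hC₁.le (by positivity), Real.div_rpow hT.le hN.le,
        show α - 2 = -1 - (1 - α) by ring, Real.rpow_sub hT (-1), Real.rpow_neg_one,
        show α - 1 = -(1 - α) by ring, Real.rpow_neg hN.le]
      have : 0 < t (n + 2) ^ (1 - α) := Real.rpow_pos_of_pos hT _
      field_simp

/-- The next-to-last weight may be negative, so the copy switched on there may have a loss instead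
of a gain; this loss is bounded, which is enough because it occurs for one index only. -/
theorem weight_pred_mul_sub_ge (hα₀ : 0 < α) (hα₁ : α < 1) (hε : ε ≤ 1 / 2)
    (h : NearUniformMesh ε (n + 2) t) :
    -(9 * (3 + 2 * (α / ((1 - α) * (2 - α)))) * (t (n + 2))⁻¹ * ((n + 2 : ℕ) : ℝ) ^ α) ≤
      weight α t (n + 2) (n + 1) * t (n + 1) ^ (α - 1) -
        truncation α (t (n + 2)) (t (n + 1)) := by
  have hτ : 0 < tau t (n + 2) := h.tau_pos (show n + 1 < n + 2 by omega)
  have hτ' : 0 < tau t (n + 1) := h.tau_pos (show n < n + 2 by omega)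
  have hi0 := h.pos (show 1 ≤ n + 1 by omega) (by omega)
  have hi1 := h.lt (show n + 1 < n + 2 by omega) le_rfl
  have hT : 0 < t (n + 2) := by linarith
  have h3 := h.le_three_mul hε le_rfl
  have hN : (0 : ℝ) < ((n + 2 : ℕ) : ℝ) := by positivity
  have hp : 0 < tau t (n + 2) ^ (-α) := Real.rpow_pos_of_pos hτ _
  have hc1 : 0 < 1 - α := by linarith
  have hc2 : 0 < 2 - α := by linarith
  have hse := slopeTerm_add_endTerm_le hα₀ hα₁ h
  have hw := weight_pred_ge hα₀ hα₁ h
  set c := α / ((1 - α) * (2 - α)) with hc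
  have hc0 : 0 ≤ c := by positivity
  have hk : 0 ≤ kernelInt α (tau t (n + 2)) (tau t (n + 2) + tau t (n + 1)) := by
    refine le_trans ?_ (mul_le_kernelInt hα₀ hα₁ hτ.le (by linarith))
    have : 0 ≤ tau t (n + 2) + tau t (n + 1) - tau t (n + 2) := by linarith
    positivity
  have hr := h.ratio n le_rfl
  have hτ2 : tau t (n + 2) ≤ 2 * tau t (n + 1) := by nlinarith
  have hw2 : -(2 * (1 + c) * tau t (n + 2) ^ (-α)) ≤ weight α t (n + 2) (n + 1) := by
    refine le_trans ?_ hw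
    rw [le_div_iff₀ hτ']
    have : tau t (n + 2) ^ (-α) * (1 + c) * tau t (n + 2) ≤
        tau t (n + 2) ^ (-α) * (1 + c) * (2 * tau t (n + 1)) := by gcongr
    linarith
  have hq : 0 < t (n + 1) ^ (α - 1) := Real.rpow_pos_of_pos hi0 _
  have htr : truncation α (t (n + 2)) (t (n + 1)) ≤ tau t (n + 2) ^ (-α) * t (n + 1) ^ (α - 1) := by
    rw [truncation, show t (n + 2) - t (n + 1) = tau t (n + 2) from rfl, rpow_one_sub_eq hτ,
      one_div, inv_mul_le_iff₀ hT]
    have : tau t (n + 2) ≤ t (n + 2) := by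
      rw [show tau t (n + 2) = t (n + 2) - t (n + 1) from rfl]; linarith
    calc _ = tau t (n + 2) * (tau t (n + 2) ^ (-α) * t (n + 1) ^ (α - 1)) := by ring
      _ ≤ _ := by gcongr
  have u1 : t (n + 1) ^ (α - 1) ≤ 9 * t (n + 2) ^ (α - 1) :=
    (Real.rpow_le_rpow_of_nonpos (by positivity) (show t (n + 2) / 3 ≤ t (n + 1) by linarith)
      (by linarith)).trans (div_three_rpow_le hT (by linarith))
  have u2 : tau t (n + 2) ^ (-α) ≤ (t (n + 2) / ((n + 2 : ℕ) : ℝ)) ^ (-α) := by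
    refine Real.rpow_le_rpow_of_nonpos (by positivity) ?_ (by linarith)
    rw [div_le_iff₀ hN, mul_comm]
    exact h.le_mul_tau le_rfl le_rfl
  have u3 : (t (n + 2) / ((n + 2 : ℕ) : ℝ)) ^ (-α) * t (n + 2) ^ (α - 1) =
      (t (n + 2))⁻¹ * ((n + 2 : ℕ) : ℝ) ^ α := by
    rw [Real.div_rpow hT.le hN.le, Real.rpow_neg hN.le, div_inv_eq_mul, Real.rpow_neg hT.le,
      Real.rpow_sub_one hT.ne']
    have : 0 < t (n + 2) ^ α := Real.rpow_pos_of_pos hT _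
    field_simp
  have h5 := mul_le_mul_of_nonneg_right hw2 hq.le
  have h6 : tau t (n + 2) ^ (-α) * t (n + 1) ^ (α - 1) ≤
      9 * ((t (n + 2))⁻¹ * ((n + 2 : ℕ) : ℝ) ^ α) := by
    rw [← u3]
    calc _ ≤ (t (n + 2) / ((n + 2 : ℕ) : ℝ)) ^ (-α) * (9 * t (n + 2) ^ (α - 1)) := by gcongr
      _ = _ := by ring
  have h7 : (3 + 2 * c) * (tau t (n + 2) ^ (-α) * t (n + 1) ^ (α - 1)) ≤
      (3 + 2 * c) * (9 * ((t (n + 2))⁻¹ * ((n + 2 : ℕ) : ℝ) ^ α)) := by gcongr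
  linarith

end

/-! ### Summed lower bound for `t ^ (α - 1) g` and logarithmic sums. -/

section

variable {α β ε r C₁ : ℝ} {M m n : ℕ} {t : ℕ → ℝ}

/-- Lower bound for the discrete fractional derivative of `t^{α-1} g` past the index `p`, where
`g` has nonnegative increments `wt`. -/
theorem exists_sum_weight_mul_ge (hα₀ : 0 < α) (hα₁ : α < 1) (hC₁ : 0 < C₁) (r : ℝ) :
    ∃ K : ℝ, 0 < K ∧ ∀ (ε : ℝ) (n : ℕ) (t : ℕ → ℝ), ε ≤ 1 / 2 → NearUniformMesh ε (n + 2) t →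
      GradedMesh C₁ r (n + 2) t → ∀ (p : ℕ) (g wt : ℕ → ℝ), 1 ≤ p → p ≤ n + 1 →
      (∀ i, p ≤ i → g (i + 1) = g i + wt (i + 1)) → (∀ i, 1 ≤ i → i ≤ n + 2 → 0 ≤ wt i) → 0 ≤ g p →
      -(g p * truncation α (t (n + 2)) (t p)) +
          ∑ i ∈ Finset.Ico p n, wt (i + 1) * (t (i + 1) ^ α * t (n + 2) ^ (-α - 1) / 3) -
          K * (t (n + 2))⁻¹ * (wt (n + 1) * ((n + 2 : ℕ) : ℝ) ^ α +
            g (n + 2) * ((n + 2 : ℕ) : ℝ) ^ (-min α (1 - α))) ≤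
        ∑ i ∈ Finset.Ico p (n + 2), weight α t (n + 2) (i + 1) *
          (t (i + 1) ^ (α - 1) * g (i + 1) - t i ^ (α - 1) * g i) := by
  obtain ⟨S, hS, hconv⟩ := exists_sum_convolution_le hα₀ hα₁
  have hc1 : 0 < 1 - α := by linarith
  have hc2 : 0 < 2 - α := by linarith
  set K₁ := 9 * C₁ ^ (1 - α) * (1 / (1 - α) + (1 + α / ((1 - α) * (2 - α)))) with hK₁
  set K₂ := 9 * (3 + 2 * (α / ((1 - α) * (2 - α)))) with hK₂
  have hK₁0 : 0 < K₁ := by positivity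
  have hK₂0 : 0 < K₂ := by positivity
  refine ⟨9 * C₁ ^ 2 * S + K₁ + K₂, by positivity, fun ε n t hε h hgr p g wt hp hpn hg hwt hgp => ?_⟩
  have hT := h.pos (show 1 ≤ n + 2 by omega) le_rfl
  have hN : (0 : ℝ) < ((n + 2 : ℕ) : ℝ) := by positivity
  have hN1 : (1 : ℝ) ≤ ((n + 2 : ℕ) : ℝ) := by exact_mod_cast (show 1 ≤ n + 2 by omega)
  set err : ℕ → ℝ := fun i => 9 * C₁ ^ 2 * (t (n + 2))⁻¹ * (((i + 1 : ℕ) : ℝ) ^ (α - 2) *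
    ((n + 1 + 1 : ℕ) : ℝ) * ((n + 1 - i : ℕ) : ℝ) ^ (-α - 1)) with herr
  set E : ℕ → ℝ := fun i => if i < n + 1 then err i else
    K₁ * (t (n + 2))⁻¹ * ((n + 2 : ℕ) : ℝ) ^ (α - 1) with hE
  have hgmono : ∀ i, p ≤ i → i ≤ n + 2 → 0 ≤ g i ∧ g i ≤ g (n + 2) := by
    intro i hpi hin
    constructor
    · induction i, hpi using Nat.le_induction with
      | base => exact hgp
      | succ j hj ih =>
        have := ih (by omega)
        have := hwt (j + 1) (by omega) hin
        rw [hg j hj]; linarith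
    · have : ∀ d, i + d ≤ n + 2 → g i ≤ g (i + d) := by
        intro d
        induction d with
        | zero => exact fun _ => le_rfl
        | succ d ih =>
          intro hd
          have h1 := ih (by omega)
          have h2 := hwt (i + d + 1) (by omega) hd
          have h3 := hg (i + d) (by omega)
          rw [show i + (d + 1) = i + d + 1 by ring, h3]; linarith
      have := this (n + 2 - i) (by omega)
      rwa [show i + (n + 2 - i) = n + 2 by omega] at this
  have htT : truncation α (t (n + 2)) (t (n + 2)) = 0 := by
    rw [truncation, sub_self, Real.zero_rpow hc1.ne']; ring
  have hE0 : ∀ i, 0 ≤ E i := by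
    intro i
    simp only [hE, herr]
    split_ifs <;> positivity
  have main := le_sum_mul_sub (g := g) (wt := wt) (D := weight α t (n + 2))
    (x := fun i => t i ^ (α - 1)) (Ψ := fun i => truncation α (t (n + 2)) (t i)) (E := E)
    (show p ≤ n + 2 by omega) hg (fun i hi hi' => (hgmono i hi hi'.le).1) (by
      intro i hi hin
      rcases Nat.lt_or_ge i (n + 1) with hlt | hge
      · simp only [hE, hlt, if_true, herr]
        exact weight_mul_sub_le hα₀ hα₁ hε hC₁ h hgr (by omega) hlt
      · obtain rfl : i = n + 1 := by omega
        simp only [hE, lt_irrefl, if_false, show n + 1 + 1 = n + 2 from rfl, htT, sub_zero]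
        have h1 := weight_last_mul_sub_le hα₀ hα₁ hε hC₁ h hgr
        have h2 := truncation_nonneg (α := α) (h.pos (show 1 ≤ n + 1 by omega) (by omega)).le
          (h.lt (show n + 1 < n + 2 by omega) le_rfl).le
        linarith)
  refine le_trans ?_ main
  simp only [htT, mul_zero, add_zero]
  -- Here the kernel lower bound of `le_weight` applies; `t (i + 1) ≤ 3 t i` converts the left node
  -- into the right one and causes the factor `1 / 3`.
  have hgain : ∀ i, p ≤ i → i < n → t (i + 1) ^ α * t (n + 2) ^ (-α - 1) / 3 ≤
      weight α t (n + 2) (i + 1) * t (i + 1) ^ (α - 1) -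
        truncation α (t (n + 2)) (t (i + 1)) := by
    intro i hi hin
    have hi0 := h.pos (show 1 ≤ i by omega) (by omega)
    have hi1 := h.lt (show i < i + 1 by omega) (by omega)
    have hi2 := h.lt (show i + 1 < n + 2 by omega) le_rfl
    have h3 : t (i + 1) ≤ 3 * t i := by
      obtain ⟨j, rfl⟩ : ∃ j, i = j + 1 := ⟨i - 1, by omega⟩
      exact h.le_three_mul hε (by omega)
    have h4 := le_kernel_sub_truncation hα₀ hα₁ hi0 hi1.le hi2
    have h5 := le_weight hα₀ hα₁ h (show i + 3 ≤ n + 2 by omega)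
    have hq : 0 < t (i + 1) ^ (α - 1) := Real.rpow_pos_of_pos (by linarith) _
    have h6 := mul_le_mul_of_nonneg_right h5 hq.le
    have hp : 0 < t (n + 2) ^ (-α) := Real.rpow_pos_of_pos hT _
    have h7 : t (i + 1) ^ α * t (n + 2) ^ (-α - 1) / 3 ≤
        t (n + 2) ^ (-α) * t (i + 1) ^ (α - 1) * (t i / t (n + 2)) := by
      have e5 : t (i + 1) ^ α = t (i + 1) ^ (α - 1) * t (i + 1) := by
        rw [Real.rpow_sub_one (by linarith)]
        have : t (i + 1) ≠ 0 := by linarith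
        field_simp
      rw [e5, Real.rpow_sub_one hT.ne']
      calc _ = t (n + 2) ^ (-α) * t (i + 1) ^ (α - 1) * (t (i + 1) / 3 / t (n + 2)) := by ring
        _ ≤ _ := by gcongr; linarith
    linarith
  have hlastgain : 0 ≤ weight α t (n + 2) (n + 2) * t (n + 2) ^ (α - 1) := by
    have hτ : 0 < tau t (n + 2) := h.tau_pos (show n + 1 < n + 2 by omega)
    have h1 := last_le_weight hα₀ hα₁ h (by omega)
    have : 0 ≤ weight α t (n + 2) (n + 2) := le_trans (by positivity) h1
    positivity
  have hpredgain := weight_pred_mul_sub_ge hα₀ hα₁ hε h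
  have hwn := hwt (n + 1) (by omega) (by omega)
  have hsum1 : ∑ i ∈ Finset.Ico p n, wt (i + 1) * (t (i + 1) ^ α * t (n + 2) ^ (-α - 1) / 3) -
      K₂ * (t (n + 2))⁻¹ * (wt (n + 1) * ((n + 2 : ℕ) : ℝ) ^ α) ≤
      ∑ i ∈ Finset.Ico p (n + 2), wt (i + 1) * (weight α t (n + 2) (i + 1) * t (i + 1) ^ (α - 1) -
        truncation α (t (n + 2)) (t (i + 1))) := by
    have hl := mul_nonneg (hwt (n + 2) (by omega) le_rfl) hlastgain
    rw [Finset.sum_Ico_succ_top (show p ≤ n + 1 by omega)]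
    simp only [show n + 1 + 1 = n + 2 from rfl, htT, sub_zero]
    rcases Nat.lt_or_ge n p with hnp | hpn'
    · obtain rfl : p = n + 1 := by omega
      rw [Finset.Ico_eq_empty (by omega), Finset.Ico_self, Finset.sum_empty]
      have : 0 ≤ K₂ * (t (n + 2))⁻¹ * (wt (n + 1) * ((n + 2 : ℕ) : ℝ) ^ α) := by positivity
      linarith
    · rw [Finset.sum_Ico_succ_top hpn']
      have h1 : ∑ i ∈ Finset.Ico p n, wt (i + 1) * (t (i + 1) ^ α * t (n + 2) ^ (-α - 1) / 3) ≤
          ∑ i ∈ Finset.Ico p n, wt (i + 1) * (weight α t (n + 2) (i + 1) * t (i + 1) ^ (α - 1) -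
          truncation α (t (n + 2)) (t (i + 1))) := by
        refine Finset.sum_le_sum fun i hi => ?_
        have hi := Finset.mem_Ico.mp hi
        exact mul_le_mul_of_nonneg_left (hgain i hi.1 hi.2) (hwt _ (by omega) (by omega))
      have h2 := mul_le_mul_of_nonneg_left hpredgain hwn
      linarith
  have hsum2 : ∑ i ∈ Finset.Ico p (n + 2), g i * E i ≤
      (9 * C₁ ^ 2 * S + K₁) * (t (n + 2))⁻¹ *
        (g (n + 2) * ((n + 2 : ℕ) : ℝ) ^ (-min α (1 - α))) := by
    have hgN := (hgmono (n + 2) (by omega) le_rfl).1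
    have h1 : ∑ i ∈ Finset.Ico p (n + 2), g i * E i ≤ g (n + 2) * ∑ i ∈ Finset.range (n + 2), E i := by
      rw [Finset.mul_sum, Finset.range_eq_Ico]
      refine (Finset.sum_le_sum fun i hi => ?_).trans (Finset.sum_le_sum_of_subset_of_nonneg
        (Finset.Ico_subset_Ico_left (Nat.zero_le p)) fun i _ _ => mul_nonneg hgN (hE0 i))
      have hi := Finset.mem_Ico.mp hi
      exact mul_le_mul_of_nonneg_right (hgmono i hi.1 hi.2.le).2 (hE0 i)
    have h2 : ∑ i ∈ Finset.range (n + 2), E i ≤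
        (9 * C₁ ^ 2 * S + K₁) * (t (n + 2))⁻¹ * ((n + 2 : ℕ) : ℝ) ^ (-min α (1 - α)) := by
      rw [Finset.sum_range_succ]
      have e1 : ∑ i ∈ Finset.range (n + 1), E i = ∑ i ∈ Finset.range (n + 1), err i :=
        Finset.sum_congr rfl fun i hi => by
          simp only [hE, Finset.mem_range.mp hi, if_true]
      have e2 : E (n + 1) = K₁ * (t (n + 2))⁻¹ * ((n + 2 : ℕ) : ℝ) ^ (α - 1) := by
        simp only [hE, lt_irrefl, if_false]
      rw [e1, e2, herr, ← Finset.mul_sum]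
      have h3 := hconv (n + 1)
      have h4 : ((n + 2 : ℕ) : ℝ) ^ (α - 1) ≤ ((n + 2 : ℕ) : ℝ) ^ (-min α (1 - α)) :=
        Real.rpow_le_rpow_of_exponent_le hN1 (by linarith [min_le_right α (1 - α)])
      calc _ ≤ 9 * C₁ ^ 2 * (t (n + 2))⁻¹ * (S * ((n + 2 : ℕ) : ℝ) ^ (-min α (1 - α))) +
            K₁ * (t (n + 2))⁻¹ * ((n + 2 : ℕ) : ℝ) ^ (-min α (1 - α)) := by gcongr
        _ = _ := by ring
    refine h1.trans ((mul_le_mul_of_nonneg_left h2 hgN).trans (le_of_eq ?_))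
    ring
  have hgN := (hgmono (n + 2) (by omega) le_rfl).1
  have r1 : 0 ≤ (9 * C₁ ^ 2 * S + K₁) * (t (n + 2))⁻¹ * (wt (n + 1) * ((n + 2 : ℕ) : ℝ) ^ α) := by
    positivity
  have r2 : 0 ≤ K₂ * (t (n + 2))⁻¹ * (g (n + 2) * ((n + 2 : ℕ) : ℝ) ^ (-min α (1 - α))) := by
    positivity
  linarith

theorem sum_inv_le_one_add_log (N : ℕ) :
    ∑ j ∈ Finset.Icc 1 N, ((j : ℝ))⁻¹ ≤ 1 + Real.log N := by
  have := harmonic_le_one_add_log N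
  rw [harmonic_eq_sum_Icc] at this
  push_cast at this
  exact this

theorem exists_log_mul_rpow_le {K c s : ℝ} (hc : 0 < c) (hs : 0 < s) :
    ∃ p : ℕ, ∀ N : ℕ, p ≤ N → K * ((6 + Real.log N) * (N : ℝ) ^ (-s)) ≤ c := by
  have h1 : Filter.Tendsto (fun x : ℝ => x ^ (-s)) Filter.atTop (nhds 0) :=
    tendsto_rpow_neg_atTop hs
  have h2 : Filter.Tendsto (fun x : ℝ => Real.log x * x ^ (-s)) Filter.atTop (nhds 0) := by
    have := (isLittleO_log_rpow_atTop hs).tendsto_div_nhds_zero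
    refine this.congr' ?_
    filter_upwards [Filter.eventually_gt_atTop 0] with x hx
    rw [Real.rpow_neg hx.le, div_eq_mul_inv]
  have h3 : Filter.Tendsto (fun x : ℝ => K * ((6 + Real.log x) * x ^ (-s))) Filter.atTop
      (nhds 0) := by
    have := ((h1.const_mul 6).add h2).const_mul K
    simp only [mul_zero, add_zero] at this
    refine this.congr fun x => by ring
  have h4 := (h3.comp tendsto_natCast_atTop_atTop).eventually (gt_mem_nhds hc)
  obtain ⟨p, hp⟩ := Filter.eventually_atTop.mp h4
  exact ⟨p, fun N hN => (hp N hN).le⟩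

theorem scaledDelta_add (B₁ B₂ : ℕ → ℝ) (m : ℕ) :
    scaledDelta α t (fun j => B₁ j + B₂ j) m = scaledDelta α t B₁ m + scaledDelta α t B₂ m := by
  simp only [scaledDelta, ← Finset.sum_add_distrib]
  exact Finset.sum_congr rfl fun i _ => by ring

theorem scaledDelta_const_mul (c : ℝ) (B : ℕ → ℝ) (m : ℕ) :
    scaledDelta α t (fun j => c * B j) m = c * scaledDelta α t B m := by
  simp only [scaledDelta, Finset.mul_sum]
  exact Finset.sum_congr rfl fun i _ => by ring

end

/-! ### The singular barrier. -/

section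

variable {α β ε r C₁ : ℝ} {M m n : ℕ} {t : ℕ → ℝ}

/-- The sequence that vanishes at `0` and equals `c` elsewhere. -/
def pulse (c : ℝ) (j : ℕ) : ℝ := if j = 0 then 0 else c

theorem scaledDelta_unweight_pulse (hβ : β ≠ 1) (hm : 1 ≤ m) (c : ℝ) :
    scaledDelta α t (unweight β (pulse c)) m = cumWeight α β t m 1 * c := by
  rw [scaledDelta_unweight hβ hm, Finset.sum_eq_single_of_mem 0 (Finset.mem_range.mpr hm)]
  · simp [pulse]
  · intro i _ hi
    simp [pulse, hi]

theorem unweight_pulse_le (hβ : 0 ≤ β) {c : ℝ} (hc : 0 ≤ c) (j : ℕ) :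
    unweight β (pulse c) j ≤ c := by
  refine (unweight_le (M := j) hβ (V := pulse c) (fun i _ => ?_) j le_rfl).trans ?_
  · unfold pulse; split_ifs <;> simp_all
  · unfold pulse; split_ifs <;> simp_all

/-- The increments of `x` after `p`, accumulated from `0`. -/
def tailPart (p : ℕ) (x : ℕ → ℝ) (j : ℕ) : ℝ := if j ≤ p then 0 else x j - x p

theorem scaledDelta_tailPart_of_le {p : ℕ} (hm : m ≤ p) (x : ℕ → ℝ) :
    scaledDelta α t (tailPart p x) m = 0 := by
  refine Finset.sum_eq_zero fun i hi => ?_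
  have hi := Finset.mem_range.mp hi
  simp [tailPart, show i + 1 ≤ p by omega, show i ≤ p by omega]

theorem scaledDelta_tailPart {p : ℕ} (hm : p ≤ m) (x : ℕ → ℝ) :
    scaledDelta α t (tailPart p x) m =
      ∑ i ∈ Finset.Ico p m, weight α t m (i + 1) * (x (i + 1) - x i) := by
  have h0 := scaledDelta_tailPart_of_le (α := α) (t := t) (le_refl p) x
  rw [scaledDelta, Finset.range_eq_Ico, ← Finset.sum_Ico_consecutive _ (Nat.zero_le p) hm,
    Finset.sum_eq_zero, zero_add]
  · refine Finset.sum_congr rfl fun i hi => ?_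
    have hi := (Finset.mem_Ico.mp hi).1
    rcases hi.eq_or_lt with rfl | hi
    · simp [tailPart]
    · simp [tailPart, show ¬ i + 1 ≤ p by omega, show ¬ i ≤ p by omega]
  · intro i hi
    have hi := (Finset.mem_Ico.mp hi).2
    simp [tailPart, show i + 1 ≤ p by omega, show i ≤ p by omega]

theorem GradedMesh.le_of_le_mul (hgr : GradedMesh C₁ r M t) (h : NearUniformMesh ε M t)
    (hr : 0 ≤ r) {j N : ℕ} {c : ℝ} (hj : 1 ≤ j) (hjN : j ≤ N) (hN : N ≤ M) (hc : (N : ℝ) ≤ c * j) :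
    t N ≤ C₁ ^ 2 * c ^ r * t j := by
  have hj0 : (0 : ℝ) < j := by exact_mod_cast hj
  have := h.pos hj (hjN.trans hN)
  have h1 : (N : ℝ) / j ≤ c := by rwa [div_le_iff₀ hj0]
  refine (hgr.growth j N hj hjN hN).trans ?_
  gcongr

/-- Lower bound for the leading part of the singular barrier. -/
theorem le_leading_part (hα₀ : 0 < α) (hα₁ : α < 1) (hC₁ : 0 < C₁) (hr : 0 ≤ r) {k q c : ℝ}
    (hk : 0 ≤ k) (hq : 0 ≤ q) (h : NearUniformMesh ε (n + 2) t)
    (hgr : GradedMesh C₁ r (n + 2) t) {p : ℕ} (hp : 1 ≤ p) (hpn : p ≤ n + 1) (hn : 2 ≤ n)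
    (hc : c = (C₁ ^ 2 * 4 ^ r)⁻¹) :
    c ^ (q + α) * (1 - α) / 12 * (((n + 2 : ℕ) : ℝ) ^ (-k) * t (n + 2) ^ (q - 1)) ≤
      (p : ℝ) ^ (-k) * t p ^ q * (t (n + 2) ^ (-α) * t p ^ (α - 1) -
        truncation α (t (n + 2)) (t p)) +
      ∑ i ∈ Finset.Ico p n, ((i + 1 : ℕ) : ℝ) ^ (-1 - k) * t (i + 1) ^ q *
        (t (i + 1) ^ α * t (n + 2) ^ (-α - 1) / 3) := by
  have hc0 : 0 < c := by rw [hc]; positivity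
  set N := n + 2 with hN
  set T := t N with hT
  have hT0 : 0 < T := h.pos (show 1 ≤ N by omega) le_rfl
  have hp0 : 0 < t p := h.pos hp (by omega)
  have hpT : t p ≤ T := h.le (by omega) le_rfl
  have hNp : (0 : ℝ) < p := by exact_mod_cast hp
  have hN0 : (0 : ℝ) < N := by positivity
  have hlow : ∀ j, 1 ≤ j → j ≤ N → N ≤ 4 * j → c * T ≤ t j := by
    intro j hj hjN hj4
    have := hgr.le_of_le_mul h hr (c := 4) hj hjN le_rfl (by exact_mod_cast hj4)
    rw [hc, inv_mul_le_iff₀ (by positivity)]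
    exact this
  have hTsplit : T ^ (q - 1) = T ^ (q + α) * T ^ (-α - 1) := by
    rw [← Real.rpow_add hT0]; ring_nf
  have hcT : c ^ (q + α) * T ^ (q + α) = (c * T) ^ q * (c * T) ^ α := by
    rw [← Real.mul_rpow hc0.le hT0.le, Real.rpow_add (by positivity)]
  have hcT0 : 0 < c * T := by positivity
  have hbase0 := le_sub_truncation hα₀ hα₁ hp0 hpT
  have hα : 0 < 1 - α := by linarith
  have hterm : ∀ i ∈ Finset.Ico p n, 0 ≤ ((i + 1 : ℕ) : ℝ) ^ (-1 - k) * t (i + 1) ^ q *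
        (t (i + 1) ^ α * T ^ (-α - 1) / 3) := by
    intro i hi
    have hi := Finset.mem_Ico.mp hi
    have := h.pos (show 1 ≤ i + 1 by omega) (by omega)
    positivity
  -- If `p` is small compared with `N`, about `N / 2` copies switched on in the upper half of the
  -- history give the bound; otherwise `t p` is comparable with `T` and the initial jump alone
  -- suffices.
  rcases Nat.lt_or_ge (4 * p) N with hcase | hcase
  · have hb : 0 ≤ (p : ℝ) ^ (-k) * t p ^ q * (T ^ (-α) * t p ^ (α - 1) - truncation α T (t p)) := by
      have : 0 ≤ T ^ (-α) * t p ^ (α - 1) - truncation α T (t p) :=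
        le_trans (by positivity) hbase0
      positivity
    refine le_trans ?_ (le_add_of_nonneg_left hb)
    refine le_trans ?_ (Finset.sum_le_sum_of_subset_of_nonneg
      (Finset.Ico_subset_Ico_left (show p ≤ n / 2 by omega)) fun i hi _ => hterm i hi)
    have hcard : (N : ℝ) / 4 ≤ ((n - n / 2 : ℕ) : ℝ) := by
      rw [div_le_iff₀ (by norm_num)]
      exact_mod_cast (show N ≤ (n - n / 2) * 4 by omega)
    have hsum : ((n - n / 2 : ℕ) : ℝ) * ((N : ℝ) ^ (-1 - k) * (c * T) ^ q *
        ((c * T) ^ α * T ^ (-α - 1) / 3)) ≤ ∑ i ∈ Finset.Ico (n / 2) n,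
        ((i + 1 : ℕ) : ℝ) ^ (-1 - k) * t (i + 1) ^ q * (t (i + 1) ^ α * T ^ (-α - 1) / 3) := by
      rw [← Nat.card_Ico, ← nsmul_eq_mul]
      refine Finset.card_nsmul_le_sum _ _ _ fun i hi => ?_
      have hi := Finset.mem_Ico.mp hi
      have h1 := hlow (i + 1) (by omega) (by omega) (by omega)
      have h0 := h.pos (show 1 ≤ i + 1 by omega) (by omega)
      have h2 : (N : ℝ) ^ (-1 - k) ≤ ((i + 1 : ℕ) : ℝ) ^ (-1 - k) :=
        Real.rpow_le_rpow_of_nonpos (by positivity)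
          (by exact_mod_cast (show i + 1 ≤ N by omega)) (by linarith)
      gcongr
    refine le_trans ?_ hsum
    have eN : (N : ℝ) * (N : ℝ) ^ (-1 - k) = (N : ℝ) ^ (-k) := by
      rw [sub_eq_add_neg, Real.rpow_add hN0, Real.rpow_neg_one]
      field_simp
    calc _ = (1 - α) * ((N : ℝ) / 4 * ((N : ℝ) ^ (-1 - k) * (c * T) ^ q *
        ((c * T) ^ α * T ^ (-α - 1) / 3))) := by
          rw [hTsplit, ← eN]
          linear_combination (1 - α) / 12 * ((N : ℝ) * (N : ℝ) ^ (-1 - k)) * T ^ (-α - 1) * hcT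
      _ ≤ 1 * ((N : ℝ) / 4 * ((N : ℝ) ^ (-1 - k) * (c * T) ^ q *
        ((c * T) ^ α * T ^ (-α - 1) / 3))) := by gcongr; linarith
      _ ≤ _ := by rw [one_mul]; gcongr
  · refine le_trans ?_ (le_add_of_nonneg_right (Finset.sum_nonneg hterm))
    have h1 := hlow p hp (by omega) hcase
    have h2 : (N : ℝ) ^ (-k) ≤ (p : ℝ) ^ (-k) :=
      Real.rpow_le_rpow_of_nonpos hNp (by exact_mod_cast (show p ≤ N by omega)) (by linarith)
    calc _ = (N : ℝ) ^ (-k) * (c * T) ^ q * ((1 - α) * ((c * T) ^ α * T ^ (-α - 1))) / 12 := by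
          rw [hTsplit]
          linear_combination (1 - α) / 12 * (N : ℝ) ^ (-k) * T ^ (-α - 1) * hcT
      _ ≤ (N : ℝ) ^ (-k) * (c * T) ^ q * ((1 - α) * ((c * T) ^ α * T ^ (-α - 1))) := by
          refine div_le_self (by positivity) (by norm_num)
      _ ≤ (p : ℝ) ^ (-k) * t p ^ q * ((1 - α) * (t p ^ α * T ^ (-α - 1))) := by gcongr
      _ ≤ _ := by gcongr

theorem sum_rpow_mul_rpow_le (h : NearUniformMesh ε M t) {k q : ℝ} (hk : 0 ≤ k) (hq : 0 ≤ q)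
    {N : ℕ} (hN : N ≤ M) (p : ℕ) :
    ∑ j ∈ Finset.Ioc p N, (j : ℝ) ^ (-1 - k) * t j ^ q ≤ t N ^ q * (1 + Real.log N) := by
  rw [mul_comm]
  refine le_trans ?_ (mul_le_mul_of_nonneg_right (sum_inv_le_one_add_log N)
    (Real.rpow_nonneg ?_ q))
  · rw [Finset.sum_mul]
    refine (Finset.sum_le_sum fun j hj => ?_).trans (Finset.sum_le_sum_of_subset_of_nonneg
      (fun j hj => ?_ : Finset.Ioc p N ⊆ Finset.Icc 1 N) fun j hj _ => ?_)
    · have hj := Finset.mem_Ioc.mp hj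
      have h1 := h.pos (show 1 ≤ j by omega) (by omega)
      have h2 := h.le hj.2 hN
      have hj1 : (1 : ℝ) ≤ j := by exact_mod_cast (show 1 ≤ j by omega)
      have h3 : (j : ℝ) ^ (-1 - k) ≤ (j : ℝ)⁻¹ := by
        rw [← Real.rpow_neg_one]
        exact Real.rpow_le_rpow_of_exponent_le hj1 (by linarith)
      gcongr
    · have hj := Finset.mem_Ioc.mp hj
      exact Finset.mem_Icc.mpr ⟨by omega, hj.2⟩
    · have hj := Finset.mem_Icc.mp hj
      have h1 := h.pos (show 1 ≤ N by omega) hN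
      positivity
  · have := h.le (Nat.zero_le N) hN
    rwa [h.start] at this

/-- The remainder in the lower bound for the singular barrier. -/
theorem remainder_le (hα₁ : α < 1) {k q κ w g K : ℝ} (hK : 0 ≤ K)
    (hk : 0 ≤ k) (hκ : κ ≤ 1 - α) (hk4 : 4 * k ≤ κ) (hα₀ : 0 < α) (hq : 0 ≤ q)
    (h : NearUniformMesh ε (n + 2) t)
    (hw : w = ((n + 1 : ℕ) : ℝ) ^ (-1 - k) * t (n + 1) ^ q)
    (hg : g ≤ t (n + 2) ^ q * (2 + Real.log (n + 2 : ℕ))) :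
    K * (t (n + 2))⁻¹ * (w * ((n + 2 : ℕ) : ℝ) ^ α + g * ((n + 2 : ℕ) : ℝ) ^ (-κ)) ≤
      K * ((6 + Real.log (n + 2 : ℕ)) * ((n + 2 : ℕ) : ℝ) ^ (-(3 * κ / 4))) *
        (((n + 2 : ℕ) : ℝ) ^ (-k) * t (n + 2) ^ (q - 1)) := by
  set N : ℝ := ((n + 2 : ℕ) : ℝ) with hN
  have hN1 : (1 : ℝ) ≤ N := by rw [hN]; push_cast; linarith [Nat.cast_nonneg (α := ℝ) n]
  have hN0 : 0 < N := by linarith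
  set T := t (n + 2) with hT
  have hT0 : 0 < T := h.pos (show 1 ≤ n + 2 by omega) le_rfl
  have h1 := h.pos (show 1 ≤ n + 1 by omega) (by omega)
  have h2 := h.le (show n + 1 ≤ n + 2 by omega) le_rfl
  have hlog : 0 ≤ Real.log N := Real.log_nonneg hN1
  have e1 : ((n + 1 : ℕ) : ℝ) ^ (-1 - k) ≤ 4 * N ^ (-1 - k) := by
    have ha : N / 2 ≤ ((n + 1 : ℕ) : ℝ) := by
      rw [hN]; push_cast; linarith [Nat.cast_nonneg (α := ℝ) n]
    have hb := Real.rpow_le_rpow_of_nonpos (by positivity) ha (by linarith : -1 - k ≤ 0)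
    refine hb.trans ?_
    rw [Real.div_rpow hN0.le (by norm_num), div_eq_mul_inv, ← Real.rpow_neg (by norm_num),
      mul_comm]
    gcongr
    calc (2 : ℝ) ^ (-(-1 - k)) ≤ 2 ^ (2 : ℝ) :=
          Real.rpow_le_rpow_of_exponent_le (by norm_num) (by linarith)
      _ = 4 := by norm_num
  have hTq : T ^ q = T ^ (q - 1) * T := by rw [Real.rpow_sub_one hT0.ne']; field_simp
  -- The exponents fit because `κ ≤ 1 - α` and `4 k ≤ κ`; a factor `N ^ (-3 κ / 4)` is left to beat
  -- the logarithm.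
  have e2 : w * N ^ α ≤ T ^ q * (4 * (N ^ (-(3 * κ / 4)) * N ^ (-k))) := by
    calc w * N ^ α ≤ 4 * N ^ (-1 - k) * T ^ q * N ^ α := by rw [hw]; gcongr
      _ = T ^ q * (4 * N ^ (-1 - k + α)) := by rw [Real.rpow_add hN0]; ring
      _ ≤ _ := by
        rw [← Real.rpow_add hN0]
        have := Real.rpow_le_rpow_of_exponent_le hN1
          (show -1 - k + α ≤ -(3 * κ / 4) + -k by linarith)
        gcongr
  have e3 : g * N ^ (-κ) ≤ T ^ q * ((2 + Real.log N) * (N ^ (-(3 * κ / 4)) * N ^ (-k))) := by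
    calc _ ≤ T ^ q * (2 + Real.log N) * N ^ (-κ) := by gcongr
      _ ≤ T ^ q * (2 + Real.log N) * (N ^ (-(3 * κ / 4)) * N ^ (-k)) := by
        rw [← Real.rpow_add hN0]
        have := Real.rpow_le_rpow_of_exponent_le hN1
          (show -κ ≤ -(3 * κ / 4) + -k by linarith)
        gcongr
      _ = _ := by ring
  calc _ ≤ K * T⁻¹ * (T ^ q * (4 * (N ^ (-(3 * κ / 4)) * N ^ (-k))) +
        T ^ q * ((2 + Real.log N) * (N ^ (-(3 * κ / 4)) * N ^ (-k)))) := by gcongr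
    _ = _ := by rw [hTq]; field_simp; ring

/-- Barrier with singular growth `t^{α-1}`. -/
theorem AdmissibleBeta.exists_singular_barrier (hb : AdmissibleBeta α β ε) (hα₀ : 0 < α)
    (hα₁ : α < 1) (hC₁ : 0 < C₁) (hr : 0 ≤ r) {k q : ℝ} (hk : 0 ≤ k)
    (hk4 : 4 * k ≤ min α (1 - α)) (hq : 0 ≤ q) :
    ∃ (p : ℕ) (C : ℝ), 0 < C ∧ ∀ M t, NearUniformMesh (ε / 2) M t → GradedMesh C₁ r M t →
      p ≤ M → ∃ B : ℕ → ℝ, B 0 = 0 ∧ ∀ m, 1 ≤ m → m ≤ M →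
        B m ≤ C * (t m ^ (α - 1) * (t m ^ q +
          ∑ j ∈ Finset.Icc 1 m, (j : ℝ) ^ (-1 - k) * t j ^ q)) ∧
        (m : ℝ) ^ (-k) * t m ^ (q - 1) ≤ scaledDelta α t B m := by
  obtain ⟨K, hK, hmain⟩ := exists_sum_weight_mul_ge hα₀ hα₁ hC₁ r
  set c := (C₁ ^ 2 * (4 : ℝ) ^ r)⁻¹ with hc
  have hc0 : 0 < c := by positivity
  have hα : 0 < 1 - α := by linarith
  set cs := c ^ (q + α) * (1 - α) / 12 with hcs
  have hcs0 : 0 < cs := by positivity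
  set κ := min α (1 - α) with hκ
  have hκ0 : 0 < κ := lt_min hα₀ hα
  obtain ⟨p₀, hp₀⟩ := exists_log_mul_rpow_le (K := K) (c := cs / 2) (s := 3 * κ / 4)
    (by positivity) (by positivity)
  -- Beyond `p₀` the remainder is at most half of the leading part; `p ≥ 3` guarantees `n ≥ 2` when
  -- `m = n + 2 > p`.
  set p := max p₀ 3 with hp
  have hp3 : 3 ≤ p := le_max_right _ _
  have hpp : p₀ ≤ p := le_max_left _ _
  have hpR : (0 : ℝ) < p := by exact_mod_cast (show 0 < p by omega)
  set c₀ := min (1 - β) (1 / 3 : ℝ) with hc₀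
  have hc₀0 : 0 < c₀ := lt_min (by linarith [hb.lt_one]) (by norm_num)
  set D := C₁ ^ 2 * (p : ℝ) ^ r with hD
  have hD0 : 0 < D := by positivity
  set s := min (cs / 2) (c₀ * (p : ℝ) ^ (-k) * D ^ (α - 1)) with hs
  have hs0 : 0 < s := by positivity
  have hε2 : ε / 2 ≤ 1 / 2 := by linarith [hb.eps_lt]
  refine ⟨p, 1 / s * max 1 (D ^ q), by positivity, fun M t h hgr hpM => ?_⟩
  have hθ := h.pos (show 1 ≤ p by omega) hpM
  set w := (p : ℝ) ^ (-k) * t p ^ q with hw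
  have hw0 : 0 < w := by positivity
  -- A copy switched on at `t_j` gains about `t_j ^ α T ^ (-α - 1)`. With these weights, the order
  -- of `N` copies near `T` add up to `N ^ (-k) T ^ (q - 1)`.
  set wt : ℕ → ℝ := fun j => (j : ℝ) ^ (-1 - k) * t j ^ q with hwt
  have hwt0 : ∀ j, 1 ≤ j → j ≤ M → 0 ≤ wt j := by
    intro j hj hjM
    have := h.pos hj hjM
    simp only [hwt]
    positivity
  set g : ℕ → ℝ := fun j => w + ∑ i ∈ Finset.Ioc p j, wt i with hg
  have hgp : g p = w := by simp [hg]
  -- The barrier is a smoothed jump to level `w t_p ^ (α - 1)` at the first node, followed by the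
  -- increments of `t ^ (α - 1) g` after `p`. Since `g p = w`, the two levels match at `p`.
  set B₁ := unweight β (pulse (w * t p ^ (α - 1))) with hB₁
  set B₂ := tailPart p (fun j => t j ^ (α - 1) * g j) with hB₂
  have hV0 : 0 < w * t p ^ (α - 1) := by positivity
  have hB₁le := unweight_pulse_le hb.pos.le hV0.le
  have hpk : (p : ℝ) ^ (-k) ≤ 1 :=
    Real.rpow_le_one_of_one_le_of_nonpos (by exact_mod_cast (show 1 ≤ p by omega)) (by linarith)
  refine ⟨fun j => 1 / s * (B₁ j + B₂ j), ?_, fun m hm hmM => ⟨?_, ?_⟩⟩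
  · simp [hB₁, hB₂, unweight, pulse, tailPart]
  · have htm := h.pos hm hmM
    show 1 / s * (B₁ m + B₂ m) ≤ _
    rw [mul_assoc (1 / s)]
    refine mul_le_mul_of_nonneg_left ?_ (by positivity)
    have hS : 0 ≤ ∑ j ∈ Finset.Icc 1 m, (j : ℝ) ^ (-1 - k) * t j ^ q :=
      Finset.sum_nonneg fun j hj => hwt0 j (Finset.mem_Icc.mp hj).1
        ((Finset.mem_Icc.mp hj).2.trans hmM)
    rcases Nat.lt_or_ge p m with hpm | hpm
    · have hpt : t p ≤ t m := h.le hpm.le hmM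
      have h1 : w ≤ t m ^ q := by
        calc w ≤ 1 * t m ^ q := by rw [hw]; gcongr
          _ = _ := one_mul _
      have h2 : ∑ i ∈ Finset.Ioc p m, wt i ≤ ∑ j ∈ Finset.Icc 1 m, (j : ℝ) ^ (-1 - k) * t j ^ q := by
        refine Finset.sum_le_sum_of_subset_of_nonneg (fun j hj => ?_) fun j hj _ => ?_
        · have hj := Finset.mem_Ioc.mp hj
          exact Finset.mem_Icc.mpr ⟨by omega, hj.2⟩
        · have hj := Finset.mem_Icc.mp hj
          exact hwt0 j hj.1 (hj.2.trans hmM)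
      have h3 := hB₁le m
      calc B₁ m + B₂ m ≤ t m ^ (α - 1) * g m := by
            simp only [hB₂, tailPart, show ¬ m ≤ p by omega, if_false, hgp]
            linarith
        _ ≤ t m ^ (α - 1) * (t m ^ q + ∑ j ∈ Finset.Icc 1 m, (j : ℝ) ^ (-1 - k) * t j ^ q) := by
            simp only [hg]
            gcongr
        _ ≤ _ := le_mul_of_one_le_left (by positivity) (le_max_left _ _)
    · have hpt : t m ≤ t p := h.le hpm hpM
      have h1 := hgr.le_of_le_mul h hr hm hpm hpM (c := p) (le_mul_of_one_le_right hpR.le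
        (by exact_mod_cast hm))
      have h2 : t p ^ q ≤ D ^ q * t m ^ q := by
        rw [← Real.mul_rpow hD0.le htm.le]
        gcongr
      have h3 : t p ^ (α - 1) ≤ t m ^ (α - 1) :=
        Real.rpow_le_rpow_of_nonpos htm hpt (by linarith)
      have h4 := hB₁le m
      calc B₁ m + B₂ m ≤ w * t p ^ (α - 1) := by
            simp only [hB₂, tailPart, hpm, if_true]
            linarith
        _ ≤ 1 * (D ^ q * t m ^ q) * t m ^ (α - 1) := by rw [hw]; gcongr
        _ = D ^ q * (t m ^ (α - 1) * t m ^ q) := by ring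
        _ ≤ max 1 (D ^ q) * (t m ^ (α - 1) * t m ^ q) := by gcongr; exact le_max_right _ _
        _ ≤ _ := by gcongr; linarith
  · have htm := h.pos hm hmM
    have h' := h.mono_right hmM
    have hB₁m : scaledDelta α t B₁ m = cumWeight α β t m 1 * (w * t p ^ (α - 1)) :=
      scaledDelta_unweight_pulse hb.lt_one.ne hm _
    rw [scaledDelta_const_mul, scaledDelta_add, hB₁m, one_div, ← div_eq_inv_mul, le_div_iff₀ hs0]
    rcases Nat.lt_or_ge p m with hpm | hpm
    · obtain ⟨n, rfl⟩ : ∃ n, m = n + 2 := ⟨m - 2, by omega⟩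
      have hgr' : GradedMesh C₁ r (n + 2) t :=
        ⟨fun j hj hj' => hgr.tau_le j hj (hj'.trans hmM),
          fun i j hi hij hj => hgr.growth i j hi hij (hj.trans hmM)⟩
      have h1 := hmain (ε / 2) n t hε2 h' hgr' p g wt (by omega) (by omega)
        (fun i hi => by simp only [hg]; rw [Finset.sum_Ioc_succ_top hi]; ring)
        (fun i hi hi' => hwt0 i hi (hi'.trans hmM)) (by rw [hgp]; exact hw0.le)
      have h2 := le_leading_part hα₀ hα₁ hC₁ hr hk hq h' hgr' (show 1 ≤ p by omega) (by omega)
        (by omega) hc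
      have hgle : g (n + 2) ≤ t (n + 2) ^ q * (2 + Real.log (n + 2 : ℕ)) := by
        have h3 := sum_rpow_mul_rpow_le h hk hq hmM p
        have hpt : t p ≤ t (n + 2) := h.le hpm.le hmM
        have h4 : w ≤ t (n + 2) ^ q := by
          calc w ≤ 1 * t (n + 2) ^ q := by rw [hw]; gcongr
            _ = _ := one_mul _
        simp only [hg]
        linarith
      have h3 := remainder_le hα₁ hK.le hk (min_le_right α (1 - α)) hk4 hα₀ hq h' rfl hgle
      have h4 := hp₀ (n + 2) (by omega)
      have h5 : t (n + 2) ^ (-α) ≤ cumWeight α β t (n + 2) 1 := by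
        have := hb.le_cumWeight_of_add_three_le hα₀ hα₁ h' (i := 0) (by omega)
        rwa [h.start, sub_zero] at this
      have h6 : scaledDelta α t B₂ (n + 2) = _ := scaledDelta_tailPart (by omega) _
      rw [h6]
      have h7 := mul_le_mul_of_nonneg_right h5 hV0.le
      have h8 : 0 ≤ ((n + 2 : ℕ) : ℝ) ^ (-k) * t (n + 2) ^ (q - 1) := by positivity
      have h9 := mul_le_mul_of_nonneg_right h4 h8
      have h10 : s ≤ cs / 2 := min_le_left _ _
      have h11 := mul_le_mul_of_nonneg_left h10 h8
      rw [hgp] at h1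
      rw [← hw, ← hcs] at h2
      rw [← hκ] at h3
      simp only [hwt] at h1 h3
      linarith
    -- Up to `p` only the jump acts; `t m` and `t p` are comparable there, with ratio bounded by
    -- `D`, so the jump is enough.
    · have hpt : t m ≤ t p := h.le hpm hpM
      have h1 := hgr.le_of_le_mul h hr hm hpm hpM (c := p) (le_mul_of_one_le_right hpR.le
        (by exact_mod_cast hm))
      have h2 : scaledDelta α t B₂ m = 0 := scaledDelta_tailPart_of_le hpm _
      have h3 : c₀ * t m ^ (-α) ≤ cumWeight α β t m 1 := by
        have := hb.le_cumWeight hα₀ hα₁ h' (i := 0) (by omega)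
        rwa [h.start, sub_zero] at this
      have h4 : D ^ (α - 1) * t m ^ (α - 1) ≤ t p ^ (α - 1) := by
        rw [← Real.mul_rpow hD0.le htm.le]
        exact Real.rpow_le_rpow_of_nonpos hθ h1 (by linarith)
      have h5 : (m : ℝ) ^ (-k) ≤ 1 :=
        Real.rpow_le_one_of_one_le_of_nonpos (by exact_mod_cast hm) (by linarith)
      have h6 : s ≤ c₀ * (p : ℝ) ^ (-k) * D ^ (α - 1) := min_le_right _ _
      have h7 : t m ^ (q - 1) = t m ^ (-α) * t m ^ q * t m ^ (α - 1) := by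
        rw [← Real.rpow_add htm, ← Real.rpow_add htm]
        ring_nf
      rw [h2, add_zero]
      calc _ ≤ 1 * t m ^ (q - 1) * (c₀ * (p : ℝ) ^ (-k) * D ^ (α - 1)) := by gcongr
        _ = c₀ * t m ^ (-α) * ((p : ℝ) ^ (-k) * t m ^ q * (D ^ (α - 1) * t m ^ (α - 1))) := by
          rw [h7]; ring
        _ ≤ c₀ * t m ^ (-α) * ((p : ℝ) ^ (-k) * t p ^ q * t p ^ (α - 1)) := by gcongr
        _ ≤ _ := by gcongr

end

/-! ### Mesh conversions and the barrier for `γ < 0`. -/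

section

variable {α β ε r C₁ μ T γ σ : ℝ} {M m n : ℕ} {t : ℕ → ℝ}

/-- The bound on the ratios is `(1 + σ) / (1 - σ)`, and its reciprocal is at least `1 - 2 σ`. -/
theorem StepRatioCondition.nearUniformMesh (hs : StepRatioCondition σ M t) (hσ : 0 < σ)
    (hσ₁ : σ < 1) (h : IsMesh T M t) : NearUniformMesh (2 * σ) M t where
  start := h.start
  step := h.step
  mono j hj := by
    have h1 : 0 < tau t (j + 1) := sub_pos.mpr (h.step j (by omega))
    have h2 := hs.one_le (j + 2) (by omega) hj
    rw [rho, show j + 2 - 1 = j + 1 by omega, le_div_iff₀ h1, one_mul] at h2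
    exact h2
  ratio j hj := by
    have h1 : 0 < tau t (j + 1) := sub_pos.mpr (h.step j (by omega))
    have h3 : 0 < tau t (j + 2) := sub_pos.mpr (h.step (j + 1) (by omega))
    have h2 := hs.le_bound (j + 2) (by omega) hj
    have hσ' : 0 < 1 - σ := by linarith
    have e : 2 / (1 - σ) - 1 = (1 + σ) / (1 - σ) := by field_simp; ring
    rw [rho, show j + 2 - 1 = j + 1 by omega, e, div_le_div_iff₀ h1 hσ'] at h2
    rcases le_total (1 - 2 * σ) 0 with h0 | h0
    · exact (mul_nonpos_of_nonpos_of_nonneg h0 h3.le).trans h1.le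
    · have h4 := mul_le_mul_of_nonneg_left h2 h0
      have h5 : (1 - 2 * σ) * ((1 + σ) * tau t (j + 1)) ≤ (1 - σ) * tau t (j + 1) := by
        nlinarith [mul_nonneg (mul_nonneg hσ.le hσ.le) h1.le]
      refine le_of_mul_le_mul_left ?_ hσ'
      linarith

theorem QuasiGraded.gradedMesh (hq : QuasiGraded α γ r C₁ M t) (hC₁ : 0 < C₁) :
    GradedMesh C₁ r M t where
  tau_le j hj hjM := (hq.tau_equiv j hj hjM).1
  growth i j hi hij hjM := by
    have hi0 : (0 : ℝ) < (i : ℝ) ^ r := Real.rpow_pos_of_pos (by exact_mod_cast hi) _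
    have h1 := (hq.t_equiv j (hi.trans hij) hjM).1
    have h2 := (hq.t_equiv i hi (hij.trans hjM)).2
    rw [Real.div_rpow (Nat.cast_nonneg _) (Nat.cast_nonneg _)]
    have h3 : tau t 1 ≤ C₁ * t i / (i : ℝ) ^ r := by rwa [le_div_iff₀ hi0]
    calc t j ≤ C₁ * (tau t 1 * (j : ℝ) ^ r) := h1
      _ ≤ C₁ * (C₁ * t i / (i : ℝ) ^ r * (j : ℝ) ^ r) := by gcongr
      _ = _ := by field_simp

theorem mul_rpow_sub_one_le {q : ℝ} (hq₀ : 0 < q) (hq₁ : q < 1) (j : ℕ) :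
    q * ((j + 1 : ℕ) : ℝ) ^ (q - 1) ≤ ((j + 1 : ℕ) : ℝ) ^ q - (j : ℝ) ^ q := by
  set x : ℝ := ((j + 1 : ℕ) : ℝ) with hx
  have hx1 : (1 : ℝ) ≤ x := by rw [hx]; push_cast; linarith [Nat.cast_nonneg (α := ℝ) j]
  have hx0 : 0 < x := by linarith
  have hj : (j : ℝ) = x * (1 + -x⁻¹) := by
    rw [mul_add, mul_neg, mul_inv_cancel₀ hx0.ne', hx]; push_cast; ring
  have hinv : x⁻¹ ≤ 1 := inv_le_one_of_one_le₀ hx1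
  have h := rpow_one_add_le_one_add_mul_self (s := -x⁻¹) (by linarith) hq₀.le hq₁.le
  have hp : 0 < x ^ q := Real.rpow_pos_of_pos hx0 _
  have h2 := mul_le_mul_of_nonneg_left h hp.le
  rw [hj, Real.mul_rpow hx0.le (by linarith), Real.rpow_sub_one hx0.ne', div_eq_mul_inv]
  linarith

/-- Nondecreasing steps give `t_j ≤ (t_m / m) j`, and `∑ j ^ (q - 1) ≤ m ^ q / q`. For `q > 0` the
weights of the singular barrier thus cost no logarithm. -/
theorem NearUniformMesh.sum_rpow_le (h : NearUniformMesh ε M t) {q : ℝ} (hq₀ : 0 < q)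
    (hq₁ : q < 1) (hm : 1 ≤ m) (hmM : m ≤ M) :
    ∑ j ∈ Finset.Icc 1 m, (j : ℝ)⁻¹ * t j ^ q ≤ t m ^ q / q := by
  have hm0 : (0 : ℝ) < m := by exact_mod_cast hm
  have htm := h.pos hm hmM
  have h1 : ∀ N : ℕ, ∑ j ∈ Finset.Icc 1 N, (j : ℝ) ^ (q - 1) ≤ (N : ℝ) ^ q / q := by
    intro N
    induction N with
    | zero => simp [Real.zero_rpow hq₀.ne']
    | succ N ih =>
      rw [Finset.sum_Icc_succ_top (by omega)]
      have h2 := mul_rpow_sub_one_le hq₀ hq₁ N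
      rw [← le_div_iff₀' hq₀, sub_div] at h2
      linarith
  have h2 : ∀ j ∈ Finset.Icc 1 m, (j : ℝ)⁻¹ * t j ^ q ≤ (t m / m) ^ q * (j : ℝ) ^ (q - 1) := by
    intro j hj
    have hj := Finset.mem_Icc.mp hj
    have hj0 : (0 : ℝ) < j := by exact_mod_cast hj.1
    have h3 := h.mul_le_mul hj.2 hmM
    have h4 : t j ≤ t m / m * j := by
      rw [div_mul_eq_mul_div, le_div_iff₀ hm0]; linarith
    have h5 := h.pos hj.1 (hj.2.trans hmM)
    calc _ ≤ (j : ℝ)⁻¹ * (t m / m * j) ^ q := by gcongr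
      _ = _ := by rw [Real.mul_rpow (by positivity) hj0.le, Real.rpow_sub_one hj0.ne']; ring
  refine (Finset.sum_le_sum h2).trans ?_
  rw [← Finset.mul_sum]
  calc _ ≤ (t m / m) ^ q * ((m : ℝ) ^ q / q) := by gcongr; exact h1 m
    _ = (t m / m * m) ^ q / q := by rw [Real.mul_rpow (by positivity) hm0.le]; ring
    _ = _ := by rw [div_mul_cancel₀ _ hm0.ne']

/-- Barrier for the source `t^{-1-γ}`, `γ < 0`, on fine meshes. -/
theorem AdmissibleBeta.exists_barrier_of_neg (hb : AdmissibleBeta α β ε) (hα₀ : 0 < α)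
    (hα₁ : α < 1) (hC₁ : 0 < C₁) (hr : 0 ≤ r) (hμ : 0 ≤ μ) (hT : 0 < T) (hγ : γ < 0) :
    ∃ (p : ℕ) (h C : ℝ), 0 < h ∧ 0 < C ∧ ∀ M t, NearUniformMesh (ε / 2) M t →
      GradedMesh C₁ r M t → t M ≤ T → p ≤ M → tau t M ≤ h →
      ∃ B : ℕ → ℝ, B 0 = 0 ∧ ∀ m, 1 ≤ m → m ≤ M → B m ≤ C * t m ^ (α - 1 - γ) ∧
        t m ^ (-1 - γ) ≤ scaledDelta α t B m - μ * B m := by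
  rcases le_or_gt γ (α - 1) with hγα | hγα
  · obtain ⟨h, C, hh, hC, H⟩ := hb.exists_power_barrier hα₀ hα₁ hμ T
      (a := α - 1 - γ) (by linarith)
    refine ⟨0, h, C, hh, hC, fun M t hm _ hMT _ hτ => ?_⟩
    obtain ⟨B, hB0, hB⟩ := H M t hm hMT hτ
    refine ⟨B, hB0, fun m h1 h2 => ⟨(hB m h1 h2).1, ?_⟩⟩
    have := (hB m h1 h2).2
    rwa [show α - 1 - γ - α = -1 - γ by ring] at this
  · obtain ⟨h, Cp, hh, hCp, H⟩ := hb.exists_power_barrier hα₀ hα₁ hμ T (a := 0) le_rfl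
    obtain ⟨p, C₀, hC₀, H₀⟩ := hb.exists_singular_barrier hα₀ hα₁ hC₁ hr (k := 0) (q := -γ)
      le_rfl (by rw [mul_zero]; exact le_min hα₀.le (by linarith)) (by linarith)
    set C' := C₀ * (1 + 1 / (-γ)) with hC'
    have hC'0 : 0 < C' := by
      have : 0 < -γ := by linarith
      positivity
    set e := α - 1 - γ with he
    have he0 : e < 0 := by linarith
    -- For `t m ≤ h₀` the term `μ S` is at most half the source; for larger times it is at most the
    -- constant `L`, which a multiple of the barrier with `a = 0` cancels.
    set h₀ := (2 * (μ + 1) * C') ^ (-1 / α) with hh₀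
    have hh₀0 : 0 < h₀ := by positivity
    have hh₀α : h₀ ^ α = (2 * (μ + 1) * C')⁻¹ := by
      rw [hh₀, ← Real.rpow_mul (by positivity), show -1 / α * α = -1 by field_simp,
        Real.rpow_neg_one]
    set L := μ * C' * h₀ ^ e with hL
    have hL0 : 0 ≤ L := by positivity
    refine ⟨p, h, 2 * (C' + L * T ^ α * Cp * T ^ (-e)), hh, by positivity,
      fun M t hm hgr hMT hpM hτ => ?_⟩
    obtain ⟨B, hB0, hB⟩ := H M t hm hMT hτ
    obtain ⟨S, hS0, hS⟩ := H₀ M t hm hgr hpM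
    refine ⟨fun j => 2 * (S j + L * T ^ α * B j), by simp [hB0, hS0], fun m h1 h2 => ?_⟩
    have htm := hm.pos h1 h2
    have htT : t m ≤ T := (hm.le h2 le_rfl).trans hMT
    obtain ⟨b1, b2⟩ := hB m h1 h2
    obtain ⟨s1, s2⟩ := hS m h1 h2
    simp only [sub_zero, neg_zero, Real.rpow_zero, one_mul, mul_one, Real.rpow_neg_one,
      zero_sub] at b1 b2 s1 s2
    have hsum := hm.sum_rpow_le (q := -γ) (by linarith) (by linarith) h1 h2
    have s3 : S m ≤ C' * t m ^ e := by
      refine s1.trans ?_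
      have e1 : t m ^ e = t m ^ (α - 1) * t m ^ (-γ) := by
        rw [← Real.rpow_add htm, he, sub_eq_add_neg _ γ]
      calc _ ≤ C₀ * (t m ^ (α - 1) * (t m ^ (-γ) + t m ^ (-γ) / (-γ))) := by gcongr
        _ = _ := by rw [e1, hC']; ring
    have e2 : T ^ (-e) * T ^ e = 1 := by rw [← Real.rpow_add hT]; simp
    have e3 : T ^ e ≤ t m ^ e := Real.rpow_le_rpow_of_nonpos htm htT he0.le
    have e4 : T ^ α * T ^ (-α) = 1 := by rw [← Real.rpow_add hT]; simp
    have e5 : T ^ (-α) ≤ t m ^ (-α) := Real.rpow_le_rpow_of_nonpos htm htT (by linarith)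
    constructor
    · have h3 : L * T ^ α * B m ≤ L * T ^ α * Cp * T ^ (-e) * t m ^ e := by
        calc _ ≤ L * T ^ α * Cp := mul_le_mul_of_nonneg_left b1 (by positivity)
          _ = L * T ^ α * Cp * (T ^ (-e) * T ^ e) := by rw [e2, mul_one]
          _ ≤ L * T ^ α * Cp * (T ^ (-e) * t m ^ e) := by gcongr
          _ = _ := by ring
      linarith
    · rw [scaledDelta_const_mul, scaledDelta_add, scaledDelta_const_mul]
      have h3 : μ * S m ≤ μ * (C' * t m ^ e) := by gcongr
      have h4 : L ≤ L * T ^ α * (scaledDelta α t B m - μ * B m) := by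
        calc L = L * (T ^ α * T ^ (-α)) := by rw [e4, mul_one]
          _ = L * T ^ α * T ^ (-α) := by ring
          _ ≤ _ := by gcongr; linarith
      have h5 : μ * (C' * t m ^ e) ≤ t m ^ (-1 - γ) / 2 + L := by
        rcases le_total (t m) h₀ with hc | hc
        · have h6 : t m ^ α ≤ (2 * (μ + 1) * C')⁻¹ := by rw [← hh₀α]; gcongr
          have h7 : t m ^ e = t m ^ α * t m ^ (-1 - γ) := by
            rw [← Real.rpow_add htm, he]; ring_nf
          have h8 : 0 < t m ^ (-1 - γ) := Real.rpow_pos_of_pos htm _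
          calc μ * (C' * t m ^ e) ≤ (μ + 1) * (C' * t m ^ e) := by gcongr; linarith
            _ ≤ (μ + 1) * (C' * ((2 * (μ + 1) * C')⁻¹ * t m ^ (-1 - γ))) := by
              rw [h7]; gcongr
            _ = t m ^ (-1 - γ) / 2 := by field_simp
            _ ≤ _ := by linarith
        · have h6 : t m ^ e ≤ h₀ ^ e := Real.rpow_le_rpow_of_nonpos hh₀0 hc he0.le
          have h8 : 0 < t m ^ (-1 - γ) := Real.rpow_pos_of_pos htm _
          have h9 : μ * (C' * t m ^ e) ≤ L := by rw [hL, mul_assoc μ]; gcongr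
          linarith
      have h6 : t m ^ (-1 - γ) ≤ scaledDelta α t S m := by
        rwa [show -γ - 1 = -1 - γ by ring] at s2
      linarith

end

/-! ### The barrier on fine meshes. -/

section

variable {α β ε r C₁ μ T γ σ : ℝ} {M m n : ℕ} {t : ℕ → ℝ}

theorem tau_one_eq (h : t 0 = 0) : tau t 1 = t 1 := by simp [tau, h]

theorem one_le_ell (h₀ : 0 < tau t 1) (h : tau t 1 ≤ T) : 1 ≤ ell T γ t := by
  unfold ell
  split_ifs
  · have := Real.log_nonneg ((one_le_div h₀).mpr h)
    linarith
  · exact le_rfl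

theorem exists_sum_rpow_le {k : ℝ} (hk : 0 < k) :
    ∃ S : ℝ, 0 < S ∧ ∀ m : ℕ, ∑ j ∈ Finset.Icc 1 m, (j : ℝ) ^ (-1 - k) ≤ S := by
  have hs : Summable fun j : ℕ => (j : ℝ) ^ (-1 - k) := Real.summable_nat_rpow.mpr (by linarith)
  refine ⟨(∑' j : ℕ, (j : ℝ) ^ (-1 - k)) + 1, ?_, fun m => ?_⟩
  · have : 0 ≤ ∑' j : ℕ, (j : ℝ) ^ (-1 - k) := tsum_nonneg fun j => by positivity
    linarith
  · have := hs.sum_le_tsum (Finset.Icc 1 m) fun j _ => by positivity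
    linarith

theorem NearUniformMesh.tau_one_mem (h : NearUniformMesh ε M t) (hm : 1 ≤ m) (hmM : m ≤ M) :
    0 < tau t 1 ∧ tau t 1 ≤ t m := by
  rw [tau_one_eq h.start]
  exact ⟨h.pos le_rfl (hm.trans hmM), h.le hm hmM⟩

/-- The sum in the singular barrier is controlled by the factor `ℓ_γ`. -/
theorem exists_sum_rpow_le_ell {k : ℝ} (hC₁ : 0 < C₁) (hr : 1 ≤ r) (hk : 0 ≤ k)
    (hγ : γ ≠ 0 → 0 < k) (T : ℝ) :
    ∃ S : ℝ, 0 < S ∧ ∀ M t, NearUniformMesh ε M t → QuasiGraded α γ r C₁ M t → t M ≤ T →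
      ∀ m, 1 ≤ m → m ≤ M → 1 + ∑ j ∈ Finset.Icc 1 m, (j : ℝ) ^ (-1 - k) ≤ S * ell T γ t := by
  by_cases hγ0 : γ = 0
  · refine ⟨2 + |Real.log C₁|, by positivity, fun M t h hq hMT m hm hmM => ?_⟩
    obtain ⟨h1, h2⟩ := h.tau_one_mem hm hmM
    have htT : t m ≤ T := (h.le hmM le_rfl).trans hMT
    have hm1 : (1 : ℝ) ≤ m := by exact_mod_cast hm
    have hm0 : (0 : ℝ) < m := by linarith
    have h3 : ∑ j ∈ Finset.Icc 1 m, (j : ℝ) ^ (-1 - k) ≤ 1 + Real.log m := by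
      refine le_trans (Finset.sum_le_sum fun j hj => ?_) (sum_inv_le_one_add_log m)
      rw [← Real.rpow_neg_one]
      exact Real.rpow_le_rpow_of_exponent_le (by exact_mod_cast (Finset.mem_Icc.mp hj).1)
        (by linarith)
    have h4 : (m : ℝ) ≤ C₁ * (T / tau t 1) := by
      rw [← mul_div_assoc, le_div_iff₀ h1]
      calc (m : ℝ) * tau t 1 = tau t 1 * (m : ℝ) ^ (1 : ℝ) := by rw [Real.rpow_one]; ring
        _ ≤ tau t 1 * (m : ℝ) ^ r := by
          have := Real.rpow_le_rpow_of_exponent_le hm1 hr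
          gcongr
        _ ≤ C₁ * t m := (hq.t_equiv m hm hmM).2
        _ ≤ _ := by gcongr
    have h5 := Real.log_le_log hm0 h4
    have h6 : 1 ≤ T / tau t 1 := (one_le_div h1).mpr (h2.trans htT)
    rw [Real.log_mul hC₁.ne' (by positivity)] at h5
    have h7 := Real.log_nonneg h6
    have h8 := le_abs_self (Real.log C₁)
    have h9 := mul_nonneg (abs_nonneg (Real.log C₁)) h7
    simp only [ell, hγ0, if_true]
    linarith
  · obtain ⟨S, hS, H⟩ := exists_sum_rpow_le (hγ hγ0)
    refine ⟨1 + S, by positivity, fun M t _ _ _ m _ _ => ?_⟩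
    have := H m
    simp only [ell, hγ0, if_false]
    linarith

/-- Barrier on fine meshes, `γ ≥ 0`. -/
theorem AdmissibleBeta.exists_barrier_of_nonneg (hb : AdmissibleBeta α β ε) (hα₀ : 0 < α)
    (hα₁ : α < 1) (hC₁ : 0 < C₁) (hr : 1 ≤ r) (hμ : 0 ≤ μ) (hT : 0 < T) (hγ : 0 ≤ γ) :
    ∃ (p : ℕ) (h C : ℝ), 0 < h ∧ 0 < C ∧ ∀ M t, NearUniformMesh (ε / 2) M t →
      QuasiGraded α γ r C₁ M t → t M ≤ T → p ≤ M → tau t M ≤ h →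
      ∃ B : ℕ → ℝ, B 0 = 0 ∧ ∀ m, 1 ≤ m → m ≤ M → B m ≤ C * (ell T γ t * t m ^ (α - 1)) ∧
        (tau t 1 / t m) ^ γ * (t m)⁻¹ ≤ scaledDelta α t B m - μ * B m := by
  have hκ0 : 0 < min α (1 - α) := lt_min hα₀ (by linarith)
  -- The available decay is `m ^ (-r γ)`; it is reduced to an exponent that the singular barrier
  -- permits. This `k` vanishes only if `γ = 0`, where the logarithm appears.
  set k := min γ (min α (1 - α) / 4) with hk
  have hk0 : 0 ≤ k := le_min hγ (by positivity)
  obtain ⟨p₀, C₀, hC₀, H₀⟩ := hb.exists_singular_barrier hα₀ hα₁ hC₁ (zero_le_one.trans hr)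
    hk0 (by have := min_le_right γ (min α (1 - α) / 4); linarith) (q := 0) le_rfl
  -- The term `μ A` has size `ℓ_γ t ^ (α - 1)`, which is the source `t ^ (-1 - γ')` with `γ' = -α`;
  -- its barrier is bounded, hence below a multiple of `t ^ (α - 1)` on `(0, T]`.
  obtain ⟨p₁, h, Cn, hh, hCn, H₁⟩ := hb.exists_barrier_of_neg hα₀ hα₁ hC₁
    (zero_le_one.trans hr) hμ hT (γ := -α) (by linarith)
  obtain ⟨S, hS, HS⟩ := exists_sum_rpow_le_ell (α := α) (ε := ε / 2) (γ := γ) hC₁ hr hk0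
    (fun hne => lt_min (lt_of_le_of_ne hγ hne.symm) (by positivity)) T
  set D := C₁ ^ γ with hD
  have hD0 : 0 < D := by positivity
  refine ⟨max p₀ p₁, h, D * (C₀ * S * (1 + μ * Cn * T ^ α)), hh, by positivity,
    fun M t hm hq hMT hpM hτ => ?_⟩
  have hgr := hq.gradedMesh hC₁
  obtain ⟨A, hA0, hA⟩ := H₀ M t hm hgr ((le_max_left _ _).trans hpM)
  obtain ⟨B, hB0, hB⟩ := H₁ M t hm hgr hMT ((le_max_right _ _).trans hpM) hτ
  refine ⟨fun j => D * (A j + μ * (C₀ * S * ell T γ t) * B j), by simp [hA0, hB0],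
    fun m h1 h2 => ?_⟩
  have htm := hm.pos h1 h2
  have htT : t m ≤ T := (hm.le h2 le_rfl).trans hMT
  obtain ⟨hτ0, hτm⟩ := hm.tau_one_mem h1 h2
  have hell := one_le_ell (γ := γ) hτ0 (hτm.trans htT)
  have hell0 : 0 < ell T γ t := by linarith
  obtain ⟨a1, a2⟩ := hA m h1 h2
  obtain ⟨b1, b2⟩ := hB m h1 h2
  simp only [Real.rpow_zero, mul_one, zero_sub, Real.rpow_neg_one] at a1 a2
  have a3 : A m ≤ C₀ * S * (ell T γ t * t m ^ (α - 1)) := by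
    have := HS M t hm hq hMT m h1 h2
    calc _ ≤ C₀ * (t m ^ (α - 1) * (S * ell T γ t)) := by
          refine a1.trans ?_
          gcongr
      _ = _ := by ring
  constructor
  · have e1 : t m ^ (α - 1 - -α) ≤ T ^ α * t m ^ (α - 1) := by
      rw [sub_neg_eq_add, Real.rpow_add htm, mul_comm]
      gcongr
    have b3 : B m ≤ Cn * (T ^ α * t m ^ (α - 1)) := b1.trans (by gcongr)
    have b4 := mul_le_mul_of_nonneg_left b3 (show 0 ≤ μ * (C₀ * S * ell T γ t) by positivity)
    calc D * (A m + μ * (C₀ * S * ell T γ t) * B m) ≤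
        D * (C₀ * S * (ell T γ t * t m ^ (α - 1)) +
          μ * (C₀ * S * ell T γ t) * (Cn * (T ^ α * t m ^ (α - 1)))) := by gcongr
      _ = _ := by ring
  · rw [scaledDelta_const_mul, scaledDelta_add, scaledDelta_const_mul]
    have hm1 : (1 : ℝ) ≤ m := by exact_mod_cast h1
    have hm0 : (0 : ℝ) < m := by linarith
    have c1 : (tau t 1 / t m) ^ γ ≤ D * (m : ℝ) ^ (-k) := by
      have h3 := (hq.t_equiv m h1 h2).2
      have hmr : (0 : ℝ) < (m : ℝ) ^ r := Real.rpow_pos_of_pos hm0 _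
      have h4 : tau t 1 / t m ≤ C₁ * (m : ℝ) ^ (-r) := by
        rw [Real.rpow_neg hm0.le, div_le_iff₀ htm, mul_right_comm, ← div_eq_mul_inv,
          le_div_iff₀ hmr]
        exact h3
      calc _ ≤ (C₁ * (m : ℝ) ^ (-r)) ^ γ := by gcongr
        _ = D * (m : ℝ) ^ (-r * γ) := by
          rw [Real.mul_rpow hC₁.le (by positivity), ← Real.rpow_mul hm0.le]
        _ ≤ _ := by
          have : k ≤ γ := min_le_left _ _
          have := Real.rpow_le_rpow_of_exponent_le hm1 (show -r * γ ≤ -k by nlinarith)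
          gcongr
    have c2 : (tau t 1 / t m) ^ γ * (t m)⁻¹ ≤ D * scaledDelta α t A m := by
      calc _ ≤ D * (m : ℝ) ^ (-k) * (t m)⁻¹ := by gcongr
        _ = D * ((m : ℝ) ^ (-k) * (t m)⁻¹) := by ring
        _ ≤ _ := by gcongr
    have c3 : μ * A m ≤ μ * (C₀ * S * ell T γ t) * (scaledDelta α t B m - μ * B m) := by
      rw [show -1 - -α = α - 1 by ring] at b2
      calc _ ≤ μ * (C₀ * S * (ell T γ t * t m ^ (α - 1))) := by gcongr
        _ = μ * (C₀ * S * ell T γ t) * t m ^ (α - 1) := by ring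
        _ ≤ _ := by gcongr
    have c4 := mul_le_mul_of_nonneg_left c3 hD0.le
    linarith

/-- Barrier on fine meshes. -/
theorem AdmissibleBeta.exists_fine_barrier (hb : AdmissibleBeta α β ε) (hα₀ : 0 < α)
    (hα₁ : α < 1) (hC₁ : 0 < C₁) (hr : 1 ≤ r) (hμ : 0 ≤ μ) (hT : 0 < T) (γ : ℝ) :
    ∃ (M₀ : ℕ) (C : ℝ), 0 < C ∧ ∀ M t, M₀ ≤ M → NearUniformMesh (ε / 2) M t →
      QuasiGraded α γ r C₁ M t → t M = T → ∃ B : ℕ → ℝ, B 0 = 0 ∧ ∀ m, 1 ≤ m → m ≤ M →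
        B m ≤ C * barrier α T γ t m ∧
        (tau t 1 / t m) ^ (γ + 1) ≤ scaledDelta α t B m - μ * B m := by
  have hfine : ∀ h : ℝ, 0 < h → ∃ N : ℕ, 1 ≤ N ∧ ∀ M t, N ≤ M → QuasiGraded α γ r C₁ M t →
      t M = T → tau t M ≤ h := by
    intro h hh
    obtain ⟨N, hN⟩ := exists_nat_gt (C₁ * T / h)
    refine ⟨N + 1, by omega, fun M t hM hq hMT => ?_⟩
    have h1 := (hq.tau_equiv M (by omega) le_rfl).1
    have h2 : (N : ℝ) ≤ M := by exact_mod_cast (show N ≤ M by omega)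
    have hM0 : (0 : ℝ) < M := by exact_mod_cast (show 0 < M by omega)
    rw [hMT, ← mul_div_assoc] at h1
    refine h1.trans ?_
    rw [div_le_iff₀ hM0]
    rw [div_lt_iff₀ hh] at hN
    nlinarith
  rcases lt_or_ge γ 0 with hγ | hγ
  · obtain ⟨p, h, C, hh, hC, H⟩ := hb.exists_barrier_of_neg hα₀ hα₁ hC₁
      (zero_le_one.trans hr) hμ hT hγ
    obtain ⟨N, hN1, hN⟩ := hfine h hh
    refine ⟨max p N, C, hC, fun M t hM hm hq hMT => ?_⟩
    have hNM : N ≤ M := (le_max_right _ _).trans hM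
    obtain ⟨B, hB0, hB⟩ := H M t hm (hq.gradedMesh hC₁) hMT.le ((le_max_left _ _).trans hM)
      (hN M t hNM hq hMT)
    refine ⟨fun j => tau t 1 ^ (γ + 1) * B j, by simp [hB0], fun m h1 h2 => ?_⟩
    have htm := hm.pos h1 h2
    have hτ0 := (hm.tau_one_mem h1 h2).1
    have hτp : 0 < tau t 1 ^ (γ + 1) := Real.rpow_pos_of_pos hτ0 _
    obtain ⟨b1, b2⟩ := hB m h1 h2
    constructor
    · refine (mul_le_mul_of_nonneg_left b1 hτp.le).trans (le_of_eq ?_)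
      rw [barrier, ell, if_neg hγ.ne, min_eq_right hγ.le, Real.div_rpow hτ0.le htm.le,
        Real.rpow_add_one hτ0.ne', Real.rpow_sub htm _ γ]
      ring
    · rw [scaledDelta_const_mul, Real.div_rpow hτ0.le htm.le, div_eq_mul_inv,
        ← Real.rpow_neg htm.le, show -(γ + 1) = -1 - γ by ring]
      have := mul_le_mul_of_nonneg_left b2 hτp.le
      linarith
  · obtain ⟨p, h, C, hh, hC, H⟩ := hb.exists_barrier_of_nonneg hα₀ hα₁ hC₁ hr hμ hT hγ
    obtain ⟨N, hN1, hN⟩ := hfine h hh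
    refine ⟨max p N, C, hC, fun M t hM hm hq hMT => ?_⟩
    have hNM : N ≤ M := (le_max_right _ _).trans hM
    obtain ⟨B, hB0, hB⟩ := H M t hm hq hMT.le ((le_max_left _ _).trans hM)
      (hN M t hNM hq hMT)
    refine ⟨fun j => tau t 1 * B j, by simp [hB0], fun m h1 h2 => ?_⟩
    have htm := hm.pos h1 h2
    have hτ0 := (hm.tau_one_mem h1 h2).1
    obtain ⟨b1, b2⟩ := hB m h1 h2
    constructor
    · refine (mul_le_mul_of_nonneg_left b1 hτ0.le).trans (le_of_eq ?_)
      rw [barrier, min_eq_left hγ, Real.rpow_zero]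
      ring
    · rw [scaledDelta_const_mul, Real.rpow_add_one (by positivity)]
      have := mul_le_mul_of_nonneg_left b2 hτ0.le
      calc _ = tau t 1 * ((tau t 1 / t m) ^ γ * (t m)⁻¹) := by ring
        _ ≤ _ := by linarith

end

/-! ### Combining coarse and fine meshes, and the step restriction. -/

section

variable {α β ε r C₁ μ T γ σ : ℝ} {M m n : ℕ} {t : ℕ → ℝ}

/-- Barrier with constants that may depend on the number of steps. -/
theorem AdmissibleBeta.exists_barrier_of_card (hb : AdmissibleBeta α β ε) (hα₀ : 0 < α)
    (hα₁ : α < 1) (hC₁ : 0 < C₁) (hμ : 0 ≤ μ) (hT : 0 < T) (γ r : ℝ) (hM : 1 ≤ M) :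
    ∃ C : ℝ, 0 < C ∧ ∀ t, NearUniformMesh (ε / 2) M t →
      QuasiGraded α γ r C₁ M t → t M = T →
      (∀ j, 1 ≤ j → j ≤ M → μ < tau t j ^ (-α) * (1 / (1 - α))) →
      ∃ B : ℕ → ℝ, B 0 = 0 ∧ ∀ m, 1 ≤ m → m ≤ M →
        B m ≤ C * barrier α T γ t m ∧
        (tau t 1 / t m) ^ (γ + 1) ≤ scaledDelta α t B m - μ * B m := by
  obtain ⟨C, hC, H⟩ := hb.exists_coarse_barrier hα₀ hα₁ hμ hT hM
  have hM0 : (0 : ℝ) < M := by exact_mod_cast hM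
  set x := (M : ℝ) ^ (-r) / C₁ with hx
  have hx0 : 0 < x := by positivity
  set A := max 1 ((x / T) ^ (γ + 1)) with hA
  have hA0 : 0 < A := lt_of_lt_of_le one_pos (le_max_left _ _)
  refine ⟨A * C / (x * T ^ (α - 1)), by positivity, fun t hm hq hMT hstep => ?_⟩
  obtain ⟨B, hB0, hB⟩ := H t hm hMT hstep
  refine ⟨fun j => A * B j, by simp [hB0], fun m h1 h2 => ?_⟩
  have htm := hm.pos h1 h2
  have htT : t m ≤ T := hMT ▸ hm.le h2 le_rfl
  obtain ⟨hτ0, hτm⟩ := hm.tau_one_mem h1 h2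
  have hell := one_le_ell (γ := γ) hτ0 (hτm.trans htT)
  have hxτ : x ≤ tau t 1 := by rw [hx, div_le_iff₀' hC₁]; exact hq.tau_one.2
  have hle1 : tau t 1 / t m ≤ 1 := (div_le_one htm).mpr hτm
  have hq0 : 0 < tau t 1 / t m := by positivity
  obtain ⟨b1, b2⟩ := hB m h1 h2
  constructor
  · have h3 : 1 ≤ (tau t 1 / t m) ^ min 0 γ :=
      Real.one_le_rpow_of_pos_of_le_one_of_nonpos hq0 hle1 (min_le_left _ _)
    have h4 : T ^ (α - 1) ≤ t m ^ (α - 1) := Real.rpow_le_rpow_of_nonpos htm htT (by linarith)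
    calc A * B m ≤ A * C := by gcongr
      _ = A * C / (x * T ^ (α - 1)) * (1 * x * T ^ (α - 1) * 1) := by field_simp
      _ ≤ _ := by
        rw [barrier]
        gcongr
  · rw [scaledDelta_const_mul]
    have h3 : (tau t 1 / t m) ^ (γ + 1) ≤ A := by
      rcases le_total 0 (γ + 1) with h0 | h0
      · exact (Real.rpow_le_one hq0.le hle1 h0).trans (le_max_left _ _)
      · refine le_trans ?_ (le_max_right _ _)
        exact Real.rpow_le_rpow_of_nonpos (by positivity) (by gcongr) h0
    have h4 := mul_le_mul_of_nonneg_left b2 hA0.le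
    linarith

/-- Barrier with constants independent of the mesh. -/
theorem AdmissibleBeta.exists_barrier (hb : AdmissibleBeta α β ε) (hα₀ : 0 < α)
    (hα₁ : α < 1) (hC₁ : 0 < C₁) (hμ : 0 ≤ μ) (hT : 0 < T) (γ r : ℝ) :
    ∃ C : ℝ, 0 < C ∧ ∀ M t, 1 ≤ M → NearUniformMesh (ε / 2) M t →
      QuasiGraded α γ r C₁ M t → t M = T →
      (∀ j, 1 ≤ j → j ≤ M → μ < tau t j ^ (-α) * (1 / (1 - α))) →
      ∃ B : ℕ → ℝ, B 0 = 0 ∧ ∀ m, 1 ≤ m → m ≤ M →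
        B m ≤ C * barrier α T γ t m ∧
        (tau t 1 / t m) ^ (γ + 1) ≤ scaledDelta α t B m - μ * B m := by
  by_cases hr : 1 ≤ r
  swap
  · exact ⟨1, one_pos, fun M t _ _ hq => absurd hq.one_le_r hr⟩
  obtain ⟨M₀, C, hC, H⟩ := hb.exists_fine_barrier hα₀ hα₁ hC₁ hr hμ hT γ
  choose! D hD HD using fun (M : ℕ) (hM : 1 ≤ M) =>
    hb.exists_barrier_of_card hα₀ hα₁ hC₁ hμ hT γ r hM
  have hD' : ∀ M ∈ Finset.Icc 1 M₀, 0 ≤ D M := fun M hM => (hD M (Finset.mem_Icc.mp hM).1).le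
  have hsum := Finset.sum_nonneg hD'
  -- The sum dominates each of the finitely many constants for coarse meshes and makes the final
  -- constant independent of `M`.
  refine ⟨C + ∑ M ∈ Finset.Icc 1 M₀, D M, by positivity, fun M t hM hm hq hMT hstep => ?_⟩
  have hbar : ∀ m, 1 ≤ m → m ≤ M → 0 ≤ barrier α T γ t m := by
    intro m h1 h2
    have htm := hm.pos h1 h2
    obtain ⟨hτ0, hτm⟩ := hm.tau_one_mem h1 h2
    have hell := one_le_ell (γ := γ) hτ0 (hτm.trans (hMT ▸ hm.le h2 le_rfl))
    have : 0 ≤ ell T γ t := by linarith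
    rw [barrier]
    positivity
  rcases le_total M₀ M with hMM | hMM
  · obtain ⟨B, hB0, hB⟩ := H M t hMM hm hq hMT
    refine ⟨B, hB0, fun m h1 h2 => ⟨(hB m h1 h2).1.trans ?_, (hB m h1 h2).2⟩⟩
    have := hbar m h1 h2
    gcongr
    linarith
  · obtain ⟨B, hB0, hB⟩ := HD M hM t hm hq hMT hstep
    refine ⟨B, hB0, fun m h1 h2 => ⟨(hB m h1 h2).1.trans ?_, (hB m h1 h2).2⟩⟩
    have := hbar m h1 h2
    have h3 := Finset.single_le_sum hD' (Finset.mem_Icc.mpr ⟨hM, hMM⟩)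
    gcongr
    linarith

theorem mul_gamma_lt {lam τ : ℝ} (hα₁ : α < 1) (hτ : 0 < τ)
    (h : lam * τ ^ α < (Real.Gamma (2 - α))⁻¹) :
    lam * Real.Gamma (1 - α) < τ ^ (-α) * (1 / (1 - α)) := by
  have hα : 0 < 1 - α := by linarith
  have hΓ : 0 < Real.Gamma (1 - α) := Real.Gamma_pos_of_pos hα
  have hτα : 0 < τ ^ α := Real.rpow_pos_of_pos hτ _
  rw [show 2 - α = (1 - α) + 1 by ring, Real.Gamma_add_one hα.ne', ← one_div,
    lt_div_iff₀ (by positivity)] at h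
  rw [Real.rpow_neg hτ.le, ← div_eq_inv_mul, lt_div_iff₀ hτα, lt_div_iff₀ hα]
  linarith

end

end L2Subdiffusion

end

theorem mainTheorem6 (α : ℝ) (hα₀ : 0 < α) (hα₁ : α < 1) :
    ∃ σ : ℝ, 0 < σ ∧ σ < 1 ∧
      ∀ T lam γ r C₁ C₂ : ℝ, 0 < T → 0 ≤ lam → 0 < C₁ → 0 < C₂ →
        ∃ C : ℝ, 0 < C ∧
          ∀ (M : ℕ) (t : ℕ → ℝ),
            L2Subdiffusion.IsMesh T M t →
            L2Subdiffusion.StepRatioCondition σ M t →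
            L2Subdiffusion.QuasiGraded α γ r C₁ M t →
            (∀ j, 1 ≤ j → j ≤ M →
              lam * L2Subdiffusion.tau t j ^ α < (Real.Gamma (2 - α))⁻¹) →
            (∃ (β : ℕ → ℝ) (κ : ℕ → ℕ → ℝ), L2Subdiffusion.IsInverseMonotoneRep α M t β κ) ∧
            ∀ (β : ℕ → ℝ) (κ : ℕ → ℕ → ℝ), L2Subdiffusion.IsInverseMonotoneRep α M t β κ →
              ∀ U W : ℕ → ℝ, U 0 = 0 → W 0 = 0 →
                (∀ m, 1 ≤ m → m ≤ M →
                  (∑ j ∈ Finset.range (m + 1), κ m j * W j) - lam * U m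
                    ≤ C₂ * (L2Subdiffusion.tau t 1 / t m) ^ (γ + 1)) →
                (∀ j, 1 ≤ j → j ≤ M → (U j - β j * U (j - 1)) / (1 - β j) ≤ W j) →
                ∀ j, 1 ≤ j → j ≤ M → U j ≤ C * L2Subdiffusion.barrier α T γ t j := by
  open L2Subdiffusion in
  obtain ⟨β₀, hβ₀, hβ₁, hlast, ε, hε₀, hε₁, hmargin⟩ := exists_beta hα₀ hα₁
  have hb : AdmissibleBeta α β₀ ε := ⟨hβ₀, hβ₁, hlast, hε₀, hε₁, hmargin⟩
  -- The ratio condition with `σ` yields mesh parameter `2 σ`, and the estimates require `ε / 2`.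
  refine ⟨ε / 4, by linarith, by linarith, fun T lam γ r C₁ C₂ hT hlam hC₁ hC₂ => ?_⟩
  have hΓ : 0 < Real.Gamma (1 - α) := Real.Gamma_pos_of_pos (by linarith)
  obtain ⟨C, hC, H⟩ := hb.exists_barrier hα₀ hα₁ hC₁ (mul_nonneg hlam hΓ.le) hT γ r
  refine ⟨Real.Gamma (1 - α) * C₂ * C, by positivity, fun M t hmesh hratio hq hstep => ?_⟩
  have h : NearUniformMesh (ε / 2) M t := by
    have := hratio.nearUniformMesh (by linarith) (by linarith) hmesh
    rwa [show 2 * (ε / 4) = ε / 2 by ring] at this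
  have hM : 1 ≤ M := by
    by_contra hM
    obtain rfl : M = 0 := by omega
    exact hT.ne (hmesh.start.symm.trans hmesh.final)
  refine ⟨⟨_, _, hb.isInverseMonotoneRep hα₀ hα₁ h⟩, ?_⟩
  intro β κ hrep U W hU hW hF hUW
  have hτ : ∀ j, 1 ≤ j → j ≤ M → 0 < tau t j := by
    intro j hj hjM
    obtain ⟨i, rfl⟩ : ∃ i, j = i + 1 := ⟨j - 1, by omega⟩
    exact h.tau_pos hjM
  have hstep' : ∀ j, 1 ≤ j → j ≤ M →
      lam * Real.Gamma (1 - α) < tau t j ^ (-α) * (1 / (1 - α)) :=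
    fun j hj hjM => mul_gamma_lt hα₁ (hτ j hj hjM) (hstep j hj hjM)
  obtain ⟨B, hB0, hB⟩ := H M t hM h hq hmesh.final hstep'
  -- The given representation is compared with a barrier built from `β₀`. The factor `Γ(1 - α)`
  -- undoes the scaling in `scaledDelta`, and accordingly `H` was applied with `μ = lam * Γ(1 - α)`.
  have hcomp := hrep.comparison (B := fun j => Real.Gamma (1 - α) * C₂ * B j)
    (F := fun m => C₂ * (tau t 1 / t m) ^ (γ + 1)) hlam (fun m hm hmM => ?_) hU hW (by simp [hB0])
    hF hUW (fun m hm hmM => ?_)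
  · intro j hj hjM
    refine (hcomp j hjM).trans ?_
    rw [mul_assoc _ C]
    exact mul_le_mul_of_nonneg_left (hB j hj hjM).1 (by positivity)
  · have h1 := last_le_weight hα₀ hα₁ (h.mono_right hmM) hm
    have h2 : 0 < 1 - β m := sub_pos.mpr (hrep.beta_mem m hm hmM).2
    rw [hrep.diag_eq hα₁ h hm hmM, mul_comm, one_div, ← div_eq_inv_mul]
    refine mul_lt_mul_of_pos_left ?_ h2
    rw [lt_div_iff₀ hΓ]
    exact (hstep' m hm hmM).trans_le h1
  · have h1 : delta α t (fun j => Real.Gamma (1 - α) * C₂ * B j) m =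
        C₂ * scaledDelta α t B m := by
      rw [delta_eq_sum hα₁ _ h.start hm (h.mono_right hmM).step]
      change 1 / Real.Gamma (1 - α) *
        scaledDelta α t (fun j => Real.Gamma (1 - α) * C₂ * B j) m = _
      rw [scaledDelta_const_mul]
      field_simp
    rw [h1]
    have := mul_le_mul_of_nonneg_left (hB m hm hmM).2 hC₂.le
    linarith
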